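/- All graphs are finite, simple and undirected, and weighted graphs have edge weights $w:E\to\mathbb{R}_{\ge 0}$; $d_G$ denotes the shortest path distance of $G=(V,E,w)$ (with $d_G(u,v)=\infty$ if $u,v$ lie in different components). For $\rho>0$, a $\rho$-dominating set of $G$ is a set $S\subseteq V$ such that every $x\in V$ has some $y\in S$ with $d_G(x,y)\le\rho$. *Local search with swaps of size $s$* starts with $S=V$ and, as long as there is a $\rho$-dominating set $S'\subseteq V$ with $|S'|<|S|$ and $|S\setminus S'|+|S'\setminus S|\le s$, replaces $S$ by such an $S'$; when there is none, it returns $S$. **Theorem.** For every $h\in\mathbb{N}$ there are constants $C\in\mathbb N$ and $K\in\mathbb R$ and an algorithm $\mathcal A$, all depending only on $h$, such that the following holds for every graph $H$ with $h$ vertices, every nonempty weighted $n$-vertex graph $G=(V,E,w)$ that does not contain $H$ as a minor, and all $\epsilon\in(0,\frac12)$ and $\rho>0$. Put $s=\lceil C/\epsilon\rceil^2$, so $s=O_h(\epsilon^{-2})$. 1. Every set $S$ that local search with swaps of size $s$ can return (whichever $S'$ is chosen in each iteration) is a $\rho$-dominating set with $|S|\le(1+\epsilon)|\tilde S|$ for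 every $\rho$-dominating set $\tilde S$ of $G$. 2. Given $G$, $\epsilon$ and $\rho$, the algorithm $\mathcal A$ stops after at most $K\cdot n^{K/\epsilon^2}=n^{O_h(\epsilon^{-2})}$ steps and outputs a set that local search with swaps of size $s$ can return. In particular it outputs a $\rho$-dominating set of size at most $(1+\epsilon)$ times the minimum, that is, it is a PTAS for the metric $\rho$-dominating set problem under the uniform measure in $H$-minor-free graphs. Here an algorithm is a program for a random access machine with registers and arrays of natural numbers and of real numbers, on which each addition, subtraction, comparison, jump, load and store costs one step (no multiplication, division or rounding); the input is $n$, the adjacency matrix and the matrix of edge weights of $G$ with $V=\{0,\dots,n-1\}$, and the real numbers $\rho$ and $\epsilon$; the output is the indicator vector of a vertex set. -/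

import Mathlib

open scoped NNReal ENNReal

/-- `H` is a minor of `G`: there are pairwise disjoint branch sets in `G`, one for each vertex of
`H`, each inducing a (nonempty) connected subgraph of `G`, such that `G` has an edge between the
branch sets of any two adjacent vertices of `H`. -/
def IsGraphMinor {W V : Type*} (H : SimpleGraph W) (G : SimpleGraph V) : Prop :=
  ∃ B : W → Set V,
    (∀ x, (G.induce (B x)).Connected) ∧
    (∀ x y, x ≠ y → Disjoint (B x) (B y)) ∧
    (∀ x y, H.Adj x y → ∃ u ∈ B x, ∃ v ∈ B y, G.Adj u v)

/-- Shortest path distance in the graph `G` with nonnegative edge weights `w` (only the values of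
`w` on the edges of `G` matter); it is `∞` between different components. -/
noncomputable def weightedDist {V : Type*} (G : SimpleGraph V) (w : Sym2 V → ℝ≥0)
    (u v : V) : ℝ≥0∞ :=
  ⨅ p : G.Walk u v, (((p.edges.map w).sum : ℝ≥0) : ℝ≥0∞)

/-- `S` is a `ρ`-dominating set: every vertex is within distance `ρ` of some vertex of `S`. -/
def IsRhoDominating {V : Type*} (G : SimpleGraph V) (w : Sym2 V → ℝ≥0) (ρ : ℝ)
    (S : Finset V) : Prop :=
  ∀ x, ∃ y ∈ S, weightedDist G w x y ≤ ENNReal.ofReal ρ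

/-- One iteration of local search with swaps of size `s`: replace `S` by a strictly smaller
`ρ`-dominating set `S'` whose symmetric difference with `S` has at most `s` elements. -/
def LocalSearchStep {V : Type*} [DecidableEq V] (G : SimpleGraph V) (w : Sym2 V → ℝ≥0)
    (ρ : ℝ) (s : ℕ) (S S' : Finset V) : Prop :=
  IsRhoDominating G w ρ S' ∧ S'.card < S.card ∧ (S \ S').card + (S' \ S).card ≤ s

/-- `S` is a possible result of local search with swaps of size `s`: it is reached from the set of
all vertices by iterations of the search, and no further iteration is possible. -/
def IsLocalSearchResult {V : Type*} [Fintype V] [DecidableEq V] (G : SimpleGraph V)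
    (w : Sym2 V → ℝ≥0) (ρ : ℝ) (s : ℕ) (S : Finset V) : Prop :=
  Relation.ReflTransGen (LocalSearchStep G w ρ s) Finset.univ S ∧
    ∀ S', ¬ LocalSearchStep G w ρ s S S'

namespace RealRAM

/-- Instructions of an additive real random access machine. The machine has natural number
registers and arrays, and real number registers and arrays. Registers and arrays are named by
fixed numbers in the program text; positions inside an array are addressed indirectly, through a
natural number register. The only arithmetic is addition and subtraction (there is no
multiplication and no rounding of reals); each instruction costs one time unit. -/
inductive Instr : Type
  /-- natural register `d` becomes the constant `k` -/
  | natConst (d k : ℕ)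
  /-- natural register `d` becomes the sum of the natural registers `a` and `b` -/
  | natAdd (d a b : ℕ)
  /-- natural register `d` becomes the truncated difference of the natural registers `a`, `b` -/
  | natSub (d a b : ℕ)
  /-- natural register `d` becomes the entry of natural array `m` at the position in `a` -/
  | natLoad (d m a : ℕ)
  /-- the entry of natural array `m` at the position in `a` becomes natural register `b` -/
  | natStore (m a b : ℕ)
  /-- real register `d` becomes the constant `k` -/
  | realConst (d k : ℕ)
  /-- real register `d` becomes the sum of the real registers `a` and `b` -/
  | realAdd (d a b : ℕ)
  /-- real register `d` becomes the difference of the real registers `a` and `b` -/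
  | realSub (d a b : ℕ)
  /-- real register `d` becomes the entry of real array `m` at the position in natural
  register `a` -/
  | realLoad (d m a : ℕ)
  /-- the entry of real array `m` at the position in natural register `a` becomes real
  register `b` -/
  | realStore (m a b : ℕ)
  /-- go to line `l` -/
  | jump (l : ℕ)
  /-- go to line `l` if natural register `a` is at most natural register `b` -/
  | jumpNatLE (a b l : ℕ)
  /-- go to line `l` if real register `a` is at most real register `b` -/
  | jumpRealLE (a b l : ℕ)
  /-- stop -/
  | halt

/-- A program is a finite list of instructions, numbered from `0`. -/
abbrev Program : Type := List Instr

/-- A configuration of the machine: program counter, registers and arrays. -/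
structure Config : Type where
  pc : ℕ
  natReg : ℕ → ℕ
  natArr : ℕ → ℕ → ℕ
  realReg : ℕ → ℝ
  realArr : ℕ → ℕ → ℝ

/-- Update of position `i` of array `m`. -/
def setArr {α : Type} (f : ℕ → ℕ → α) (m i : ℕ) (x : α) : ℕ → ℕ → α :=
  Function.update f m (Function.update (f m) i x)

/-- Effect of one instruction; `none` means that the machine stops. -/
noncomputable def exec (c : Config) : Instr → Option Config
  | .natConst d k =>
      some { c with pc := c.pc + 1, natReg := Function.update c.natReg d k }
  | .natAdd d a b =>
      some { c with
        pc := c.pc + 1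
        natReg := Function.update c.natReg d (c.natReg a + c.natReg b) }
  | .natSub d a b =>
      some { c with
        pc := c.pc + 1
        natReg := Function.update c.natReg d (c.natReg a - c.natReg b) }
  | .natLoad d m a =>
      some { c with
        pc := c.pc + 1
        natReg := Function.update c.natReg d (c.natArr m (c.natReg a)) }
  | .natStore m a b =>
      some { c with
        pc := c.pc + 1
        natArr := setArr c.natArr m (c.natReg a) (c.natReg b) }
  | .realConst d k =>
      some { c with pc := c.pc + 1, realReg := Function.update c.realReg d (k : ℝ) }
  | .realAdd d a b =>
      some { c with
        pc := c.pc + 1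
        realReg := Function.update c.realReg d (c.realReg a + c.realReg b) }
  | .realSub d a b =>
      some { c with
        pc := c.pc + 1
        realReg := Function.update c.realReg d (c.realReg a - c.realReg b) }
  | .realLoad d m a =>
      some { c with
        pc := c.pc + 1
        realReg := Function.update c.realReg d (c.realArr m (c.natReg a)) }
  | .realStore m a b =>
      some { c with
        pc := c.pc + 1
        realArr := setArr c.realArr m (c.natReg a) (c.realReg b) }
  | .jump l => some { c with pc := l }
  | .jumpNatLE a b l =>
      some { c with pc := if c.natReg a ≤ c.natReg b then l else c.pc + 1 }
  | .jumpRealLE a b l =>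
      open Classical in
      some { c with pc := if c.realReg a ≤ c.realReg b then l else c.pc + 1 }
  | .halt => none

/-- One step; the machine also stops when the program counter leaves the program. -/
noncomputable def step (P : Program) (c : Config) : Option Config :=
  P[c.pc]?.bind (exec c)

/-- `RunsIn P t c c'`: started in `c`, the program `P` is in `c'` after exactly `t` steps. -/
inductive RunsIn (P : Program) : ℕ → Config → Config → Prop
  | refl (c : Config) : RunsIn P 0 c c
  | tail {t : ℕ} {c c' c'' : Config} :
      RunsIn P t c c' → step P c' = some c'' → RunsIn P (t + 1) c c''

/-- Started in `c`, the program `P` stops after exactly `t` steps, in the configuration `c'`. -/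
def HaltsIn (P : Program) (t : ℕ) (c c' : Config) : Prop :=
  RunsIn P t c c' ∧ step P c' = none

open Classical in
/-- The start configuration for a weighted graph on the vertices `0, …, n - 1` and the real
parameters `ρ` and `ε`: natural register `0` holds `n`, natural array `0` holds the adjacency
matrix (row by row, the entry for `i, j` at position `i * n + j`), real registers `0` and `1` hold
`ρ` and `ε`, and real array `0` holds the matrix of edge weights, with `0` for non-edges.
Everything else is `0`. -/
noncomputable def start {n : ℕ} (G : SimpleGraph (Fin n)) (w : Sym2 (Fin n) → ℝ≥0)
    (ρ ε : ℝ) : Config where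
  pc := 0
  natReg r := if r = 0 then n else 0
  natArr m a := if ∃ i j : Fin n, m = 0 ∧ a = i * n + j ∧ G.Adj i j then 1 else 0
  realReg r := if r = 0 then ρ else if r = 1 then ε else 0
  realArr m a :=
    ∑ i : Fin n, ∑ j : Fin n,
      if m = 0 ∧ a = i * n + j ∧ G.Adj i j then (w s(i, j) : ℝ) else 0

/-- A set of vertices is output as its indicator vector, in natural array `1`. -/
def Outputs {n : ℕ} (c : Config) (S : Finset (Fin n)) : Prop :=
  ∀ v : Fin n, c.natArr 1 v = if v ∈ S then 1 else 0

end RealRAM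

/-! Any dominating set `O` can be exchanged piecewise against a local optimum `L`. Assign every
vertex to a nearest centre in `L ∪ O` and join two centres whose Voronoi cells are adjacent. Cells
are connected, so a complete minor on `h` vertices in this exchange graph lifts to `G`, and with it
every `H` on `h` vertices. On a shortest walk from a vertex `v` to a centre that dominates it, every
cell met has a centre that dominates `v` too. Hence `v` is dominated by some `x ∈ L` and `y ∈ O`
that are equal or adjacent (`exists_exchange_graph`).

Graphs without such a minor have balanced separators of order `√|U|`
(`exists_separator_of_no_covey`). Recursive splitting covers the exchange graph by regions of at
most `q ^ 2` vertices, every edge inside one region, where the region sizes exceed the number of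
vertices by only an `O(1 / q)` fraction (`HasSplits.hasDivision`). For each region, trade the
vertices of `L` that lie in no other region for all vertices of `O` in it. This keeps domination and
is a legal swap, so it cannot gain. Summing over the regions bounds `|L|` by `|O|` plus twice the
total overlap (`card_le_of_hasDivision`), and `q` of order `1 / ε` makes the overlap small
(`IsLocalSearchResult.card_le`).

For the running time, programs are written in a small structured language whose compilation
preserves step counts, and are verified by timed Hoare triples (`Does`). The algorithm decides by
Bellman–Ford rounds which distances are at most `ρ`. It then enumerates swaps as `s`-digit numbers
in base `n + 1` (`exists_flipDigits`). Each pass over all numbers shrinks the set or shows it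
locally optimal, so `n + 1` passes suffice (`does_search`). For `n ≥ 2` all loops are bounded
through `B = (n + 1) ^ s`, and the total is `O(B ^ 5)`. -/

/-! ### Connected vertex sets. -/

section Connectivity

variable {V : Type*}

/-- Reachability by a walk of `G` that stays in `S`. -/
def LinkedIn (G : SimpleGraph V) (S : Set V) : V → V → Prop :=
  Relation.ReflTransGen (fun a b => G.Adj a b ∧ a ∈ S ∧ b ∈ S)

/-- `S` is nonempty and induces a connected subgraph of `G`. -/
def ConnSet (G : SimpleGraph V) (S : Set V) : Prop :=
  S.Nonempty ∧ ∀ u ∈ S, ∀ v ∈ S, LinkedIn G S u v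

variable {G : SimpleGraph V} {S T : Set V} {u v : V}

theorem LinkedIn.mono (hST : S ⊆ T) (h : LinkedIn G S u v) : LinkedIn G T u v :=
  Relation.ReflTransGen.mono (fun _ _ hab => ⟨hab.1, hST hab.2.1, hST hab.2.2⟩) _ _ h

theorem LinkedIn.symm (h : LinkedIn G S u v) : LinkedIn G S v u := by
  induction h with
  | refl => exact .refl
  | tail _ hbc ih => exact .head ⟨hbc.1.symm, hbc.2.2, hbc.2.1⟩ ih

theorem LinkedIn.trans {w : V} (h : LinkedIn G S u v) (h' : LinkedIn G S v w) :
    LinkedIn G S u w :=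
  Relation.ReflTransGen.trans h h'

theorem connSet_of_center (hu : u ∈ S) (h : ∀ v ∈ S, LinkedIn G S u v) : ConnSet G S :=
  ⟨⟨u, hu⟩, fun _ ha _ hb => (h _ ha).symm.trans (h _ hb)⟩

theorem connSet_singleton (G : SimpleGraph V) (u : V) : ConnSet G {u} :=
  connSet_of_center (u := u) rfl (by rintro v rfl; exact .refl)

theorem ConnSet.insert (hS : ConnSet G S) (hu : u ∈ S) (huv : G.Adj u v) :
    ConnSet G (insert v S) := by
  refine connSet_of_center (u := u) (Set.mem_insert_of_mem _ hu) ?_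
  rintro x (rfl | hx)
  · exact .single ⟨huv, Set.mem_insert_of_mem _ hu, Set.mem_insert _ _⟩
  · exact (hS.2 u hu x hx).mono (Set.subset_insert _ _)

/-- A connected set that meets a set `D` stays in `D` if no edge inside it leaves `D`. -/
theorem ConnSet.subset_of_closed (hS : ConnSet G S) (hu : u ∈ S) {D : Set V} (huD : u ∈ D)
    (hD : ∀ a ∈ D, a ∈ S → ∀ b ∈ S, G.Adj a b → b ∈ D) : S ⊆ D := by
  intro v hv
  have h := hS.2 u hu v hv
  clear hv
  induction h with
  | refl => exact huD
  | tail _ hbc ih => exact hD _ ih hbc.2.1 _ hbc.2.2 hbc.1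

/-- Passes from the relational notion, convenient for growing sets, to the one that `IsGraphMinor`
asks for. -/
theorem ConnSet.induce_connected (hS : ConnSet G S) : (G.induce S).Connected := by
  obtain ⟨⟨u, hu⟩, h⟩ := hS
  have : Nonempty S := ⟨⟨u, hu⟩⟩
  refine ⟨fun a b => ?_⟩
  obtain ⟨a, ha⟩ := a
  obtain ⟨b, hb⟩ := b
  have hab := h a ha b hb
  clear h
  induction hab with
  | refl => exact SimpleGraph.Reachable.refl _
  | @tail x y _ hxy ih =>
    refine (ih hxy.2.1).trans (SimpleGraph.Adj.reachable ?_)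
    exact hxy.1

/-- Connected sets grow to components. -/
theorem ConnSet.exists_component {S K : Finset V} (hK : ConnSet G (K : Set V)) (hKS : K ⊆ S) :
    ∃ D : Finset V, K ⊆ D ∧ D ⊆ S ∧ ConnSet G (D : Set V) ∧
      ∀ u ∈ D, ∀ v ∈ S, G.Adj u v → v ∈ D := by
  classical
  obtain ⟨a, ha⟩ := hK.1
  have hmem : ∀ v, v ∈ S.filter (fun v => LinkedIn G (S : Set V) a v) ↔
      v ∈ S ∧ LinkedIn G (S : Set V) a v := fun v => by simp
  refine ⟨S.filter (fun v => LinkedIn G (S : Set V) a v), fun v hv => ?_,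
    Finset.filter_subset _ _, ?_, ?_⟩
  · exact (hmem v).2 ⟨hKS hv, (hK.2 a ha v hv).mono (by exact_mod_cast hKS)⟩
  · refine connSet_of_center (u := a) (by simpa using ⟨hKS ha, .refl⟩) fun v hv => ?_
    have hv' := ((hmem v).1 hv).2
    clear hv
    induction hv' with
    | refl => exact .refl
    | @tail b c hab hbc ih =>
      refine Relation.ReflTransGen.tail ih ⟨hbc.1, ?_, ?_⟩
      · exact (hmem b).2 ⟨hbc.2.1, hab⟩
      · exact (hmem c).2 ⟨hbc.2.2, hab.tail hbc⟩
  · intro u hu v hv huv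
    have hu' := (hmem u).1 hu
    exact (hmem v).2 ⟨hv, hu'.2.tail ⟨huv, hu'.1, hv⟩⟩

end Connectivity

/-! ### Small connected transversals, thin cuts and coveys. -/

section Separator

variable {V : Type*} [DecidableEq V] {G : SimpleGraph V}

/-- Either a small connected set meets all of `A 0, …, A (k - 1)`, or few vertices separate `D`
into connected pieces none of which meets all of them. -/
theorem exists_connSet_or_cut (G : SimpleGraph V) (D : Finset V) (A : ℕ → Set V) (k : ℕ) {m : ℕ}
    (hm : 0 < m) :
    (∃ T : Finset V, T ⊆ D ∧ ConnSet G (T : Set V) ∧ T.card ≤ m ∧ ∀ i < k, ∃ v ∈ T, v ∈ A i) ∨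
    (∃ Z ⊆ D, m * Z.card ≤ (k + 1) * D.card ∧
      ∀ K : Finset V, K ⊆ D \ Z → ConnSet G (K : Set V) → ∃ i < k, ∀ v ∈ K, v ∉ A i) := by
  classical
  -- A breadth-first search on pairs `(v, i)`: `i` counts the sets already met on the way to `v`,
  -- and `j` is the budget of vertices.
  let Q : ℕ → V → ℕ → Prop := fun j v i => ∃ T : Finset V, T ⊆ D ∧ ConnSet G (T : Set V) ∧
    v ∈ T ∧ T.card ≤ j ∧ ∀ i' < i, ∃ u ∈ T, u ∈ A i'
  let R : ℕ → Finset (V × ℕ) := fun j =>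
    (D ×ˢ Finset.range (k + 1)).filter (fun x => Q j x.1 x.2)
  have hR : ∀ j v i, (v, i) ∈ R j ↔ (v ∈ D ∧ i < k + 1) ∧ Q j v i := fun j v i => by simp [R]
  have hQmono : ∀ j v i, Q j v i → Q (j + 1) v i := by
    rintro j v i ⟨T, h1, h2, h3, h4, h5⟩
    exact ⟨T, h1, h2, h3, h4.trans (Nat.le_succ _), h5⟩
  have hQle : ∀ j j' v i, j ≤ j' → Q j v i → Q j' v i := by
    rintro j j' v i hj ⟨T, h1, h2, h3, h4, h5⟩
    exact ⟨T, h1, h2, h3, h4.trans hj, h5⟩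
  have hRmono : ∀ j, R j ⊆ R (j + 1) := by
    rintro j ⟨v, i⟩ hx
    rw [hR] at hx ⊢
    exact ⟨hx.1, hQmono _ _ _ hx.2⟩
  have hsum : ∀ l, ∑ j ∈ Finset.range l, (R (j + 1) \ R j).card + (R 0).card = (R l).card := by
    intro l
    induction l with
    | zero => simp
    | succ l ih =>
      rw [Finset.sum_range_succ, ← Finset.card_sdiff_add_card_eq_card (hRmono l), ← ih]
      ring
  have hRcard : (R m).card ≤ (k + 1) * D.card := by
    refine (Finset.card_filter_le _ _).trans ?_
    rw [Finset.card_product, Finset.card_range, mul_comm]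
  -- The `m` increments of the growing levels `R 0 ⊆ … ⊆ R m` add up to at most `(k + 1) * D.card`,
  -- so one of them is at most the average.
  obtain ⟨j, hjm, hj⟩ : ∃ j < m, m * (R (j + 1) \ R j).card ≤ (k + 1) * D.card := by
    by_contra! hcon
    have h1 : ∑ j ∈ Finset.range m, ((k + 1) * D.card + 1) ≤
        ∑ j ∈ Finset.range m, m * (R (j + 1) \ R j).card :=
      Finset.sum_le_sum fun j hj => hcon j (Finset.mem_range.1 hj)
    rw [← Finset.mul_sum, Finset.sum_const, Finset.card_range, smul_eq_mul] at h1
    have h2 := Nat.le_of_mul_le_mul_left h1 hm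
    have h3 := hsum m
    omega
  by_cases hex : ∃ T : Finset V, T ⊆ D ∧ ConnSet G (T : Set V) ∧ T.card ≤ m ∧
      ∀ i < k, ∃ v ∈ T, v ∈ A i
  · exact Or.inl hex
  right
  -- The cut is the projection of the thin increment; off it, levels `j` and `j + 1` coincide.
  refine ⟨(R (j + 1) \ R j).image Prod.fst, ?_, ?_, ?_⟩
  · intro v hv
    simp only [Finset.mem_image, Finset.mem_sdiff, Prod.exists, exists_and_right, exists_eq_right]
      at hv
    obtain ⟨i, hi, -⟩ := hv
    exact ((hR _ _ _).1 hi).1.1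
  · exact (Nat.mul_le_mul_left _ Finset.card_image_le).trans hj
  intro K hK hKc
  by_contra! hcon
  have hKD : ∀ v ∈ K, v ∈ D := fun v hv => (Finset.mem_sdiff.1 (hK hv)).1
  have hdown : ∀ v ∈ K, ∀ i < k + 1, Q (j + 1) v i → Q j v i := by
    intro v hv i hi hq
    by_contra hq'
    refine (Finset.mem_sdiff.1 (hK hv)).2 (Finset.mem_image.2 ⟨(v, i), ?_, rfl⟩)
    rw [Finset.mem_sdiff, hR, hR]
    exact ⟨⟨⟨hKD v hv, hi⟩, hq⟩, fun h => hq' h.2⟩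
  -- Induction on the number of sets met. A vertex of `K` in `A i` advances to `i + 1` with the same
  -- witness. Along edges of `K` the witness grows by one vertex, which `hdown` absorbs because `K`
  -- avoids the cut.
  have hall : ∀ i < k + 1, ∀ v ∈ K, Q j v i := by
    intro i
    induction i with
    | zero =>
      intro hi v hv
      refine hdown v hv 0 hi (hQle 1 _ _ _ (by omega) ⟨{v}, ?_, ?_, ?_, ?_, ?_⟩)
      · simpa using hKD v hv
      · simpa using connSet_singleton G v
      · simp
      · simp
      · simp
    | succ i ih =>
      intro hi
      obtain ⟨v, hvK, hvA⟩ := hcon i (by omega)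
      have hv : Q j v (i + 1) := by
        obtain ⟨T, h1, h2, h3, h4, h5⟩ := ih (by omega) v hvK
        refine ⟨T, h1, h2, h3, h4, fun i' hi' => ?_⟩
        rcases Nat.lt_succ_iff_lt_or_eq.1 hi' with h | rfl
        · exact h5 _ h
        · exact ⟨v, h3, hvA⟩
      have := hKc.subset_of_closed (D := {x | Q j x (i + 1)}) hvK hv ?_
      · intro x hx
        exact this hx
      · rintro a ⟨T, h1, h2, h3, h4, h5⟩ - b hb hab
        refine hdown b hb _ hi ⟨insert b T, ?_, ?_, ?_, ?_, ?_⟩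
        · exact Finset.insert_subset (hKD b hb) h1
        · rw [Finset.coe_insert]
          exact h2.insert h3 hab
        · simp
        · exact (Finset.card_insert_le _ _).trans (by omega)
        · intro i' hi'
          obtain ⟨u, hu, hu'⟩ := h5 i' hi'
          exact ⟨u, Finset.mem_insert_of_mem hu, hu'⟩
  obtain ⟨v, hv⟩ := hKc.1
  obtain ⟨T, h1, h2, h3, h4, h5⟩ := hall k (by omega) v hv
  exact hex ⟨T, h1, h2, h4.trans hjm.le, h5⟩

/-- Pairwise disjoint and pairwise adjacent connected sets `C i`, `i ∈ I`. -/
structure IsCovey {h : ℕ} (G : SimpleGraph V) (I : Finset (Fin h)) (C : Fin h → Finset V) :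
    Prop where
  conn : ∀ i ∈ I, ConnSet G (C i : Set V)
  disj : ∀ i ∈ I, ∀ j ∈ I, i ≠ j → Disjoint (C i) (C j)
  adj : ∀ i ∈ I, ∀ j ∈ I, i ≠ j → ∃ u ∈ C i, ∃ v ∈ C j, G.Adj u v

omit [DecidableEq V] in
theorem IsCovey.mono {h : ℕ} {I J : Finset (Fin h)} {C : Fin h → Finset V} (hC : IsCovey G I C)
    (hJ : J ⊆ I) : IsCovey G J C :=
  ⟨fun i hi => hC.conn i (hJ hi), fun i hi j hj => hC.disj i (hJ hi) j (hJ hj),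
    fun i hi j hj => hC.adj i (hJ hi) j (hJ hj)⟩

omit [DecidableEq V] in
-- Serves both for adding a new member and for enlarging an old one, as the covey condition is
-- required only away from `i`.
theorem IsCovey.update {h : ℕ} {I : Finset (Fin h)} {C : Fin h → Finset V} {i : Fin h}
    {B : Finset V} (hC : IsCovey G (I.erase i) C) (hB : ConnSet G (B : Set V))
    (hd : ∀ j ∈ I, j ≠ i → Disjoint B (C j))
    (ha : ∀ j ∈ I, j ≠ i → ∃ u ∈ B, ∃ v ∈ C j, G.Adj u v) :
    IsCovey G I (Function.update C i B) := by
  refine ⟨fun j hj => ?_, fun j hj l hl hjl => ?_, fun j hj l hl hjl => ?_⟩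
  · by_cases hji : j = i
    · subst hji; simpa using hB
    · simpa [hji] using hC.conn j (Finset.mem_erase.2 ⟨hji, hj⟩)
  · by_cases hji : j = i
    · subst hji
      simpa [hjl.symm] using hd l hl hjl.symm
    · by_cases hli : l = i
      · subst hli
        simpa [hji] using (hd j hj hji).symm
      · simpa [hji, hli] using hC.disj j (Finset.mem_erase.2 ⟨hji, hj⟩) l
          (Finset.mem_erase.2 ⟨hli, hl⟩) hjl
  · by_cases hji : j = i
    · subst hji
      simpa [hjl.symm] using ha l hl hjl.symm
    · by_cases hli : l = i
      · subst hli
        obtain ⟨u, hu, v, hv, huv⟩ := ha j hj hji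
        exact ⟨v, by simpa [hji] using hv, u, by simpa using hu, huv.symm⟩
      · simpa [hji, hli] using hC.adj j (Finset.mem_erase.2 ⟨hji, hj⟩) l
          (Finset.mem_erase.2 ⟨hli, hl⟩) hjl

end Separator

/-! ### Balanced separators in graphs without a covey of `h` sets. -/

section SeparatorTheorem

variable {V : Type*} [DecidableEq V] {G : SimpleGraph V}

/-- The situation in the proof of the separator theorem: a covey `C i`, `i ∈ I`, with small parts
`X i` that cut off a large connected set `D`. -/
structure CoveyState {h : ℕ} (G : SimpleGraph V) (U : Finset V) (m : ℕ) (I : Finset (Fin h))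
    (C X : Fin h → Finset V) (D : Finset V) : Prop where
  covey : IsCovey G I C
  subset : ∀ i ∈ I, C i ⊆ U
  disj : ∀ i ∈ I, Disjoint (C i) D
  cut_subset : ∀ i ∈ I, X i ⊆ C i
  cut_card : ∀ i ∈ I, (X i).card ≤ m
  big_subset : D ⊆ U
  big_conn : ConnSet G (D : Set V)
  big_card : U.card < 2 * D.card
  closed : ∀ u ∈ D, ∀ v ∈ U, G.Adj u v → v ∈ D ∨ ∃ i ∈ I, v ∈ X i

theorem exists_mem_inter_of_card {U D D' : Finset V} (hD : D ⊆ U) (hD' : D' ⊆ U)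
    (h : U.card < 2 * D.card) (h' : U.card < 2 * D'.card) : ∃ v ∈ D, v ∈ D' := by
  by_contra! hcon
  have hdis : Disjoint D D' := Finset.disjoint_left.2 hcon
  have := Finset.card_le_card (Finset.union_subset hD hD')
  rw [Finset.card_union_of_disjoint hdis] at this
  omega

variable {h : ℕ} {U : Finset V} {m : ℕ}

/-- Every small set leaves a large component. -/
def HasBigComponents (G : SimpleGraph V) (U : Finset V) (M : ℕ) : Prop :=
  ∀ X ⊆ U, X.card ≤ M →
    ∃ K ⊆ U \ X, ConnSet G (K : Set V) ∧ U.card < 2 * K.card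

theorem HasBigComponents.exists_component {M : ℕ} (hb : HasBigComponents G U M) {X : Finset V}
    (hX : X ⊆ U) (hXc : X.card ≤ M) :
    ∃ D ⊆ U \ X, ConnSet G (D : Set V) ∧ U.card < 2 * D.card ∧
      ∀ u ∈ D, ∀ v ∈ U, G.Adj u v → v ∈ D ∨ v ∈ X := by
  obtain ⟨K, hK, hKc, hKb⟩ := hb X hX hXc
  obtain ⟨D, hKD, hD, hDc, hDcl⟩ := hKc.exists_component hK
  refine ⟨D, hD, hDc, ?_, fun u hu v hv huv => ?_⟩
  · have := Finset.card_le_card hKD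
    omega
  · by_cases hvX : v ∈ X
    · exact Or.inr hvX
    · exact Or.inl (hDcl u hu v (Finset.mem_sdiff.2 ⟨hv, hvX⟩) huv)

/-- After changing the cut sets, the new large component lies in the part `P` of the old one that
the new cut sets separate from the rest. -/
theorem HasBigComponents.exists_coveyState {J : Finset (Fin h)} {C' X' : Fin h → Finset V}
    {P : Finset V} (hb : HasBigComponents G U (h * m)) (hC' : IsCovey G J C')
    (hsub : ∀ i ∈ J, C' i ⊆ U) (hX' : ∀ i ∈ J, X' i ⊆ C' i) (hX'c : ∀ i ∈ J, (X' i).card ≤ m)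
    (hdisj : ∀ i ∈ J, Disjoint (C' i) P) (hPb : ∃ D₁ ⊆ P, D₁ ⊆ U ∧ U.card < 2 * D₁.card)
    (hP : ∀ u ∈ P, ∀ v ∈ U, G.Adj u v → v ∈ P ∨ ∃ i ∈ J, v ∈ X' i) :
    ∃ D' ⊆ P, CoveyState G U m J C' X' D' := by
  have hmem : ∀ v, v ∈ J.biUnion X' ↔ ∃ i ∈ J, v ∈ X' i := fun v => Finset.mem_biUnion
  have hXU : J.biUnion X' ⊆ U := by
    intro v hv
    obtain ⟨i, hi, hv⟩ := (hmem v).1 hv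
    exact hsub i hi (hX' i hi hv)
  have hXc : (J.biUnion X').card ≤ h * m := by
    refine (Finset.card_biUnion_le_card_mul J X' m hX'c).trans (Nat.mul_le_mul_right _ ?_)
    simpa using Finset.card_le_univ J
  obtain ⟨D', hD', hD'c, hD'b, hD'cl⟩ := hb.exists_component hXU hXc
  obtain ⟨D₁, hD₁P, hD₁U, hD₁⟩ := hPb
  have hD'U : D' ⊆ U := hD'.trans Finset.sdiff_subset
  obtain ⟨v, hv₁, hv⟩ := exists_mem_inter_of_card hD₁U hD'U hD₁ hD'b
  -- Two sets containing more than half of `U` intersect, so `D'` meets `P`; it cannot leave `P`,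
  -- whose boundary in `U` was deleted together with the sets `X' i`.
  have hD'P : D' ⊆ P := by
    have := hD'c.subset_of_closed (D := (P : Set V)) hv (hD₁P hv₁) ?_
    · exact_mod_cast this
    · intro a ha ha' b hb hab
      rcases hP a ha b (hD'U hb) hab with h1 | h1
      · exact h1
      · exact absurd ((hmem b).2 h1) (Finset.mem_sdiff.1 (hD' hb)).2
  refine ⟨D', hD'P, hC', hsub, fun i hi => ?_, hX', hX'c, hD'U, hD'c, hD'b, ?_⟩
  · exact Finset.disjoint_of_subset_right hD'P (hdisj i hi)
  · intro u hu v hv huv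
    rcases hD'cl u hu v hv huv with h1 | h1
    · exact Or.inl h1
    · exact Or.inr ((hmem v).1 h1)

/-- While the covey is incomplete, the state can be improved. A member without an edge to `D` is
dropped. Otherwise `exists_connSet_or_cut` is applied in `D` to the neighbourhoods of the members. A
small connected set meeting all of them becomes a new member and its own cut set. A small cut
instead leaves a large component that misses the neighbourhood of some member, and this member is
enlarged into `D`. In both of these cases `D` shrinks; the weight `h + 1` on `D.card` lets `I`
change freely then. -/
theorem CoveyState.exists_covey (hm : 0 < m) (hcard : (h + 1) * U.card ≤ m * m)
    (hb : HasBigComponents G U (h * m)) :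
    ∀ (N : ℕ) (I : Finset (Fin h)) (C X : Fin h → Finset V) (D : Finset V),
      CoveyState G U m I C X D → D.card * (h + 1) + I.card ≤ N →
      ∃ C' : Fin h → Finset V, IsCovey G Finset.univ C' ∧ ∀ i, C' i ⊆ U := by
  intro N
  induction N with
  | zero =>
    intro I C X D hst hN
    -- The measure cannot be zero: `D` has more than half of the vertices of `U`, so it is nonempty.
    have := hst.big_card
    have h2 : D.card * (h + 1) = 0 := by omega
    rw [Nat.mul_eq_zero] at h2
    omega
  | succ N ih =>
    intro I C X D hst hN
    have hshrink : ∀ D' : Finset V, D'.card < D.card → ∀ J : Finset (Fin h),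
        D'.card * (h + 1) + J.card ≤ N := by
      intro D' hD' J
      have h1 : (D'.card + 1) * (h + 1) ≤ D.card * (h + 1) := Nat.mul_le_mul_right _ hD'
      have h2 : J.card ≤ h := by simpa using Finset.card_le_univ J
      rw [add_mul] at h1
      omega
    by_cases hI : I = Finset.univ
    · subst hI
      exact ⟨C, hst.covey, fun i => hst.subset i (Finset.mem_univ _)⟩
    by_cases hno : ∃ i ∈ I, ∀ u ∈ D, ∀ v ∈ C i, ¬ G.Adj u v
    · obtain ⟨i, hi, hno⟩ := hno
      refine ih (I.erase i) C X D ⟨hst.covey.mono (Finset.erase_subset _ _),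
        fun j hj => hst.subset j (Finset.mem_of_mem_erase hj),
        fun j hj => hst.disj j (Finset.mem_of_mem_erase hj),
        fun j hj => hst.cut_subset j (Finset.mem_of_mem_erase hj),
        fun j hj => hst.cut_card j (Finset.mem_of_mem_erase hj),
        hst.big_subset, hst.big_conn, hst.big_card, ?_⟩ ?_
      · intro u hu v hv huv
        rcases hst.closed u hu v hv huv with h1 | ⟨j, hj, hvj⟩
        · exact Or.inl h1
        · refine Or.inr ⟨j, Finset.mem_erase.2 ⟨?_, hj⟩, hvj⟩
          rintro rfl
          exact hno u hu v (hst.cut_subset j hj hvj) huv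
      · rw [Finset.card_erase_of_mem hi]
        have := Finset.card_pos.2 ⟨i, hi⟩
        omega
    push Not at hno
    -- Indices outside `I` get the whole vertex set, so they impose no condition on a transversal
    -- and cannot be the set that a nonempty component misses.
    let A : ℕ → Set V := fun l =>
      if hl : l < h then if (⟨l, hl⟩ : Fin h) ∈ I then {u | ∃ v ∈ C ⟨l, hl⟩, G.Adj u v}
        else Set.univ else Set.univ
    have hA : ∀ i : Fin h, i ∈ I → ∀ u, u ∈ A i ↔ ∃ v ∈ C i, G.Adj u v := by
      intro i hi u
      simp [A, hi]
    have hA' : ∀ i : Fin h, i ∉ I → ∀ u, u ∈ A i := by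
      intro i hi u
      simp [A, hi]
    rcases exists_connSet_or_cut G D A h hm with ⟨T, hTD, hTc, hTm, hTA⟩ | ⟨Z, hZD, hZm, hZ⟩
    · obtain ⟨i, hi⟩ : ∃ i, i ∉ I := by
        by_contra! hcon
        exact hI (Finset.eq_univ_of_forall hcon)
      have hne : ∀ j ∈ I, j ≠ i := fun j hj hji => hi (hji ▸ hj)
      have hcov : IsCovey G (insert i I) (Function.update C i T) := by
        refine IsCovey.update ?_ hTc (fun j hj hji => ?_) (fun j hj hji => ?_)
        · rw [Finset.erase_insert hi]; exact hst.covey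
        · have hj := Finset.mem_of_mem_insert_of_ne hj hji
          exact (Finset.disjoint_of_subset_right hTD (hst.disj j hj)).symm
        · have hj := Finset.mem_of_mem_insert_of_ne hj hji
          obtain ⟨u, hu, hu'⟩ := hTA j j.2
          obtain ⟨v, hv, huv⟩ := (hA j hj u).1 hu'
          exact ⟨u, hu, v, hv, huv⟩
      have hmemI : ∀ {Q : Fin h → Prop}, Q i → (∀ j ∈ I, Q j) → ∀ j ∈ insert i I, Q j := by
        intro Q h1 h2 j hj
        rcases Finset.mem_insert.1 hj with rfl | hj
        exacts [h1, h2 j hj]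
      have hTU : T ⊆ U := hTD.trans hst.big_subset
      obtain ⟨D₁, hD₁, hD₁c, hD₁b, -⟩ : ∃ D₁ ⊆ U \ ((insert i I).biUnion
          (Function.update X i T)), ConnSet G (D₁ : Set V) ∧ U.card < 2 * D₁.card ∧ True := by
        have h1 : ∀ j ∈ insert i I, (Function.update X i T j).card ≤ m := by
          refine hmemI (by simpa using hTm) fun j hj => ?_
          simpa [hne j hj] using hst.cut_card j hj
        have h2 : ∀ j ∈ insert i I, Function.update X i T j ⊆ U := by
          refine hmemI (by simpa using hTU) fun j hj => ?_
          simpa [hne j hj] using (hst.cut_subset j hj).trans (hst.subset j hj)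
        obtain ⟨K, a, b, c⟩ := hb ((insert i I).biUnion (Function.update X i T))
          (Finset.biUnion_subset.2 h2)
          ((Finset.card_biUnion_le_card_mul _ _ m h1).trans
            (Nat.mul_le_mul_right _ (by simpa using Finset.card_le_univ (insert i I))))
        exact ⟨K, a, b, c, trivial⟩
      have hD₁U : D₁ ⊆ U := hD₁.trans Finset.sdiff_subset
      have hcl : ∀ u ∈ D \ T, ∀ v ∈ U, G.Adj u v →
          v ∈ D \ T ∨ ∃ j ∈ insert i I, v ∈ Function.update X i T j := by
        intro u hu v hv huv
        rcases hst.closed u (Finset.mem_sdiff.1 hu).1 v hv huv with h1 | ⟨j, hj, hvj⟩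
        · by_cases hvT : v ∈ T
          · exact Or.inr ⟨i, Finset.mem_insert_self _ _, by simpa using hvT⟩
          · exact Or.inl (Finset.mem_sdiff.2 ⟨h1, hvT⟩)
        · exact Or.inr ⟨j, Finset.mem_insert_of_mem hj, by simpa [hne j hj] using hvj⟩
      have hD₁D : D₁ ⊆ D \ T := by
        obtain ⟨v, hv, hv₁⟩ := exists_mem_inter_of_card hst.big_subset hD₁U hst.big_card hD₁b
        have hnot : ∀ x ∈ D₁, ∀ j ∈ insert i I, x ∉ Function.update X i T j :=
          fun x hx j hj hxj =>
            (Finset.mem_sdiff.1 (hD₁ hx)).2 (Finset.mem_biUnion.2 ⟨j, hj, hxj⟩)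
        have hvT : v ∉ T := fun hvT =>
          hnot v hv₁ i (Finset.mem_insert_self _ _) (by simpa using hvT)
        have := hD₁c.subset_of_closed (D := ((D \ T : Finset V) : Set V)) hv₁
          (Finset.mem_coe.2 (Finset.mem_sdiff.2 ⟨hv, hvT⟩)) ?_
        · exact_mod_cast this
        · intro a ha _ b hb' hab
          rcases hcl a ha b (hD₁U hb') hab with h1 | ⟨j, hj, hbj⟩
          · exact h1
          · exact absurd hbj (hnot b hb' j hj)
      obtain ⟨D', hD'P, hst'⟩ := HasBigComponents.exists_coveyState
        (P := D \ T) hb hcov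
        (X' := Function.update X i T)
        (hmemI (by simpa using hTU) fun j hj => by simpa [hne j hj] using hst.subset j hj)
        (hmemI (by simp) fun j hj => by simpa [hne j hj] using hst.cut_subset j hj)
        (hmemI (by simpa using hTm) fun j hj => by simpa [hne j hj] using hst.cut_card j hj)
        (hmemI (by simpa using Finset.disjoint_sdiff) fun j hj => by
          simpa [hne j hj] using
            Finset.disjoint_of_subset_right Finset.sdiff_subset (hst.disj j hj))
        ⟨D₁, hD₁D, hD₁U, hD₁b⟩ hcl
      refine ih _ _ _ D' hst' (hshrink D' ?_ _)
      obtain ⟨t, ht⟩ := hTc.1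
      refine (Finset.card_le_card hD'P).trans_lt (Finset.card_lt_card ?_)
      exact (Finset.ssubset_iff_of_subset Finset.sdiff_subset).2
        ⟨t, hTD ht, fun h1 => (Finset.mem_sdiff.1 h1).2 ht⟩
    · have hZm' : Z.card ≤ m := by
        have h1 : (h + 1) * D.card ≤ (h + 1) * U.card :=
          Nat.mul_le_mul_left _ (Finset.card_le_card hst.big_subset)
        exact Nat.le_of_mul_le_mul_left ((hZm.trans h1).trans hcard) hm
      -- An unused index leaves room for the cut `Z` beside the old cut sets within the budget `h *
      -- m`.
      have hIlt : I.card + 1 ≤ h := by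
        have := Finset.card_lt_univ_of_notMem (s := I)
          (x := Classical.choose (by
            by_contra! hcon
            exact hI (Finset.eq_univ_of_forall hcon) : ∃ i, i ∉ I))
          (Classical.choose_spec (by
            by_contra! hcon
            exact hI (Finset.eq_univ_of_forall hcon) : ∃ i, i ∉ I))
        simpa using this
      have hXU : I.biUnion X ∪ Z ⊆ U := Finset.union_subset
        (Finset.biUnion_subset.2 fun j hj => (hst.cut_subset j hj).trans (hst.subset j hj))
        (hZD.trans hst.big_subset)
      have hXc : (I.biUnion X ∪ Z).card ≤ h * m := by
        have h1 := Finset.card_union_le (I.biUnion X) Z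
        have h2 := Finset.card_biUnion_le_card_mul I X m hst.cut_card
        have h3 : (I.card + 1) * m ≤ h * m := Nat.mul_le_mul_right _ hIlt
        rw [add_mul] at h3
        omega
      obtain ⟨D₁, hD₁, hD₁c, hD₁b, hD₁cl⟩ := hb.exists_component hXU hXc
      have hD₁U : D₁ ⊆ U := hD₁.trans Finset.sdiff_subset
      have hD₁X : ∀ x ∈ D₁, ∀ j ∈ I, x ∉ X j := fun x hx j hj hxj =>
        (Finset.mem_sdiff.1 (hD₁ hx)).2
          (Finset.mem_union_left _ (Finset.mem_biUnion.2 ⟨j, hj, hxj⟩))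
      have hD₁D : D₁ ⊆ D := by
        obtain ⟨v, hv, hv₁⟩ := exists_mem_inter_of_card hst.big_subset hD₁U hst.big_card hD₁b
        have := hD₁c.subset_of_closed (D := (D : Set V)) hv₁ hv ?_
        · exact_mod_cast this
        · intro a ha _ b hb' hab
          rcases hst.closed a ha b (hD₁U hb') hab with h1 | ⟨j, hj, hbj⟩
          · exact h1
          · exact absurd hbj (hD₁X b hb' j hj)
      obtain ⟨l, hl, hlA⟩ := hZ D₁ (fun v hv => Finset.mem_sdiff.2 ⟨hD₁D hv, fun hvZ =>
        (Finset.mem_sdiff.1 (hD₁ hv)).2 (Finset.mem_union_right _ hvZ)⟩) hD₁c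
      obtain ⟨i, hil⟩ : ∃ i : Fin h, (i : ℕ) = l := ⟨⟨l, hl⟩, rfl⟩
      subst hil
      obtain ⟨x₁, hx₁⟩ := hD₁c.1
      have hiI : i ∈ I := by
        by_contra hcon
        exact hlA x₁ hx₁ (hA' i hcon x₁)
      have hmiss : ∀ u ∈ D₁, ∀ v ∈ C i, ¬ G.Adj u v := fun u hu v hv huv =>
        hlA u hu ((hA i hiI u).2 ⟨v, hv, huv⟩)
      -- The member `C i` swallows everything in `D` outside `D₁` that it can reach; `D₁` itself has
      -- no edge to `C i`.
      obtain ⟨B, hCB, hB, hBc, hBcl⟩ := (hst.covey.conn i hiI).exists_component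
        (S := C i ∪ D \ D₁) Finset.subset_union_left
      have hBD₁ : ∀ x ∈ B, x ∉ D₁ := by
        intro x hx hx₁
        rcases Finset.mem_union.1 (hB hx) with h1 | h1
        · exact Finset.disjoint_left.1 (hst.disj i hiI) h1 (hD₁D hx₁)
        · exact (Finset.mem_sdiff.1 h1).2 hx₁
      have hgrow : ∀ u ∈ D, u ∉ D₁ → ∀ v ∈ B, G.Adj v u → u ∈ B := fun u hu hu₁ v hv hvu =>
        hBcl v hv u (Finset.mem_union_right _ (Finset.mem_sdiff.2 ⟨hu, hu₁⟩)) hvu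
      have hBU : B ⊆ U := hB.trans (Finset.union_subset (hst.subset i hiI)
        (Finset.sdiff_subset.trans hst.big_subset))
      classical
      let Z' := B.filter fun z => ∃ u ∈ D₁, G.Adj u z
      have hZ'mem : ∀ z, z ∈ Z' ↔ z ∈ B ∧ ∃ u ∈ D₁, G.Adj u z := fun z => Finset.mem_filter
      -- A vertex of `B` next to `D₁` is not in `C i`, so it lies in `D` outside `D₁`. As `D₁` is a
      -- component after deleting the cut sets and `Z`, the vertex was deleted; the old cut sets
      -- avoid `D`, so it is in `Z`.
      have hZ'Z : Z' ⊆ Z := by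
        intro z hz
        obtain ⟨hzB, u, hu, huz⟩ := (hZ'mem z).1 hz
        rcases Finset.mem_union.1 (hB hzB) with h1 | h1
        · exact absurd huz (hmiss u hu z h1)
        · obtain ⟨hzD, hzD₁⟩ := Finset.mem_sdiff.1 h1
          rcases hD₁cl u hu z (hst.big_subset hzD) huz with h2 | h2
          · exact absurd h2 hzD₁
          · rcases Finset.mem_union.1 h2 with h3 | h3
            · obtain ⟨j, hj, hzj⟩ := Finset.mem_biUnion.1 h3
              exact absurd hzD (Finset.disjoint_left.1 (hst.disj j hj) (hst.cut_subset j hj hzj))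
            · exact h3
      have hBC : ∀ j ∈ I, j ≠ i → Disjoint B (C j) := fun j hj hji =>
        Finset.disjoint_of_subset_left hB (Finset.disjoint_union_left.2
          ⟨hst.covey.disj i hiI j hj hji.symm,
            Finset.disjoint_of_subset_left Finset.sdiff_subset (hst.disj j hj).symm⟩)
      have hcov : IsCovey G I (Function.update C i B) := by
        refine IsCovey.update (hst.covey.mono (Finset.erase_subset _ _)) hBc hBC ?_
        intro j hj hji
        obtain ⟨u, hu, v, hv, huv⟩ := hst.covey.adj i hiI j hj hji.symm
        exact ⟨u, hCB hu, v, hv, huv⟩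
      have hup : ∀ {Q : Finset V → Finset V → Prop}, Q B Z' →
          (∀ j ∈ I, j ≠ i → Q (C j) (X j)) →
          ∀ j ∈ I, Q (Function.update C i B j) (Function.update X i Z' j) := by
        intro Q h1 h2 j hj
        by_cases hji : j = i
        · subst hji; simpa using h1
        · simpa [hji] using h2 j hj hji
      obtain ⟨D', hD'P, hst'⟩ := HasBigComponents.exists_coveyState
        (P := D \ B) hb hcov (X' := Function.update X i Z')
        (hup (Q := fun a _ => a ⊆ U) hBU fun j hj _ => hst.subset j hj)
        (hup (Q := fun a b => b ⊆ a) (Finset.filter_subset _ _) fun j hj _ => hst.cut_subset j hj)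
        (hup (Q := fun _ b => b.card ≤ m) ((Finset.card_le_card hZ'Z).trans hZm')
          fun j hj _ => hst.cut_card j hj)
        (hup (Q := fun a _ => Disjoint a (D \ B)) Finset.disjoint_sdiff fun j hj _ =>
          Finset.disjoint_of_subset_right Finset.sdiff_subset (hst.disj j hj))
        ⟨D₁, fun x hx => Finset.mem_sdiff.2 ⟨hD₁D hx, fun hxB => hBD₁ x hxB hx⟩, hD₁U, hD₁b⟩
        (by
          intro u hu v hv huv
          obtain ⟨huD, huB⟩ := Finset.mem_sdiff.1 hu
          rcases hst.closed u huD v hv huv with h1 | ⟨j, hj, hvj⟩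
          · by_cases hvB : v ∈ B
            · by_cases hu₁ : u ∈ D₁
              · exact Or.inr ⟨i, hiI, by simpa using (hZ'mem v).2 ⟨hvB, u, hu₁, huv⟩⟩
              · exact absurd (hgrow u huD hu₁ v hvB huv.symm) huB
            · exact Or.inl (Finset.mem_sdiff.2 ⟨h1, hvB⟩)
          · by_cases hji : j = i
            · subst hji
              have hvC := hst.cut_subset j hj hvj
              by_cases hu₁ : u ∈ D₁
              · exact absurd huv (hmiss u hu₁ v hvC)
              · exact absurd (hgrow u huD hu₁ v (hCB hvC) huv.symm) huB
            · exact Or.inr ⟨j, hj, by simpa [hji] using hvj⟩)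
      refine ih _ _ _ D' hst' (hshrink D' ?_ _)
      -- Progress: `C i` had a neighbour in `D`, which is outside `D₁` and has therefore moved into
      -- `B`.
      obtain ⟨u, hu, v, hv, huv⟩ := hno i hiI
      have huB : u ∈ B := by
        refine hgrow u hu (fun hu₁ => hmiss u hu₁ v hv huv) v (hCB hv) huv.symm
      refine (Finset.card_le_card hD'P).trans_lt (Finset.card_lt_card ?_)
      exact (Finset.ssubset_iff_of_subset Finset.sdiff_subset).2
        ⟨u, hu, fun h1 => (Finset.mem_sdiff.1 h1).2 huB⟩

/-- The separator theorem of Alon, Seymour and Thomas. -/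
theorem exists_separator_of_no_covey (hm : 0 < m) (hcard : (h + 1) * U.card ≤ m * m)
    (hno : ∀ C : Fin h → Finset V, IsCovey G Finset.univ C → ¬ ∀ i, C i ⊆ U) :
    ∃ X ⊆ U, X.card ≤ h * m ∧
      ∀ K ⊆ U \ X, ConnSet G (K : Set V) → 2 * K.card ≤ U.card := by
  by_contra! hcon
  have hb : HasBigComponents G U (h * m) := hcon
  -- The start state is the empty covey with a component of `U` having more than half of its
  -- vertices.
  obtain ⟨D, hD, hDc, hDb, hDcl⟩ := hb.exists_component (Finset.empty_subset U) (by simp)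
  obtain ⟨C', hC', hC'U⟩ := CoveyState.exists_covey hm hcard hb _ ∅ (fun _ => ∅) (fun _ => ∅) D
    ⟨⟨by simp, by simp, by simp⟩, by simp, by simp, by simp, by simp,
      hD.trans Finset.sdiff_subset, hDc, hDb, by simpa using hDcl⟩ le_rfl
  exact hno C' hC' hC'U

end SeparatorTheorem

/-! ### From separators to divisions into small regions. -/

section Division

variable {V : Type*} [DecidableEq V] {G : SimpleGraph V} {U : Finset V}

/-- The components left by a separator can be distributed over two sides in a balanced way. -/
theorem exists_balanced_split {X : Finset V} (hX : X ⊆ U)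
    (hsep : ∀ K ⊆ U \ X, ConnSet G (K : Set V) → 2 * K.card ≤ U.card) :
    ∃ A B : Finset V, A ∪ B = U ∧ A.card + B.card = U.card + X.card ∧
      3 * A.card ≤ 2 * U.card + 3 * X.card ∧ 3 * B.card ≤ 2 * U.card + 3 * X.card ∧
      U.card ≤ 3 * A.card ∧ U.card ≤ 3 * B.card ∧
      ∀ u ∈ U, ∀ v ∈ U, G.Adj u v → u ∈ A ∧ v ∈ A ∨ u ∈ B ∧ v ∈ B := by
  classical
  let F := (U \ X).powerset.filter fun A' =>
    (∀ u ∈ A', ∀ v ∈ U \ X, G.Adj u v → v ∈ A') ∧ 3 * A'.card ≤ 2 * U.card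
  have hF : ∀ A', A' ∈ F ↔ A' ⊆ U \ X ∧ (∀ u ∈ A', ∀ v ∈ U \ X, G.Adj u v → v ∈ A') ∧
      3 * A'.card ≤ 2 * U.card := fun A' => by simp only [F, Finset.mem_filter, Finset.mem_powerset]
  -- A largest union of components among those with at most two thirds of the vertices.
  obtain ⟨A', hA', hmax⟩ := Finset.exists_max_image F Finset.card ⟨∅, (hF ∅).2 (by simp)⟩
  obtain ⟨hA'U, hA'cl, hA'c⟩ := (hF A').1 hA'
  have hc1 : (U \ X).card + X.card = U.card := Finset.card_sdiff_add_card_eq_card hX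
  have hc2 : ((U \ X) \ A').card + A'.card = (U \ X).card :=
    Finset.card_sdiff_add_card_eq_card hA'U
  -- Otherwise `A'` has less than a third of `U`. Any component `K` outside `A'` is itself a
  -- candidate, so it is no larger than `A'`. Then `A' ∪ K` is below two thirds and beats `A'`.
  have hB : 3 * ((U \ X) \ A').card ≤ 2 * U.card := by
    by_contra! hcon
    obtain ⟨v, hv⟩ : ((U \ X) \ A').Nonempty := Finset.card_pos.1 (by omega)
    obtain ⟨hvU, hvA⟩ := Finset.mem_sdiff.1 hv
    obtain ⟨K, hvK, hK, hKc, hKcl⟩ := ConnSet.exists_component (G := G) (S := U \ X) (K := {v})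
      (by simpa using connSet_singleton G v) (by simpa using hvU)
    rw [Finset.singleton_subset_iff] at hvK
    have hdis : Disjoint A' K := by
      refine Finset.disjoint_left.2 fun x hxA hxK => hvA ?_
      exact hKc.subset_of_closed (D := (A' : Set V)) hxK hxA
        (fun a ha _ b hb hab => hA'cl a ha b (hK hb) hab) hvK
    have hKhalf := hsep K hK hKc
    have hKle : K.card ≤ A'.card := hmax K ((hF K).2 ⟨hK, hKcl, by omega⟩)
    have hun : 2 * U.card < 3 * (A' ∪ K).card := by
      by_contra! hle
      have := hmax (A' ∪ K) ((hF _).2 ⟨Finset.union_subset hA'U hK, ?_, hle⟩)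
      · rw [Finset.card_union_of_disjoint hdis] at this
        have := Finset.card_pos.2 ⟨v, hvK⟩
        omega
      · intro u hu w hw huw
        rcases Finset.mem_union.1 hu with h1 | h1
        · exact Finset.mem_union_left _ (hA'cl u h1 w hw huw)
        · exact Finset.mem_union_right _ (hKcl u h1 w hw huw)
    rw [Finset.card_union_of_disjoint hdis] at hun
    omega
  have hAX : (A' ∪ X).card = A'.card + X.card := Finset.card_union_of_disjoint
    (Finset.disjoint_of_subset_left hA'U Finset.sdiff_disjoint)
  have hBX : (((U \ X) \ A') ∪ X).card = ((U \ X) \ A').card + X.card :=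
    Finset.card_union_of_disjoint
      (Finset.disjoint_of_subset_left Finset.sdiff_subset Finset.sdiff_disjoint)
  refine ⟨A' ∪ X, ((U \ X) \ A') ∪ X, ?_, by omega, by omega, by omega, by omega, by omega, ?_⟩
  · ext x
    have h1 := @hA'U x
    have h2 := @hX x
    simp only [Finset.mem_union, Finset.mem_sdiff] at h1 h2 ⊢
    tauto
  · intro u hu v hv huv
    have h1 := fun h => hA'cl u h v
    have h2 := fun h => hA'cl v h u
    have h3 := huv.symm
    simp only [Finset.mem_union, Finset.mem_sdiff] at h1 h2 ⊢
    tauto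

/-- Every vertex set `U` inside `T` has a balanced separation of order at most `c √|U|`. -/
def HasSplits (G : SimpleGraph V) (T : Finset V) (c : ℝ) : Prop :=
  ∀ U ⊆ T, ∃ A B : Finset V, A ∪ B = U ∧
    (A.card + B.card : ℝ) ≤ U.card + c * √U.card ∧
    (A.card : ℝ) ≤ 2 / 3 * U.card + c * √U.card ∧ (B.card : ℝ) ≤ 2 / 3 * U.card + c * √U.card ∧
    (U.card : ℝ) ≤ 3 * A.card ∧ (U.card : ℝ) ≤ 3 * B.card ∧
    ∀ u ∈ U, ∀ v ∈ U, G.Adj u v → u ∈ A ∧ v ∈ A ∨ u ∈ B ∧ v ∈ B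

theorem hasSplits_of_no_covey {h : ℕ} {T : Finset V}
    (hno : ∀ C : Fin h → Finset V, IsCovey G Finset.univ C → ¬ ∀ i, C i ⊆ T) :
    HasSplits G T (2 * (h + 1) * (h + 1)) := by
  intro U hU
  have hno' : ∀ C : Fin h → Finset V, IsCovey G Finset.univ C → ¬ ∀ i, C i ⊆ U :=
    fun C hC hCU => hno C hC fun i => (hCU i).trans hU
  rcases Finset.eq_empty_or_nonempty U with rfl | hne
  · exact ⟨∅, ∅, by simp⟩
  have hUpos : (1 : ℝ) ≤ U.card := by exact_mod_cast Finset.card_pos.2 hne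
  have hs1 : 1 ≤ √(U.card : ℝ) := Real.one_le_sqrt.2 hUpos
  have hs : √(U.card : ℝ) * √(U.card : ℝ) = U.card := Real.mul_self_sqrt (by positivity)
  -- The separator theorem is used with `m = (h + 1) * ⌈√|U|⌉`. The separator of size `h * m` is
  -- then at most `2 * (h + 1) ^ 2 * √|U|`, because rounding up at most doubles a number that is at
  -- least `1`.
  have hm1 : 0 < (h + 1) * ⌈√(U.card : ℝ)⌉₊ := by
    have : 0 < ⌈√(U.card : ℝ)⌉₊ := Nat.ceil_pos.2 (by linarith)
    positivity
  have hm2 : (h + 1) * U.card ≤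
      ((h + 1) * ⌈√(U.card : ℝ)⌉₊) * ((h + 1) * ⌈√(U.card : ℝ)⌉₊) := by
    have h1 : U.card ≤ ⌈√(U.card : ℝ)⌉₊ * ⌈√(U.card : ℝ)⌉₊ := by
      have h2 := Nat.le_ceil √(U.card : ℝ)
      have h3 : (U.card : ℝ) ≤ (⌈√(U.card : ℝ)⌉₊ : ℝ) * ⌈√(U.card : ℝ)⌉₊ := by
        refine hs.symm.le.trans ?_
        gcongr
      exact_mod_cast h3
    calc (h + 1) * U.card ≤ (h + 1) * (h + 1) * (⌈√(U.card : ℝ)⌉₊ * ⌈√(U.card : ℝ)⌉₊) :=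
          Nat.mul_le_mul (Nat.le_mul_of_pos_left _ (Nat.succ_pos _)) h1
      _ = _ := by ring
  obtain ⟨X, hXU, hXc, hXs⟩ := exists_separator_of_no_covey hm1 hm2 hno'
  have hXr : (X.card : ℝ) ≤ 2 * (h + 1) * (h + 1) * √(U.card : ℝ) := by
    have h1 : (X.card : ℝ) ≤ h * ((h + 1) * ⌈√(U.card : ℝ)⌉₊) := by exact_mod_cast hXc
    have h2 : (⌈√(U.card : ℝ)⌉₊ : ℝ) ≤ 2 * √(U.card : ℝ) := by
      have := Nat.ceil_lt_add_one (Real.sqrt_nonneg (U.card : ℝ))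
      linarith
    calc (X.card : ℝ) ≤ h * ((h + 1) * ⌈√(U.card : ℝ)⌉₊) := h1
      _ ≤ (h + 1) * ((h + 1) * (2 * √(U.card : ℝ))) := by gcongr; linarith
      _ = _ := by ring
  obtain ⟨A, B, h1, h2, h3, h4, h5, h6, h7⟩ := exists_balanced_split hXU hXs
  have h2' : (A.card + B.card : ℝ) = U.card + X.card := by exact_mod_cast h2
  have h3' : (3 * A.card : ℝ) ≤ 2 * U.card + 3 * X.card := by exact_mod_cast h3
  have h4' : (3 * B.card : ℝ) ≤ 2 * U.card + 3 * X.card := by exact_mod_cast h4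
  exact ⟨A, B, h1, by linarith, by linarith, by linarith, by exact_mod_cast h5,
    by exact_mod_cast h6, h7⟩

/-- `U` is covered by regions of at most `r` vertices such that every edge inside `U` lies in a
region and the sizes of the regions sum up to at most `M`. -/
def HasDivision (G : SimpleGraph V) (U : Finset V) (r : ℕ) (M : ℝ) : Prop :=
  ∃ (ι : Type) (_ : Fintype ι) (R : ι → Finset V),
    (∀ i, R i ⊆ U) ∧ (∀ i, (R i).card ≤ r) ∧ (∀ v ∈ U, ∃ i, v ∈ R i) ∧
    (∀ u ∈ U, ∀ v ∈ U, G.Adj u v → ∃ i, u ∈ R i ∧ v ∈ R i) ∧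
    (∑ i, ((R i).card : ℝ)) ≤ M

omit [DecidableEq V] in
theorem HasDivision.mono {r : ℕ} {M M' : ℝ} (hd : HasDivision G U r M) (hM : M ≤ M') :
    HasDivision G U r M' := by
  obtain ⟨ι, _, R, h1, h2, h3, h4, h5⟩ := hd
  exact ⟨ι, _, R, h1, h2, h3, h4, h5.trans hM⟩

omit [DecidableEq V] in
theorem hasDivision_of_card_le {r : ℕ} (hU : U.card ≤ r) : HasDivision G U r U.card :=
  ⟨Unit, inferInstance, fun _ => U, by simp, by simpa using hU, fun v hv => ⟨(), hv⟩,
    fun u hu v hv _ => ⟨(), hu, hv⟩, by simp⟩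

theorem HasDivision.union {r : ℕ} {A B : Finset V} {M N : ℝ} (hA : HasDivision G A r M)
    (hB : HasDivision G B r N)
    (hAB : ∀ u ∈ A ∪ B, ∀ v ∈ A ∪ B, G.Adj u v → u ∈ A ∧ v ∈ A ∨ u ∈ B ∧ v ∈ B) :
    HasDivision G (A ∪ B) r (M + N) := by
  obtain ⟨ι, _, R, h1, h2, h3, h4, h5⟩ := hA
  obtain ⟨κ, _, S, k1, k2, k3, k4, k5⟩ := hB
  refine ⟨ι ⊕ κ, inferInstance, Sum.elim R S, ?_, ?_, ?_, ?_, ?_⟩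
  · rintro (i | i)
    · exact (h1 i).trans Finset.subset_union_left
    · exact (k1 i).trans Finset.subset_union_right
  · rintro (i | i)
    · exact h2 i
    · exact k2 i
  · intro v hv
    rcases Finset.mem_union.1 hv with hv | hv
    · obtain ⟨i, hi⟩ := h3 v hv; exact ⟨.inl i, hi⟩
    · obtain ⟨i, hi⟩ := k3 v hv; exact ⟨.inr i, hi⟩
  · intro u hu v hv huv
    rcases hAB u hu v hv huv with ⟨hu, hv⟩ | ⟨hu, hv⟩
    · obtain ⟨i, hi⟩ := h4 u hu v hv huv; exact ⟨.inl i, hi⟩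
    · obtain ⟨i, hi⟩ := k4 u hu v hv huv; exact ⟨.inr i, hi⟩
  · rw [Fintype.sum_sum_type]
    simpa using add_le_add h5 k5

/-- Squaring, `a + b + 2√(ab) ≥ m + 2m/3`, and `5/3 ≥ (5/4)²`. This strict gain of square roots
under balanced splitting pays for the separators in the recursion. -/
theorem sqrt_add_sqrt_ge {m a b : ℝ} (hm : 0 ≤ m) (hab : m ≤ a + b) (ha : m ≤ 3 * a)
    (hb : m ≤ 3 * b) : 5 / 4 * √m ≤ √a + √b := by
  have ha0 : 0 ≤ a := by linarith
  have hb0 : 0 ≤ b := by linarith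
  have hprod : m / 3 ≤ √a * √b := by
    rw [← Real.sqrt_mul ha0]
    refine Real.le_sqrt_of_sq_le ?_
    calc (m / 3) ^ 2 = (m / 3) * (m / 3) := sq _
      _ ≤ a * b := by gcongr <;> linarith
  refine (pow_le_pow_iff_left₀ (by positivity) (by positivity) two_ne_zero).1 ?_
  have h1 := Real.sq_sqrt hm
  have h2 := Real.sq_sqrt ha0
  have h3 := Real.sq_sqrt hb0
  nlinarith

/-- The subtracted term `8 * c * √|U|` makes the induction close: by `sqrt_add_sqrt_ge` it grows by
at least `2 * c * √|U|` in a split. The split costs `c * √|U|` in duplicated vertices, plus at most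
`16/20 * c * √|U|` in the middle term, since `q ≥ 20 * c`. Only sets with more than `q ^ 2` vertices
are split, so each side, having at least a third of them, again satisfies the lower bound on its
size. -/
theorem HasSplits.hasDivision_of_large {T : Finset V} {c : ℝ} (hc : 1 ≤ c) {q : ℕ}
    (hq : 20 * c ≤ q) (hs : HasSplits G T c) :
    ∀ (N : ℕ) (U : Finset V), U ⊆ T → U.card ≤ N → (q : ℝ) ^ 2 ≤ 3 * U.card →
      HasDivision G U (q ^ 2) (U.card + 16 * c * U.card / q - 8 * c * √U.card) := by
  have hq0 : (0 : ℝ) < q := by linarith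
  intro N
  induction N with
  | zero =>
    intro U _ hU hU3
    have : (U.card : ℝ) = 0 := by exact_mod_cast Nat.le_zero.1 hU
    rw [this] at hU3
    nlinarith
  | succ N ih =>
    intro U hUT hUN hU3
    have hm0 : (0 : ℝ) ≤ U.card := by positivity
    have hsm : √(U.card : ℝ) * √(U.card : ℝ) = U.card := Real.mul_self_sqrt hm0
    have hs0 := Real.sqrt_nonneg (U.card : ℝ)
    by_cases hsmall : U.card ≤ q ^ 2
    · refine (hasDivision_of_card_le hsmall).mono ?_
      -- The lower bound `q ^ 2 ≤ 3 * |U|` is what lets the middle term outweigh the subtracted one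
      -- for a single region.
      have h1 : (q : ℝ) ≤ 2 * √(U.card : ℝ) := by
        refine (pow_le_pow_iff_left₀ (by positivity) (by positivity) two_ne_zero).1 ?_
        nlinarith
      have h2 : 8 * c * √(U.card : ℝ) ≤ 16 * c * U.card / q := by
        rw [le_div_iff₀ hq0]
        calc 8 * c * √(U.card : ℝ) * q ≤ 8 * c * √(U.card : ℝ) * (2 * √(U.card : ℝ)) := by gcongr
          _ = 16 * c * (√(U.card : ℝ) * √(U.card : ℝ)) := by ring
          _ = 16 * c * U.card := by rw [hsm]
      linarith
    push Not at hsmall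
    have hbig : (q : ℝ) ^ 2 < U.card := by exact_mod_cast hsmall
    have hsq : (q : ℝ) ≤ √(U.card : ℝ) := Real.le_sqrt_of_sq_le hbig.le
    obtain ⟨A, B, hAB, h1, h2, h3, h4, h5, h6⟩ := hs U hUT
    have hcs : 20 * (c * √(U.card : ℝ)) ≤ U.card := by
      calc 20 * (c * √(U.card : ℝ)) = 20 * c * √(U.card : ℝ) := by ring
        _ ≤ √(U.card : ℝ) * √(U.card : ℝ) := by gcongr; linarith
        _ = U.card := hsm
    have hUpos : (0 : ℝ) < U.card := lt_of_le_of_lt (by positivity) hbig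
    have hlt : ∀ D : Finset V, (D.card : ℝ) ≤ 2 / 3 * U.card + c * √U.card → D.card ≤ N := by
      intro D hD
      have : (D.card : ℝ) < U.card := by linarith
      have : D.card < U.card := by exact_mod_cast this
      omega
    have hA := ih A ((hAB ▸ Finset.subset_union_left).trans hUT) (hlt A h2) (by linarith)
    have hB := ih B ((hAB ▸ Finset.subset_union_right).trans hUT) (hlt B h3) (by linarith)
    have hsum : (U.card : ℝ) ≤ A.card + B.card := by
      have := Finset.card_union_le A B
      rw [hAB] at this
      exact_mod_cast this
    have hroot := sqrt_add_sqrt_ge hm0 hsum h4 h5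
    subst hAB
    refine (hA.union hB h6).mono ?_
    have e1 : 16 * c * A.card / q + 16 * c * B.card / q ≤
        16 * c * (A ∪ B).card / q + 16 / 20 * (c * √((A ∪ B).card : ℝ)) := by
      rw [← add_div, div_le_iff₀ hq0, add_mul, div_mul_cancel₀ _ hq0.ne']
      have h7 : 0 ≤ c * √((A ∪ B).card : ℝ) * (q - 20 * c) :=
        mul_nonneg (by positivity) (by linarith only [hq])
      have h8 := mul_le_mul_of_nonneg_left h1 (by linarith : 0 ≤ 16 * c)
      linarith only [h7, h8]
    have e2 : 8 * c * (5 / 4 * √((A ∪ B).card : ℝ)) ≤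
        8 * c * (√(A.card : ℝ) + √(B.card : ℝ)) := by gcongr
    have e3 : 0 ≤ c * √((A ∪ B).card : ℝ) := by positivity
    linarith

theorem HasSplits.hasDivision {T : Finset V} {c : ℝ} (hc : 1 ≤ c) {q : ℕ} (hq : 20 * c ≤ q)
    (hs : HasSplits G T c) :
    HasDivision G T (q ^ 2) (T.card + 16 * c * T.card / q) := by
  by_cases hT : (q : ℝ) ^ 2 ≤ 3 * T.card
  · refine (hs.hasDivision_of_large hc hq _ T (Finset.Subset.refl _) le_rfl hT).mono ?_
    have : 0 ≤ 8 * c * √(T.card : ℝ) := by positivity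
    linarith
  · refine (hasDivision_of_card_le ?_).mono ?_
    · have h1 : (T.card : ℝ) ≤ (q : ℝ) ^ 2 := by
        have : (0 : ℝ) ≤ T.card := by positivity
        linarith
      exact_mod_cast h1
    · have : 0 ≤ 16 * c * T.card / q := by positivity
      linarith

end Division

/-! ### Walk weights and shortest paths. -/

section WeightedDistance

variable {V : Type*} {G : SimpleGraph V}

/-- Total weight of the edges of a walk. -/
def walkWeight (w : Sym2 V → ℝ≥0) {u v : V} (p : G.Walk u v) : ℝ≥0 := (p.edges.map w).sum

variable {w : Sym2 V → ℝ≥0} {u v x : V}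

@[simp] theorem walkWeight_nil : walkWeight w (SimpleGraph.Walk.nil : G.Walk u u) = 0 := by
  simp [walkWeight]

@[simp] theorem walkWeight_cons (huv : G.Adj u v) (p : G.Walk v x) :
    walkWeight w (SimpleGraph.Walk.cons huv p) = w s(u, v) + walkWeight w p := by
  simp [walkWeight]

@[simp] theorem walkWeight_append (p : G.Walk u v) (q : G.Walk v x) :
    walkWeight w (p.append q) = walkWeight w p + walkWeight w q := by
  simp [walkWeight]

theorem weightedDist_le (p : G.Walk u v) : weightedDist G w u v ≤ walkWeight w p :=
  iInf_le (fun p : G.Walk u v => (((p.edges.map w).sum : ℝ≥0) : ℝ≥0∞)) p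

theorem le_weightedDist {a : ℝ≥0∞} (h : ∀ p : G.Walk u v, a ≤ walkWeight w p) :
    a ≤ weightedDist G w u v :=
  le_iInf h

theorem weightedDist_self : weightedDist G w u u = 0 :=
  le_antisymm (by simpa using weightedDist_le (w := w) (SimpleGraph.Walk.nil : G.Walk u u))
    zero_le

theorem exists_isPath_walkWeight_le [DecidableEq V] (p : G.Walk u v) :
    ∃ q : G.Walk u v, q.IsPath ∧ walkWeight w q ≤ walkWeight w p :=
  ⟨p.bypass, p.bypass_isPath,
    (p.edges_bypass_sublist_edges.map w).sum_le_sum fun _ _ => zero_le⟩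

/-- A finite distance is the weight of a path. -/
theorem exists_walkWeight_eq [Finite V] (h : weightedDist G w u v ≠ ⊤) :
    ∃ p : G.Walk u v, p.IsPath ∧ (walkWeight w p : ℝ≥0∞) = weightedDist G w u v := by
  classical
  have hne : Nonempty (G.Walk u v) := by
    by_contra hcon
    rw [not_nonempty_iff] at hcon
    exact h (by simp [weightedDist])
  let S : Set ℝ≥0 := {a | ∃ p : G.Walk u v, p.IsPath ∧ walkWeight w p = a}
  have hfin : S.Finite := by
    -- A path repeats no edge, so its weight is determined by its set of edges; hence only finitely
    -- many weights occur and the infimum is attained.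
    refine (Set.finite_range fun s : Finset (Sym2 V) => ∑ e ∈ s, w e).subset ?_
    rintro a ⟨p, hp, rfl⟩
    exact ⟨p.edges.toFinset, List.sum_toFinset _ hp.isTrail.edges_nodup⟩
  obtain ⟨p₀⟩ := hne
  obtain ⟨a, ⟨p, hp, rfl⟩, hmin⟩ := Set.exists_min_image S id hfin
    ⟨walkWeight w p₀.bypass, _, p₀.bypass_isPath, rfl⟩
  refine ⟨p, hp, le_antisymm (le_weightedDist fun q => ?_) (weightedDist_le p)⟩
  obtain ⟨q', hq', hle⟩ := exists_isPath_walkWeight_le (w := w) q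
  exact_mod_cast (hmin _ ⟨q', hq', rfl⟩).trans hle

theorem weightedDist_le_add (p : G.Walk u v) (x : V) [Finite V] :
    weightedDist G w u x ≤ walkWeight w p + weightedDist G w v x := by
  by_cases h : weightedDist G w v x = ⊤
  · simp [h]
  obtain ⟨q, -, hq⟩ := exists_walkWeight_eq h
  rw [← hq]
  simpa using weightedDist_le (w := w) (p.append q)

theorem walkWeight_add_const (δ : ℝ≥0) (p : G.Walk u v) :
    walkWeight (fun e => w e + δ) p = walkWeight w p + p.length * δ := by
  induction p with
  | nil => simp
  | cons h p ih =>
    simp only [walkWeight_cons, SimpleGraph.Walk.length_cons, ih]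
    push_cast
    ring

/-- Making all weights positive by adding a small constant does not change which vertices
dominate each other. -/
theorem exists_pos_weights [Fintype V] (G : SimpleGraph V) (w : Sym2 V → ℝ≥0) (ρ : ℝ) :
    ∃ (w' : Sym2 V → ℝ≥0) (R : ℝ≥0), (∀ e, 0 < w' e) ∧
      ∀ u v, weightedDist G w u v ≤ ENNReal.ofReal ρ ↔ weightedDist G w' u v ≤ R := by
  classical
  have hev : ∀ᶠ δ : ℝ≥0 in nhdsWithin 0 (Set.Ioi 0), ∀ u v : V,
      ¬ weightedDist G w u v ≤ ENNReal.ofReal ρ →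
        ¬ weightedDist G w u v ≤ (ρ.toNNReal + Fintype.card V * δ : ℝ≥0) := by
    simp only [Filter.eventually_all]
    intro u v h
    have hlim : Filter.Tendsto (fun δ : ℝ≥0 => ((ρ.toNNReal + Fintype.card V * δ : ℝ≥0) : ℝ≥0∞))
        (nhdsWithin 0 (Set.Ioi 0)) (nhds ((ρ.toNNReal + Fintype.card V * 0 : ℝ≥0) : ℝ≥0∞)) := by
      refine Filter.Tendsto.mono_left (Continuous.tendsto ?_ 0) nhdsWithin_le_nhds
      fun_prop
    have hlt : ((ρ.toNNReal + Fintype.card V * 0 : ℝ≥0) : ℝ≥0∞) < weightedDist G w u v := by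
      simpa [ENNReal.ofReal] using h
    filter_upwards [hlim.eventually_lt_const hlt] with δ hδ
    exact not_le.2 hδ
  obtain ⟨δ, hδ, hδ0⟩ := (hev.and self_mem_nhdsWithin).exists
  -- The slack `|V| * δ` suffices because a path has fewer than `|V|` edges; `δ` is so small that
  -- none of the finitely many distances above `ρ` is admitted.
  refine ⟨fun e => w e + δ, ρ.toNNReal + Fintype.card V * δ,
    fun e => lt_of_lt_of_le hδ0 le_add_self, fun u v => ⟨fun h => ?_, fun h => ?_⟩⟩
  · obtain ⟨p, hp, hpw⟩ := exists_walkWeight_eq (h.trans_lt ENNReal.ofReal_lt_top).ne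
    refine (weightedDist_le p).trans ?_
    rw [walkWeight_add_const]
    have h1 : walkWeight w p ≤ ρ.toNNReal := by
      rw [← hpw, ENNReal.ofReal] at h
      exact_mod_cast h
    have h2 : (p.length : ℝ≥0) ≤ Fintype.card V := by exact_mod_cast hp.length_lt.le
    exact_mod_cast add_le_add h1 (mul_le_mul_left h2 δ)
  · by_contra hcon
    refine hδ u v hcon (le_trans (le_weightedDist fun p => ?_) h)
    refine (weightedDist_le p).trans ?_
    rw [walkWeight_add_const]
    exact_mod_cast le_self_add

theorem weightedDist_pos [Finite V] (hw : ∀ e, 0 < w e) (huv : u ≠ v) :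
    weightedDist G w u v ≠ 0 := by
  intro h
  obtain ⟨p, -, hp⟩ := exists_walkWeight_eq (G := G) (w := w) (u := u) (v := v) (by simp [h])
  cases p with
  | nil => exact huv rfl
  | @cons _ y _ hadj q =>
    rw [h, walkWeight_cons, ENNReal.coe_eq_zero] at hp
    exact (hw s(u, y)).ne' (by simpa using (add_eq_zero.1 hp).1)

theorem linkedIn_of_walk {S : Set V} (p : G.Walk u v) (h : ∀ x ∈ p.support, x ∈ S) :
    LinkedIn G S u v := by
  induction p with
  | nil => exact .refl
  | cons hadj p ih =>
    simp only [SimpleGraph.Walk.support_cons, List.mem_cons, forall_eq_or_imp] at h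
    exact .head ⟨hadj, h.1, h.2 _ p.start_mem_support⟩ (ih h.2)

/-- A walk that starts in `A` and ends in `B`, with all vertices in `A` or `B`, has two equal or
adjacent vertices, one in `A` and one in `B`. -/
theorem exists_crossing {A B : V → Prop} (p : G.Walk u v) (hu : A u) (hv : B v)
    (h : ∀ x, A x ∨ B x) :
    ∃ x ∈ p.support, ∃ y ∈ p.support, A x ∧ B y ∧ (x = y ∨ G.Adj x y) := by
  induction p with
  | nil => exact ⟨_, by simp, _, by simp, hu, hv, Or.inl rfl⟩
  | @cons a b c hadj p ih =>
    by_cases hb : A b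
    · obtain ⟨x, hx, y, hy, h1⟩ := ih hb hv
      exact ⟨x, by simp [hx], y, by simp [hy], h1⟩
    · exact ⟨a, by simp, b, by simp, hu, (h b).resolve_left hb, Or.inr hadj⟩

end WeightedDistance

/-! ### Voronoi cells and the exchange graph. -/

section ExchangeGraph

variable {V : Type*} [Fintype V] [LinearOrder V] {G : SimpleGraph V} {w : Sym2 V → ℝ≥0}

/-- `c` maps each vertex to the first among its nearest centres in `T`. -/
structure IsVoronoi (G : SimpleGraph V) (w : Sym2 V → ℝ≥0) (T : Finset V) (c : V → V) : Prop where
  mem : ∀ v, c v ∈ T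
  le : ∀ v, ∀ t ∈ T, weightedDist G w v (c v) ≤ weightedDist G w v t
  first : ∀ v, ∀ t ∈ T, weightedDist G w v t = weightedDist G w v (c v) → c v ≤ t

omit [Fintype V] in
theorem exists_isVoronoi (G : SimpleGraph V) (w : Sym2 V → ℝ≥0) {T : Finset V}
    (hT : T.Nonempty) : ∃ c, IsVoronoi G w T c := by
  have h : ∀ v, ∃ t ∈ T, (∀ t' ∈ T, weightedDist G w v t ≤ weightedDist G w v t') ∧
      ∀ t' ∈ T, weightedDist G w v t' = weightedDist G w v t → t ≤ t' := by
    intro v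
    obtain ⟨t₀, ht₀, hmin⟩ := Finset.exists_min_image T (weightedDist G w v) hT
    obtain ⟨t, ht, htmin⟩ := Finset.exists_min_image
      (T.filter fun t => weightedDist G w v t = weightedDist G w v t₀) id ⟨t₀, by simp [ht₀]⟩
    rw [Finset.mem_filter] at ht
    refine ⟨t, ht.1, fun t' ht' => ht.2 ▸ hmin t' ht', fun t' ht' heq => htmin t' ?_⟩
    rw [Finset.mem_filter]
    exact ⟨ht', heq.trans ht.2⟩
  choose c h1 h2 h3 using h
  exact ⟨c, h1, h2, h3⟩

variable {T : Finset V} {c : V → V}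

/-- Positive weights are essential: at distance `0`, the tie-break could give a centre away to
another cell. -/
theorem IsVoronoi.eq_of_mem (hc : IsVoronoi G w T c) (hw : ∀ e, 0 < w e) {t : V} (ht : t ∈ T) :
    c t = t := by
  by_contra hne
  have := hc.le t t ht
  rw [weightedDist_self] at this
  exact weightedDist_pos hw (Ne.symm hne) (le_antisymm this zero_le)

/-- The centre of a vertex is also the centre of the vertices on a shortest path to it. -/
theorem IsVoronoi.eq_on_path (hc : IsVoronoi G w T c) {v : V} (p : G.Walk v (c v))
    (hp : (walkWeight w p : ℝ≥0∞) = weightedDist G w v (c v)) {u : V} (hu : u ∈ p.support) :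
    c u = c v := by
  have hspec : walkWeight w p =
      walkWeight w (p.takeUntil u hu) + walkWeight w (p.dropUntil u hu) := by
    rw [← walkWeight_append, p.take_spec hu]
  have h1 : weightedDist G w u (c v) ≤ walkWeight w (p.dropUntil u hu) := weightedDist_le _
  have h2 : weightedDist G w u (c u) ≤ weightedDist G w u (c v) := hc.le u _ (hc.mem v)
  have h3 : weightedDist G w v (c u) ≤
      walkWeight w (p.takeUntil u hu) + weightedDist G w u (c u) := weightedDist_le_add _ _
  have h4 : weightedDist G w v (c v) ≤ weightedDist G w v (c u) := hc.le v _ (hc.mem u)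
  rw [← hp, hspec, ENNReal.coe_add] at h4
  have h5 : (walkWeight w (p.dropUntil u hu) : ℝ≥0∞) ≤ weightedDist G w u (c u) :=
    (ENNReal.add_le_add_iff_left ENNReal.coe_ne_top).1 (h4.trans h3)
  -- Splitting the shortest path at `u` shows that `c u` and `c v` are equally near to `u` and
  -- equally near to `v`; the two tie-breaks then give both inequalities.
  refine le_antisymm (hc.first u _ (hc.mem v) (le_antisymm (h1.trans h5) h2))
    (hc.first v _ (hc.mem u) (le_antisymm ?_ (hc.le v _ (hc.mem u))))
  rw [← hp, hspec, ENNReal.coe_add]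
  exact h3.trans (by gcongr; exact h2.trans h1)

/-- The graph of adjacent Voronoi cells. -/
def cellGraph (G : SimpleGraph V) (c : V → V) : SimpleGraph V where
  Adj a b := a ≠ b ∧ ∃ u v, c u = a ∧ c v = b ∧ G.Adj u v
  symm := ⟨fun _ _ ⟨h, u, v, hu, hv, huv⟩ => ⟨h.symm, v, u, hv, hu, huv.symm⟩⟩
  loopless := ⟨fun _ h => h.1 rfl⟩

theorem IsVoronoi.linkedIn_cell (hc : IsVoronoi G w T c)
    (hfin : ∀ v, weightedDist G w v (c v) ≠ ⊤) (v : V) : LinkedIn G {x | c x = c v} v (c v) := by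
  obtain ⟨p, -, hp⟩ := exists_walkWeight_eq (hfin v)
  exact linkedIn_of_walk p fun x hx => hc.eq_on_path p hp hx

/-- A connected set of cells is a connected set of vertices. -/
theorem IsVoronoi.connSet_preimage (hc : IsVoronoi G w T c) (hw : ∀ e, 0 < w e)
    (hfin : ∀ v, weightedDist G w v (c v) ≠ ⊤) {C : Finset V} (hCT : C ⊆ T)
    (hC : ConnSet (cellGraph G c) (C : Set V)) : ConnSet G {x | c x ∈ C} := by
  obtain ⟨⟨a, ha⟩, hconn⟩ := hC
  have hcell : ∀ v, c v ∈ C → LinkedIn G {x | c x ∈ C} v (c v) := fun v hv =>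
    (hc.linkedIn_cell hfin v).mono fun x hx => by
      rw [Set.mem_ofPred_eq] at hx ⊢
      rwa [hx]
  have hself : ∀ t ∈ C, c t = t := fun t ht => hc.eq_of_mem hw (hCT ht)
  have hcen : ∀ b ∈ C, LinkedIn G {x | c x ∈ C} a b := by
    intro b hb
    have h := hconn a ha b hb
    clear hb
    induction h with
    | refl => exact .refl
    | @tail b d _ hbd ih =>
      -- An edge between cells is followed by walking from the first centre to `u` inside its cell,
      -- across to `v`, and on to the second centre.
      obtain ⟨⟨-, u, v, rfl, rfl, huv⟩, hb, hd⟩ := hbd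
      refine (ih.trans (hcell u hb).symm).trans (LinkedIn.trans ?_ (hcell v hd))
      exact .single ⟨huv, hb, hd⟩
  refine connSet_of_center (u := a) ?_ fun v hv => (hcen _ hv).trans (hcell v hv).symm
  rw [Set.mem_ofPred_eq, hself a ha]
  exact ha

/-- The unions of the cells of the `h` covey sets are connected, disjoint and pairwise adjacent in
`G`: a complete minor, which contains every `H` on `h` vertices. -/
theorem IsVoronoi.isGraphMinor (hc : IsVoronoi G w T c) (hw : ∀ e, 0 < w e)
    (hfin : ∀ v, weightedDist G w v (c v) ≠ ⊤) {h : ℕ} {C : Fin h → Finset V}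
    (hC : IsCovey (cellGraph G c) Finset.univ C) (hCT : ∀ i, C i ⊆ T)
    (H : SimpleGraph (Fin h)) : IsGraphMinor H G := by
  refine ⟨fun i => {x | c x ∈ C i}, fun i => ?_, fun i j hij => ?_, fun i j hij => ?_⟩
  · exact (hc.connSet_preimage hw hfin (hCT i) (hC.conn i (Finset.mem_univ _))).induce_connected
  · have := hC.disj i (Finset.mem_univ _) j (Finset.mem_univ _) hij
    exact Set.disjoint_left.2 fun x hx hx' => Finset.disjoint_left.1 this hx hx'
  · obtain ⟨a, ha, b, hb, -, u, v, rfl, rfl, huv⟩ :=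
      hC.adj i (Finset.mem_univ _) j (Finset.mem_univ _) hij.ne
    exact ⟨u, ha, v, hb, huv⟩

/-- If the centre of `v` lies in `A` then `v` is dominated by two equal or adjacent centres, one in
`A` and one in `B`. -/
theorem IsVoronoi.exists_adjacent_centres (hc : IsVoronoi G w T c) (hw : ∀ e, 0 < w e)
    {A B : Finset V} (hT : T = A ∪ B) {R : ℝ≥0} {v b : V} (hvA : c v ∈ A) (hb : b ∈ B)
    (hvb : weightedDist G w v b ≤ R) :
    ∃ x ∈ A, ∃ y ∈ B, weightedDist G w v x ≤ R ∧ weightedDist G w v y ≤ R ∧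
      (x = y ∨ (cellGraph G c).Adj x y) := by
  have hbT : b ∈ T := hT ▸ Finset.mem_union_right _ hb
  obtain ⟨p, -, hp⟩ := exists_walkWeight_eq (hvb.trans_lt ENNReal.coe_lt_top).ne
  -- From a vertex `x` of the shortest path to `b`, the centre of `x` is at most as far as `b`, so
  -- the detour to it is no longer than the path.
  have hnear : ∀ x ∈ p.support, weightedDist G w v (c x) ≤ R := by
    intro x hx
    have h1 : weightedDist G w v (c x) ≤
        walkWeight w (p.takeUntil x hx) + weightedDist G w x (c x) := weightedDist_le_add _ _
    refine h1.trans (le_trans ?_ hvb)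
    rw [← hp]
    conv_rhs => rw [← p.take_spec hx, walkWeight_append, ENNReal.coe_add]
    gcongr
    exact (hc.le x b hbT).trans (weightedDist_le _)
  obtain ⟨x, hx, y, hy, hxA, hyB, hxy⟩ := exists_crossing (A := fun x => c x ∈ A)
    (B := fun x => c x ∈ B) p hvA (by rwa [hc.eq_of_mem hw hbT])
    (fun x => Finset.mem_union.1 (hT ▸ hc.mem x))
  refine ⟨c x, hxA, c y, hyB, hnear x hx, hnear y hy, ?_⟩
  rcases hxy with rfl | hxy
  · exact Or.inl rfl
  · by_cases heq : c x = c y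
    · exact Or.inl heq
    · exact Or.inr ⟨heq, x, y, rfl, rfl, hxy⟩

/-- The exchange graph of two dominating sets `L` and `O`: it has no covey of `h` sets if `G` has
no minor with `h` vertices, and each vertex is dominated by two equal or adjacent members of `L`
and `O`. -/
theorem exists_exchange_graph {h : ℕ} {H : SimpleGraph (Fin h)} (hH : ¬ IsGraphMinor H G) {ρ : ℝ}
    {L O : Finset V} (hL : IsRhoDominating G w ρ L) (hO : IsRhoDominating G w ρ O) :
    ∃ F : SimpleGraph V,
      (∀ C : Fin h → Finset V, IsCovey F Finset.univ C → ¬ ∀ i, C i ⊆ L ∪ O) ∧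
      ∀ v, ∃ x ∈ L, ∃ y ∈ O, weightedDist G w v x ≤ ENNReal.ofReal ρ ∧
        weightedDist G w v y ≤ ENNReal.ofReal ρ ∧ (x = y ∨ F.Adj x y) := by
  rcases isEmpty_or_nonempty V with hV | ⟨⟨v₀⟩⟩
  -- Without vertices, a covey forces `h = 0`, and then `H` is trivially a minor.
  · refine ⟨⊥, fun C hC _ => hH ⟨fun _ => ∅, ?_, by simp, ?_⟩, fun v => hV.elim v⟩
    · intro i
      obtain ⟨a, -⟩ := (hC.conn i (Finset.mem_univ _)).1
      exact hV.elim a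
    · intro i
      obtain ⟨a, -⟩ := (hC.conn i (Finset.mem_univ _)).1
      exact hV.elim a
  obtain ⟨w', R, hw', hR⟩ := exists_pos_weights G w ρ
  simp only [hR]
  have hne : (L ∪ O).Nonempty := by
    obtain ⟨y, hy, -⟩ := hL v₀
    exact ⟨y, Finset.mem_union_left _ hy⟩
  obtain ⟨c, hc⟩ := exists_isVoronoi G w' hne
  have hfin : ∀ v, weightedDist G w' v (c v) ≠ ⊤ := by
    intro v
    obtain ⟨y, hy, hyd⟩ := hL v
    rw [hR] at hyd
    exact (((hc.le v y (Finset.mem_union_left _ hy)).trans hyd).trans_lt ENNReal.coe_lt_top).ne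
  refine ⟨cellGraph G c, fun C hC hCT => hH (hc.isGraphMinor hw' hfin hC hCT H), fun v => ?_⟩
  obtain ⟨a, ha, hva⟩ := hL v
  obtain ⟨b, hb, hvb⟩ := hO v
  rw [hR] at hva hvb
  rcases Finset.mem_union.1 (hc.mem v) with h1 | h1
  · exact hc.exists_adjacent_centres hw' rfl h1 hb hvb
  · obtain ⟨x, hx, y, hy, h2, h3, h4⟩ :=
      hc.exists_adjacent_centres hw' (Finset.union_comm L O) h1 ha hva
    exact ⟨y, hy, x, hx, h3, h2, h4.imp Eq.symm SimpleGraph.Adj.symm⟩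

end ExchangeGraph

/-! ### The exchange argument. -/

section LocalOptimum

variable {V : Type*} [DecidableEq V]

/-- A local optimum is not much larger than any solution `O`, if the exchange graph has a good
division. -/
theorem card_le_of_hasDivision {F : SimpleGraph V} {L O : Finset V} {D : V → V → Prop} {r : ℕ}
    {M : ℝ} (hpair : ∀ v, ∃ x ∈ L, ∃ y ∈ O, D v x ∧ D v y ∧ (x = y ∨ F.Adj x y))
    (hdiv : HasDivision F (L ∪ O) r M)
    (hopt : ∀ S : Finset V, (∀ v, ∃ y ∈ S, D v y) → (L \ S).card + (S \ L).card ≤ r →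
      L.card ≤ S.card) :
    (L.card : ℝ) ≤ O.card + 2 * (M - (L ∪ O).card) := by
  classical
  obtain ⟨ι, _, R, hRsub, hRcard, hRcov, hRedge, hRsum⟩ := hdiv
  let mult : V → ℕ := fun v => (Finset.univ.filter fun i => v ∈ R i).card
  -- The vertices private to a region. An exchange edge at such a vertex can only be covered by this
  -- region, so its other end is there too.
  let Core : ι → Finset V := fun i => (R i).filter fun v => mult v = 1
  have hdouble : ∀ A : Finset V, ∑ i, (A ∩ R i).card = ∑ v ∈ A, mult v := by
    intro A
    have h1 : ∀ i, (A ∩ R i).card = ∑ v ∈ A, if v ∈ R i then 1 else 0 := fun i => by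
      rw [← Finset.filter_mem_eq_inter, Finset.card_filter]
    have h2 : ∀ v, mult v = ∑ i, if v ∈ R i then 1 else 0 := fun v => Finset.card_filter _ _
    simp only [h1, h2]
    exact Finset.sum_comm
  have hmult : ∀ v ∈ L ∪ O, 1 ≤ mult v := by
    intro v hv
    obtain ⟨i, hi⟩ := hRcov v hv
    exact Finset.card_pos.2 ⟨i, by simpa using hi⟩
  have huniq : ∀ v i j, mult v = 1 → v ∈ R i → v ∈ R j → i = j := by
    intro v i j h1 hi hj
    exact Finset.card_le_one.1 h1.le i (by simpa using hi) j (by simpa using hj)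
  -- Replace `L ∩ Core i` by `O ∩ R i`. A vertex whose partner `x ∈ L` was removed is still
  -- dominated by `y`, which lies in `R i`. All changes are inside `R i`, so the swap has size at
  -- most `r` and local optimality applies.
  have hswap : ∀ i, (L ∩ Core i).card ≤ (O ∩ R i).card := by
    intro i
    have hIR : Core i ⊆ R i := Finset.filter_subset _ _
    have hle : L.card ≤ ((L \ Core i) ∪ (O ∩ R i)).card := by
      refine hopt _ (fun v => ?_) ?_
      · obtain ⟨x, hx, y, hy, hvx, hvy, hxy⟩ := hpair v
        by_cases hxI : x ∈ Core i
        · refine ⟨y, Finset.mem_union_right _ (Finset.mem_inter.2 ⟨hy, ?_⟩), hvy⟩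
          rcases hxy with rfl | hxy
          · exact hIR hxI
          · obtain ⟨j, hxj, hyj⟩ := hRedge x (Finset.mem_union_left _ hx) y
              (Finset.mem_union_right _ hy) hxy
            obtain ⟨hxi, hx1⟩ := Finset.mem_filter.1 hxI
            rwa [huniq x i j hx1 hxi hxj]
        · exact ⟨x, Finset.mem_union_left _ (Finset.mem_sdiff.2 ⟨hx, hxI⟩), hvx⟩
      · refine le_trans ?_ (hRcard i)
        rw [← Finset.card_union_of_disjoint (Finset.disjoint_left.2 fun x hx hx' =>
          (Finset.mem_sdiff.1 hx').2 (Finset.mem_sdiff.1 hx).1)]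
        refine Finset.card_le_card fun x hx => ?_
        simp only [Finset.mem_union, Finset.mem_sdiff, Finset.mem_inter] at hx
        have := @hIR x
        tauto
    have h1 := Finset.card_union_le (L \ Core i) (O ∩ R i)
    have h2 := Finset.card_sdiff_add_card_inter L (Core i)
    omega
  have hCore : ∑ i, (L ∩ Core i).card = ∑ v ∈ L, if mult v = 1 then 1 else 0 := by
    have h1 : ∀ i, (L ∩ Core i).card = ((L.filter fun v => mult v = 1) ∩ R i).card := by
      intro i
      congr 1
      ext x
      simp only [Core, Finset.mem_inter, Finset.mem_filter]
      tauto
    simp only [h1]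
    rw [hdouble, Finset.sum_filter]
    refine Finset.sum_congr rfl fun v _ => ?_
    split_ifs with h <;> simp [h]
  have hmain : ∑ v ∈ L, (if mult v = 1 then 1 else 0) ≤ ∑ v ∈ O, mult v := by
    rw [← hCore, ← hdouble]
    exact Finset.sum_le_sum fun i _ => hswap i
  -- Linearizes the count of private vertices: `2 - mult v` is at most `1` if `mult v = 1` and at
  -- most `0` otherwise. What remains is the excess `mult v - 1` over `L` and over `O`, each bounded
  -- by the total overlap.
  have hmainR : (∑ v ∈ L, (2 - (mult v : ℝ))) ≤ ∑ v ∈ O, (mult v : ℝ) := by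
    refine le_trans (Finset.sum_le_sum fun v hv => ?_)
      (by exact_mod_cast hmain : (∑ v ∈ L, ((if mult v = 1 then 1 else 0 : ℕ) : ℝ)) ≤ _)
    have h1 := hmult v (Finset.mem_union_left _ hv)
    split_ifs with h
    · rw [h]; norm_num
    · have : (2 : ℝ) ≤ mult v := by exact_mod_cast (by omega : 2 ≤ mult v)
      push_cast
      linarith
  have htot : (∑ v ∈ L ∪ O, ((mult v : ℝ) - 1)) ≤ M - (L ∪ O).card := by
    rw [Finset.sum_sub_distrib, Finset.sum_const, nsmul_eq_mul, mul_one]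
    have h1 : (∑ v ∈ L ∪ O, (mult v : ℝ)) = ∑ i, ((R i).card : ℝ) := by
      have h2 := hdouble (L ∪ O)
      have h3 : ∀ i, (L ∪ O) ∩ R i = R i := fun i => Finset.inter_eq_right.2 (hRsub i)
      simp only [h3] at h2
      exact_mod_cast h2.symm
    rw [h1]
    linarith
  have hpart : ∀ A ⊆ L ∪ O, (∑ v ∈ A, ((mult v : ℝ) - 1)) ≤ M - (L ∪ O).card := by
    intro A hA
    refine le_trans (Finset.sum_le_sum_of_subset_of_nonneg hA fun v hv _ => ?_) htot
    have : (1 : ℝ) ≤ mult v := by exact_mod_cast hmult v hv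
    linarith
  have hpL := hpart L Finset.subset_union_left
  have hpO := hpart O Finset.subset_union_right
  simp only [Finset.sum_sub_distrib, Finset.sum_const, nsmul_eq_mul, mul_one] at hpL hpO hmainR
  linarith

end LocalOptimum

/-! ### The approximation ratio of local search. -/

section Approximation

variable {V : Type*} [Fintype V] {G : SimpleGraph V} {w : Sym2 V → ℝ≥0} {ρ : ℝ}

theorem isRhoDominating_univ : IsRhoDominating G w ρ Finset.univ :=
  fun x => ⟨x, Finset.mem_univ _, by rw [weightedDist_self]; exact zero_le⟩

omit [Fintype V] in
theorem isRhoDominating_of_reflTransGen [DecidableEq V] {s : ℕ} {S S' : Finset V}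
    (h : Relation.ReflTransGen (LocalSearchStep G w ρ s) S S') (hS : IsRhoDominating G w ρ S) :
    IsRhoDominating G w ρ S' := by
  induction h with
  | refl => exact hS
  | tail _ h _ => exact h.1

/-- With `c = 2 * (h + 1) ^ 2` the constant `192 * (h + 1) ^ 2` equals `96 * c`. The overlap is then
at most `ε / 6 * (|L| + |O|)`, and it enters twice. Regions have at most `q ^ 2` vertices, which is
exactly the swap size. -/
theorem IsLocalSearchResult.card_le [LinearOrder V] {h : ℕ} {H : SimpleGraph (Fin h)}
    (hH : ¬ IsGraphMinor H G) {ε : ℝ} (hε : 0 < ε) (hε2 : ε < 1 / 2) {q : ℕ}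
    (hq : (192 * (h + 1) ^ 2 : ℕ) / ε ≤ q) {L O : Finset V}
    (hL : IsLocalSearchResult G w ρ (q ^ 2) L) (hO : IsRhoDominating G w ρ O) :
    (L.card : ℝ) ≤ (1 + ε) * O.card := by
  obtain ⟨F, hF, hpair⟩ := exists_exchange_graph hH
    (isRhoDominating_of_reflTransGen hL.1 isRhoDominating_univ) hO
  set c : ℝ := 2 * (h + 1) * (h + 1) with hc
  have hc1 : 1 ≤ c := by
    have : (0 : ℝ) ≤ h := by positivity
    nlinarith
  have hqc : 96 * c ≤ q * ε := by
    rw [div_le_iff₀ hε] at hq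
    push_cast at hq
    linarith
  have hq0 : (0 : ℝ) < q := by
    by_contra! hcon
    nlinarith
  have hdiv := (hasSplits_of_no_covey hF).hasDivision hc1 (q := q) (by nlinarith)
  have hmain := card_le_of_hasDivision hpair hdiv (fun S hS hcard => by
    by_contra! hlt
    exact hL.2 S ⟨hS, hlt, hcard⟩)
  have hT : ((L ∪ O).card : ℝ) ≤ L.card + O.card := by exact_mod_cast Finset.card_union_le L O
  have hfrac : 16 * c * (L ∪ O).card / q ≤ ε / 6 * (L.card + O.card) := by
    rw [div_le_iff₀ hq0]
    calc 16 * c * (L ∪ O).card ≤ 16 * c * (L.card + O.card) := by gcongr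
      _ = (96 * c) / 6 * (L.card + O.card) := by ring
      _ ≤ (q * ε) / 6 * (L.card + O.card) := by gcongr
      _ = _ := by ring
  have h1 : (L.card : ℝ) ≤ O.card + ε / 3 * (L.card + O.card) := by linarith
  have h2 : (0 : ℝ) ≤ O.card := by positivity
  have h3 : (0 : ℝ) ≤ L.card := by positivity
  -- Uses `(1 - ε/3) * (1 + ε) - (1 + ε/3) = ε * (1 - ε) / 3 ≥ 0`.
  have h4 : (1 - ε / 3) * (L.card : ℝ) ≤ (1 - ε / 3) * ((1 + ε) * O.card) := by
    have : 0 ≤ ε * (1 - ε) * O.card := by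
      have : 0 ≤ 1 - ε := by linarith
      positivity
    nlinarith
  exact le_of_mul_le_mul_left h4 (by linarith)

end Approximation

/-! ### Structured programs and their machine code. -/

namespace RealRAM

/-- The registers and arrays of a machine, without the program counter. -/
structure Mem : Type where
  natReg : ℕ → ℕ
  natArr : ℕ → ℕ → ℕ
  realReg : ℕ → ℝ
  realArr : ℕ → ℕ → ℝ

namespace Mem

/-- The configuration with memory `m` and program counter `p`. -/
def toConfig (m : Mem) (p : ℕ) : Config := ⟨p, m.natReg, m.natArr, m.realReg, m.realArr⟩

def setNat (m : Mem) (d k : ℕ) : Mem := { m with natReg := Function.update m.natReg d k }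

noncomputable def setReal (m : Mem) (d : ℕ) (x : ℝ) : Mem :=
  { m with realReg := Function.update m.realReg d x }

def storeNat (m : Mem) (a i k : ℕ) : Mem := { m with natArr := setArr m.natArr a i k }

noncomputable def storeReal (m : Mem) (a i : ℕ) (x : ℝ) : Mem :=
  { m with realArr := setArr m.realArr a i x }

variable (m : Mem) (a d i k : ℕ) (x : ℝ)

@[simp] theorem setNat_natReg (r : ℕ) :
    (m.setNat d k).natReg r = if r = d then k else m.natReg r := by
  simp [setNat, Function.update_apply]
@[simp] theorem setNat_natArr : (m.setNat d k).natArr = m.natArr := rfl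
@[simp] theorem setNat_realReg : (m.setNat d k).realReg = m.realReg := rfl
@[simp] theorem setNat_realArr : (m.setNat d k).realArr = m.realArr := rfl

@[simp] theorem setReal_realReg (r : ℕ) :
    (m.setReal d x).realReg r = if r = d then x else m.realReg r := by
  simp [setReal, Function.update_apply]
@[simp] theorem setReal_natReg : (m.setReal d x).natReg = m.natReg := rfl
@[simp] theorem setReal_natArr : (m.setReal d x).natArr = m.natArr := rfl
@[simp] theorem setReal_realArr : (m.setReal d x).realArr = m.realArr := rfl

theorem setArr_apply {α : Type} (f : ℕ → ℕ → α) (a i : ℕ) (x : α) (b : ℕ) :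
    setArr f a i x b = if b = a then Function.update (f a) i x else f b := by
  simp [setArr, Function.update_apply]

@[simp] theorem storeNat_natArr (b : ℕ) : (m.storeNat a i k).natArr b =
    if b = a then Function.update (m.natArr a) i k else m.natArr b := setArr_apply _ _ _ _ _
@[simp] theorem storeNat_natReg : (m.storeNat a i k).natReg = m.natReg := rfl
@[simp] theorem storeNat_realReg : (m.storeNat a i k).realReg = m.realReg := rfl
@[simp] theorem storeNat_realArr : (m.storeNat a i k).realArr = m.realArr := rfl

@[simp] theorem storeReal_realArr (b : ℕ) : (m.storeReal a i x).realArr b =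
    if b = a then Function.update (m.realArr a) i x else m.realArr b := setArr_apply _ _ _ _ _
@[simp] theorem storeReal_natReg : (m.storeReal a i x).natReg = m.natReg := rfl
@[simp] theorem storeReal_natArr : (m.storeReal a i x).natArr = m.natArr := rfl
@[simp] theorem storeReal_realReg : (m.storeReal a i x).realReg = m.realReg := rfl

end Mem

/-- Effect on the memory of the instructions that are neither jumps nor `halt`. -/
noncomputable def Instr.effect (m : Mem) : Instr → Option Mem
  | .natConst d k => some (m.setNat d k)
  | .natAdd d a b => some (m.setNat d (m.natReg a + m.natReg b))
  | .natSub d a b => some (m.setNat d (m.natReg a - m.natReg b))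
  | .natLoad d r a => some (m.setNat d (m.natArr r (m.natReg a)))
  | .natStore r a b => some (m.storeNat r (m.natReg a) (m.natReg b))
  | .realConst d k => some (m.setReal d k)
  | .realAdd d a b => some (m.setReal d (m.realReg a + m.realReg b))
  | .realSub d a b => some (m.setReal d (m.realReg a - m.realReg b))
  | .realLoad d r a => some (m.setReal d (m.realArr r (m.natReg a)))
  | .realStore r a b => some (m.storeReal r (m.natReg a) (m.realReg b))
  | .jump _ => none
  | .jumpNatLE _ _ _ => none
  | .jumpRealLE _ _ _ => none
  | .halt => none

theorem Instr.exec_toConfig {i : Instr} {m m' : Mem} (h : i.effect m = some m') (p : ℕ) :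
    exec (m.toConfig p) i = some (m'.toConfig (p + 1)) := by
  cases i <;> simp only [Instr.effect, Option.some.injEq, reduceCtorEq] at h <;> subst h <;> rfl

/-- Comparisons of two registers. -/
inductive Test : Type
  | nat (a b : ℕ)
  | real (a b : ℕ)

def Test.Holds (m : Mem) : Test → Prop
  | .nat a b => m.natReg a ≤ m.natReg b
  | .real a b => m.realReg a ≤ m.realReg b

def Test.jump (l : ℕ) : Test → Instr
  | .nat a b => .jumpNatLE a b l
  | .real a b => .jumpRealLE a b l

theorem Test.exec_of_holds {b : Test} {m : Mem} (h : b.Holds m) (p l : ℕ) :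
    exec (m.toConfig p) (b.jump l) = some (m.toConfig l) := by
  cases b <;> simp_all [Test.Holds, Test.jump, exec, Mem.toConfig]

theorem Test.exec_of_not_holds {b : Test} {m : Mem} (h : ¬ b.Holds m) (p l : ℕ) :
    exec (m.toConfig p) (b.jump l) = some (m.toConfig (p + 1)) := by
  cases b with
  | nat a b => exact congrArg (fun q => some (m.toConfig q)) (if_neg h)
  | real a b => exact congrArg (fun q => some (m.toConfig q)) (if_neg h)

/-- Structured programs. -/
inductive Cmd : Type
  | instr (i : Instr)
  | seq (c d : Cmd)
  | ite (b : Test) (c d : Cmd)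
  | loop (b : Test) (c : Cmd)

infixr:60 " ;; " => Cmd.seq

namespace Cmd

def size : Cmd → ℕ
  | instr _ => 1
  | seq c d => c.size + d.size
  | ite _ c d => d.size + 2 + c.size
  | loop _ c => c.size + 2

/-- Machine code of a structured program, to be placed from line `p` on. -/
def compile : Cmd → ℕ → List Instr
  | instr i, _ => [i]
  | seq c d, p => c.compile p ++ d.compile (p + c.size)
  | ite b c d, p => b.jump (p + d.size + 2) :: (d.compile (p + 1) ++
      .jump (p + d.size + 2 + c.size) :: c.compile (p + d.size + 2))
  | loop b c, p => b.jump (p + c.size + 2) :: (c.compile (p + 1) ++ [.jump p])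

end Cmd

end RealRAM

/-! ### Big-step semantics, correctness of compilation, and timed Hoare triples. -/

namespace RealRAM

namespace Cmd

theorem length_compile (c : Cmd) (p : ℕ) : (c.compile p).length = c.size := by
  induction c generalizing p with
  | instr i => rfl
  | seq c d hc hd => simp [compile, size, hc, hd]
  | ite b c d hc hd => simp [compile, size, hc, hd]; omega
  | loop b c hc => simp [compile, size, hc]

/-- `Big c m t m'`: run on the memory `m`, the program `c` ends after `t` steps with the
memory `m'`. -/
inductive Big : Cmd → Mem → ℕ → Mem → Prop
  | instr {i : Instr} {m m' : Mem} : i.effect m = some m' → Big (.instr i) m 1 m'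
  | seq {c d : Cmd} {m m' m'' : Mem} {s t : ℕ} :
      Big c m s m' → Big d m' t m'' → Big (.seq c d) m (s + t) m''
  | ite_true {b : Test} {c d : Cmd} {m m' : Mem} {t : ℕ} :
      b.Holds m → Big c m t m' → Big (.ite b c d) m (1 + t) m'
  | ite_false {b : Test} {c d : Cmd} {m m' : Mem} {t : ℕ} :
      ¬ b.Holds m → Big d m t m' → Big (.ite b c d) m (1 + (t + 1)) m'
  | loop_done {b : Test} {c : Cmd} {m : Mem} : b.Holds m → Big (.loop b c) m 1 m
  | loop_step {b : Test} {c : Cmd} {m m' m'' : Mem} {s t : ℕ} :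
      ¬ b.Holds m → Big c m s m' → Big (.loop b c) m' t m'' →
      Big (.loop b c) m (1 + (s + (1 + t))) m''

end Cmd

/-- The lines of `P` from `p` on are those of the list. -/
def CodeAt (P : Program) : ℕ → List Instr → Prop
  | _, [] => True
  | p, i :: l => P[p]? = some i ∧ CodeAt P (p + 1) l

theorem codeAt_append {P : Program} {p : ℕ} {l l' : List Instr} :
    CodeAt P p (l ++ l') ↔ CodeAt P p l ∧ CodeAt P (p + l.length) l' := by
  induction l generalizing p with
  | nil => simp [CodeAt]
  | cons i l ih =>
    simp only [List.cons_append, CodeAt, ih, List.length_cons, and_assoc]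
    rw [show p + 1 + l.length = p + (l.length + 1) by omega]

theorem codeAt_suffix (l l' : List Instr) : CodeAt (l' ++ l) l'.length l := by
  induction l generalizing l' with
  | nil => trivial
  | cons i l ih =>
    refine ⟨by simp, ?_⟩
    simpa using ih (l' ++ [i])

theorem RunsIn.trans {P : Program} {s t : ℕ} {a b c : Config} (h : RunsIn P s a b)
    (h' : RunsIn P t b c) : RunsIn P (s + t) a c := by
  induction h' with
  | refl => exact h
  | tail _ hstep ih => exact .tail (ih h) hstep

theorem RunsIn.of_exec {P : Program} {m : Mem} {p : ℕ} {i : Instr} {c : Config}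
    (hi : P[p]? = some i) (h : exec (m.toConfig p) i = some c) :
    RunsIn P 1 (m.toConfig p) c := by
  refine .tail (.refl _) ?_
  have : P[(m.toConfig p).pc]? = some i := hi
  rw [step, this]
  exact h

/-- Step counts are exact. In a conditional the second branch comes first in the code, reached by
falling through the test; its closing jump over the first branch is the extra step in `ite_false`.
-/
theorem Cmd.Big.runsIn {c : Cmd} {m m' : Mem} {t : ℕ} (h : Big c m t m') {P : Program} {p : ℕ}
    (hP : CodeAt P p (c.compile p)) : RunsIn P t (m.toConfig p) (m'.toConfig (p + c.size)) := by
  induction h generalizing p with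
  | instr h => exact .of_exec hP.1 (Instr.exec_toConfig h p)
  | seq _ _ ih ih' =>
    rw [compile, codeAt_append, length_compile] at hP
    have := (ih hP.1).trans (ih' hP.2)
    rwa [add_assoc] at this
  | @ite_true b c d _ _ _ hb _ ih =>
    obtain ⟨h1, h2⟩ := hP
    rw [codeAt_append, length_compile] at h2
    have h3 := h2.2.2
    rw [show p + 1 + d.size + 1 = p + d.size + 2 by omega] at h3
    have := (RunsIn.of_exec h1 (Test.exec_of_holds hb p _)).trans (ih h3)
    rwa [show p + d.size + 2 + c.size = p + (ite b c d).size by simp [size]; omega] at this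
  | @ite_false b c d _ _ _ hb _ ih =>
    obtain ⟨h1, h2⟩ := hP
    rw [codeAt_append, length_compile] at h2
    refine (RunsIn.of_exec h1 (Test.exec_of_not_holds hb p _)).trans ((ih h2.1).trans ?_)
    refine RunsIn.of_exec h2.2.1 ?_
    rw [show p + (ite b c d).size = p + d.size + 2 + c.size by simp [size]; omega]
    rfl
  | loop_done hb =>
    exact RunsIn.of_exec hP.1 (Test.exec_of_holds hb p _)
  | @loop_step b c _ _ _ _ _ hb _ _ ih ih' =>
    have hP' := hP
    obtain ⟨h1, h2⟩ := hP
    rw [codeAt_append, length_compile] at h2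
    refine (RunsIn.of_exec h1 (Test.exec_of_not_holds hb p _)).trans ((ih h2.1).trans ?_)
    exact (RunsIn.of_exec h2.2.1 rfl).trans (ih' hP')

/-- The machine stops because the program counter ends just behind the last line. -/
theorem Cmd.Big.haltsIn {c : Cmd} {m m' : Mem} {t : ℕ} (h : Big c m t m') :
    HaltsIn (c.compile 0) t (m.toConfig 0) (m'.toConfig c.size) := by
  refine ⟨by simpa using h.runsIn (codeAt_suffix (c.compile 0) []), ?_⟩
  have : (c.compile 0)[(m'.toConfig c.size).pc]? = none :=
    List.getElem?_eq_none (by rw [length_compile]; exact le_rfl)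
  rw [step, this]
  rfl

/-- Names of registers and arrays. -/
inductive Loc : Type
  | natReg (r : ℕ)
  | natArr (a : ℕ)
  | realReg (r : ℕ)
  | realArr (a : ℕ)
  deriving DecidableEq

/-- The two memories agree in the given register or array. -/
def Mem.Agree (m m' : Mem) : Loc → Prop
  | .natReg r => m'.natReg r = m.natReg r
  | .natArr a => m'.natArr a = m.natArr a
  | .realReg r => m'.realReg r = m.realReg r
  | .realArr a => m'.realArr a = m.realArr a

theorem Mem.Agree.refl (m : Mem) (l : Loc) : m.Agree m l := by cases l <;> rfl

theorem Mem.Agree.trans {m m' m'' : Mem} {l : Loc} (h : m.Agree m' l) (h' : m'.Agree m'' l) :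
    m.Agree m'' l := by
  cases l <;> exact Eq.trans h' h

def Instr.writes : Instr → List Loc
  | .natConst d _ => [.natReg d]
  | .natAdd d _ _ => [.natReg d]
  | .natSub d _ _ => [.natReg d]
  | .natLoad d _ _ => [.natReg d]
  | .natStore r _ _ => [.natArr r]
  | .realConst d _ => [.realReg d]
  | .realAdd d _ _ => [.realReg d]
  | .realSub d _ _ => [.realReg d]
  | .realLoad d _ _ => [.realReg d]
  | .realStore r _ _ => [.realArr r]
  | _ => []

/-- The registers and arrays that a program may change. -/
def Cmd.writes : Cmd → List Loc
  | instr i => i.writes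
  | seq c d => c.writes ++ d.writes
  | ite _ c d => c.writes ++ d.writes
  | loop _ c => c.writes

/-- `m'` agrees with `m` outside of what `c` may change. -/
def Frame (c : Cmd) (m m' : Mem) : Prop := ∀ l ∉ c.writes, m.Agree m' l

theorem Frame.refl (c : Cmd) (m : Mem) : Frame c m m := fun l _ => .refl m l

theorem Frame.trans {c : Cmd} {m m' m'' : Mem} (h : Frame c m m') (h' : Frame c m' m'') :
    Frame c m m'' := fun l hl => (h l hl).trans (h' l hl)

section

variable {c : Cmd} {m m' : Mem} (h : Frame c m m')
include h

theorem Frame.natReg (r : ℕ) (hr : Loc.natReg r ∉ c.writes) : m'.natReg r = m.natReg r := h _ hr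
theorem Frame.natArr (r : ℕ) (hr : Loc.natArr r ∉ c.writes) : m'.natArr r = m.natArr r := h _ hr
theorem Frame.realReg (r : ℕ) (hr : Loc.realReg r ∉ c.writes) :
    m'.realReg r = m.realReg r := h _ hr
theorem Frame.realArr (r : ℕ) (hr : Loc.realArr r ∉ c.writes) :
    m'.realArr r = m.realArr r := h _ hr

end

/-- The written locations are read off the syntax, so for concrete programs preservation of a
register is a decidable membership question. -/
theorem Cmd.Big.frame {c : Cmd} {m m' : Mem} {t : ℕ} (h : Big c m t m') : Frame c m m' := by
  induction h with
  | @instr i _ _ h =>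
    intro l hl
    cases i <;> simp only [Instr.effect, Option.some.injEq, reduceCtorEq] at h <;> subst h <;>
      cases l <;> simp_all [Mem.Agree, writes, Instr.writes]
  | seq _ _ ih ih' =>
    intro l hl
    rw [writes, List.mem_append, not_or] at hl
    exact (ih l hl.1).trans (ih' l hl.2)
  | ite_true _ _ ih =>
    intro l hl
    rw [writes, List.mem_append, not_or] at hl
    exact ih l hl.1
  | ite_false _ _ ih =>
    intro l hl
    rw [writes, List.mem_append, not_or] at hl
    exact ih l hl.2
  | loop_done _ => exact .refl _ _
  | loop_step _ _ _ ih ih' =>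
    intro l hl
    exact (ih l hl).trans (ih' l hl)

/-- Run on `m`, the program `c` ends after at most `T` steps with a memory that satisfies `Q`. -/
def Does (c : Cmd) (m : Mem) (T : ℕ) (Q : Mem → Prop) : Prop :=
  ∃ t m', t ≤ T ∧ c.Big m t m' ∧ Q m'

namespace Does

variable {c d : Cmd} {m : Mem} {T T' : ℕ} {Q Q' : Mem → Prop}

/-- The new postcondition may also use the frame, so specifications mention only what changes. -/
theorem mono (h : Does c m T Q) (hT : T ≤ T') (hQ : ∀ m', Frame c m m' → Q m' → Q' m') :
    Does c m T' Q' := by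
  obtain ⟨t, m', ht, hb, hq⟩ := h
  exact ⟨t, m', ht.trans hT, hb, hQ m' hb.frame hq⟩

theorem time (h : Does c m T Q) (hT : T ≤ T') : Does c m T' Q := h.mono hT fun _ _ h => h

theorem instr {i : Instr} {m' : Mem} (h : i.effect m = some m') (hQ : Q m') :
    Does (.instr i) m 1 Q :=
  ⟨1, m', le_rfl, .instr h, hQ⟩

theorem seq (h : Does c m T Q') (h' : ∀ m', Frame c m m' → Q' m' → Does d m' T' Q) :
    Does (c ;; d) m (T + T') Q := by
  obtain ⟨t, m', ht, hb, hq⟩ := h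
  obtain ⟨t', m'', ht', hb', hq'⟩ := h' m' hb.frame hq
  exact ⟨t + t', m'', by omega, .seq hb hb', hq'⟩

theorem instr_seq {i : Instr} {m' : Mem} (h : i.effect m = some m') (h' : Does d m' T Q) :
    Does (.instr i ;; d) m (1 + T) Q :=
  seq (Q' := fun m'' => m'' = m') (instr h rfl) fun _ _ h => h ▸ h'

theorem ite {b : Test} (hc : b.Holds m → Does c m T Q) (hd : ¬ b.Holds m → Does d m T Q) :
    Does (.ite b c d) m (T + 2) Q := by
  by_cases hb : b.Holds m
  · obtain ⟨t, m', ht, h, hq⟩ := hc hb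
    exact ⟨_, m', by omega, .ite_true hb h, hq⟩
  · obtain ⟨t, m', ht, h, hq⟩ := hd hb
    exact ⟨_, m', by omega, .ite_false hb h, hq⟩

/-- A loop that makes exactly `N` iterations. -/
theorem loop {b : Test} (Inv : ℕ → Mem → Prop) {N : ℕ} (h0 : Inv 0 m)
    (hstep : ∀ j < N, ∀ m', Frame c m m' → Inv j m' → ¬ b.Holds m' ∧ Does c m' T (Inv (j + 1)))
    (hend : ∀ m', Frame c m m' → Inv N m' → b.Holds m') :
    Does (.loop b c) m (N * (T + 2) + 1) (Inv N) := by
  -- Induction on the remaining iterations. Each pays two steps beyond its body, the failing test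
  -- and the jump back; the final `1` is the succeeding test.
  suffices h : ∀ k j m', k + j = N → Frame c m m' → Inv j m' →
      Does (.loop b c) m' (k * (T + 2) + 1) (Inv N) from h N 0 m rfl (.refl _ _) h0
  intro k
  induction k with
  | zero =>
    intro j m' hj hf hi
    obtain rfl : j = N := by omega
    exact ⟨1, m', by omega, .loop_done (hend m' hf hi), hi⟩
  | succ k ih =>
    intro j m' hj hf hi
    obtain ⟨hb, t, m'', ht, hc, hi'⟩ := hstep j (by omega) m' hf hi
    obtain ⟨t', m₃, ht', hc', hq⟩ := ih (j + 1) m'' (by omega) (hf.trans hc.frame) hi'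
    exact ⟨_, m₃, by rw [add_mul]; omega, .loop_step hb hc hc', hq⟩

end Does

/-- `for i = 0, …, N - 1 do c`, where `i` and `N` are registers. -/
def Cmd.forLoop (i N : ℕ) (c : Cmd) : Cmd :=
  .instr (.natConst i 0) ;;
  .loop (.nat N i) (c ;; .instr (.natConst 1 1) ;; .instr (.natAdd i i 1))

/-- Register `1` is scratch space for the constant one. The body must establish the invariant for
the memory after the counter update, hence the two `setNat`. The overhead `4` is the test, the two
instructions of the increment and the jump back. -/
theorem Does.forLoop {c : Cmd} {m : Mem} {i N T : ℕ} (Inv : ℕ → Mem → Prop) {n : ℕ}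
    (hn : m.natReg N = n)
    (hreg : i ≠ 1 ∧ N ≠ 1 ∧ N ≠ i ∧ Loc.natReg i ∉ c.writes ∧ Loc.natReg N ∉ c.writes)
    (h0 : Inv 0 (m.setNat i 0))
    (hstep : ∀ j < n, ∀ m', Frame (.forLoop i N c) m m' → m'.natReg i = j → Inv j m' →
      Does c m' T (fun m'' => Inv (j + 1) ((m''.setNat 1 1).setNat i (j + 1)))) :
    Does (.forLoop i N c) m (n * (T + 4) + 2) (Inv n) := by
  obtain ⟨hi1, hN1, hNi, hci, hcN⟩ := hreg
  have hsub : ∀ m₁, Frame (c ;; .instr (.natConst 1 1) ;; .instr (.natAdd i i 1))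
      (m.setNat i 0) m₁ → Frame (.forLoop i N c) m m₁ := by
    intro m₁ hf l hl
    have h1 : Frame (.instr (.natConst i 0)) m (m.setNat i 0) := (Cmd.Big.instr rfl).frame
    rw [Cmd.forLoop, Cmd.writes, List.mem_append, not_or] at hl
    exact (h1 l hl.1).trans (hf l hl.2)
  have hNf : ∀ m₁, Frame (.forLoop i N c) m m₁ → m₁.natReg N = n := by
    intro m₁ hf
    rw [hf.natReg N, hn]
    simp [Cmd.forLoop, Cmd.writes, Instr.writes, hcN, hN1, hNi]
  refine Does.time (Does.instr_seq rfl ((Does.loop (N := n) (T := T + 2)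
    (fun j m' => m'.natReg i = j ∧ Inv j m') ⟨by simp, h0⟩ ?_ ?_).mono le_rfl
      fun _ _ h => h.2)) (T := 1 + (n * (T + 2 + 2) + 1))
    (le_of_eq (by ring))
  · rintro j hj m' hf ⟨hij, hinv⟩
    refine ⟨?_, ?_⟩
    · simp only [Test.Holds, hNf m' (hsub m' hf), hij]
      omega
    · refine (Does.seq (hstep j hj m' (hsub m' hf) hij hinv) fun m₁ hf₁ h₁ =>
        Does.instr_seq rfl (T := 1) (Does.instr rfl ?_)).time (by omega)
      have h2 : m₁.natReg i = j := by rw [hf₁.natReg i hci, hij]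
      have h3 : (m₁.setNat 1 1).natReg i + (m₁.setNat 1 1).natReg 1 = j + 1 := by
        simp [hi1, h2]
      rw [h3]
      exact ⟨by simp, h₁⟩
  · rintro m' hf ⟨hij, -⟩
    simp only [Test.Holds, hNf m' (hsub m' hf), hij]
    exact le_rfl

end RealRAM

/-! ### Arithmetic subroutines: products, rounding up, and the number of swaps. -/

namespace RealRAM

namespace Cmd

/-- A program without an effect that matters. -/
def skip : Cmd := .instr (.natConst 1 1)

/-- Register `d` becomes the product of the registers `a` and `b`. -/
def mul (d a b i : ℕ) : Cmd := .instr (.natConst d 0) ;; .forLoop i b (.instr (.natAdd d d a))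

/-- Register `10` becomes the position of the entry `x, y` of a matrix. -/
def entry (x y : ℕ) : Cmd := .mul 10 x 0 11 ;; .instr (.natAdd 10 10 y)

/-- Register `3` becomes `⌈C / ε⌉`. -/
def ceilDiv (C : ℕ) : Cmd :=
  .instr (.realConst 3 C) ;; .instr (.realConst 2 0) ;; .instr (.natConst 3 0) ;;
  .loop (.real 3 2) (.instr (.realAdd 2 2 1) ;; .instr (.natConst 1 1) ;; .instr (.natAdd 3 3 1))

/-- Register `2` becomes `n + 1`, register `4` the swap size `s`, register `5` becomes
`(n + 1) ^ s`. -/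
def setup : Cmd :=
  .instr (.natConst 1 1) ;; .instr (.natAdd 2 0 1) ;; .mul 4 3 3 11 ;; .instr (.natConst 5 1) ;;
  .forLoop 12 4 (.mul 6 5 2 11 ;; .instr (.natConst 7 0) ;; .instr (.natAdd 5 6 7))

end Cmd

theorem Does.skip {m : Mem} {Q : Mem → Prop} {T : ℕ} (hT : 1 ≤ T) (h : Q (m.setNat 1 1)) :
    Does .skip m T Q :=
  (Does.instr rfl h).time hT

/-- Repeated addition: the cost depends only on the second factor, so a huge first factor is
harmless. -/
theorem does_mul {d a b i : ℕ} (m : Mem) (h : d ≠ 1 ∧ d ≠ i ∧ i ≠ 1 ∧ a ≠ d ∧ a ≠ 1 ∧ a ≠ i ∧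
    b ≠ d ∧ b ≠ 1 ∧ b ≠ i) :
    Does (.mul d a b i) m (5 * m.natReg b + 3) fun m' =>
      m'.natReg d = m.natReg a * m.natReg b := by
  obtain ⟨h1, h2, h3, h4, h5, h6, h7, h8, h9⟩ := h
  refine ((Does.instr_seq rfl (Does.forLoop (n := m.natReg b) (T := 1)
    (fun j m' => m'.natReg d = j * m.natReg a) (by simp [h7]) ?_ (by simp [h2]) ?_))).mono
    (by omega) fun m' _ h => by rw [h, mul_comm]
  · simp [Cmd.writes, Instr.writes, h2.symm, h3, h7, h8, h9]
  · intro j hj m' hf _ hinv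
    refine Does.instr rfl ?_
    have ha : m'.natReg a = m.natReg a := by
      rw [hf.natReg a (by simp [Cmd.forLoop, Cmd.writes, Instr.writes, h4, h5, h6])]
      simp [h4]
    simp [h1, h2, hinv, ha, add_mul]

theorem does_entry {x y : ℕ} (m : Mem) (h : x ≠ 10 ∧ x ≠ 1 ∧ x ≠ 11 ∧ y ≠ 10 ∧ y ≠ 1 ∧ y ≠ 11) :
    Does (.entry x y) m (5 * m.natReg 0 + 4) fun m' =>
      m'.natReg 10 = m.natReg x * m.natReg 0 + m.natReg y := by
  obtain ⟨h1, h2, h3, h4, h5, h6⟩ := h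
  refine (Does.seq (does_mul (d := 10) (a := x) (b := 0) (i := 11) m (by simp [h1, h2, h3]))
    fun m' hf hm' => Does.instr rfl ?_).time (by omega)
  have hy : m'.natReg y = m.natReg y := hf.natReg y (by
    simp [Cmd.mul, Cmd.forLoop, Cmd.writes, Instr.writes, h4, h5, h6])
  simp [hm', hy]

/-- Without division, `ε` is added up until the sum reaches `C`; `⌈C / ε⌉` is the least number of
summands for which it does. -/
theorem does_ceilDiv (C : ℕ) (m : Mem) {ε : ℝ} (hε : 0 < ε) (hm : m.realReg 1 = ε) :
    Does (.ceilDiv C) m (5 * ⌈(C : ℝ) / ε⌉₊ + 4) fun m' => m'.natReg 3 = ⌈(C : ℝ) / ε⌉₊ := by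
  refine (Does.instr_seq rfl (Does.instr_seq rfl (Does.instr_seq rfl ((Does.loop
    (N := ⌈(C : ℝ) / ε⌉₊) (T := 3) (fun j m' => m'.realReg 2 = j * ε ∧ m'.natReg 3 = j)
    ?_ ?_ ?_).mono le_rfl fun _ _ h => h.2)))).time (by omega)
  · simp
  · rintro j hj m' hf ⟨h1, h2⟩
    have h3 : m'.realReg 3 = C := by
      rw [hf.realReg 3 (by decide)]
      simp
    have h4 : m'.realReg 1 = ε := by
      rw [hf.realReg 1 (by decide)]
      simp [hm]
    constructor
    · simp only [Test.Holds, h1, h3, not_le]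
      rw [Nat.lt_ceil, lt_div_iff₀ hε] at hj
      exact hj
    · refine Does.instr_seq rfl (Does.instr_seq rfl (Does.instr rfl ?_))
      simp [h1, h2, h4, add_mul]
  · rintro m' hf ⟨h1, h2⟩
    have h3 : m'.realReg 3 = C := by
      rw [hf.realReg 3 (by decide)]
      simp
    simp only [Test.Holds, h1, h3]
    exact (div_le_iff₀ hε).1 (Nat.le_ceil _)

/-- Each of the `k * k` multiplications by `n + 1` costs `O(n)` steps however large the power has
become. -/
theorem does_setup (m : Mem) {n k B : ℕ} (hn : m.natReg 0 = n) (hk : m.natReg 3 = k)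
    (hnB : n + 1 ≤ B) (hkB : k * k ≤ B) :
    Does .setup m (30 * B ^ 2) fun m' =>
      m'.natReg 2 = n + 1 ∧ m'.natReg 4 = k * k ∧ m'.natReg 5 = (n + 1) ^ (k * k) := by
  refine (Does.instr_seq rfl (Does.instr_seq rfl (Does.seq (does_mul _ (by decide))
    fun m₁ hf₁ h₁ => Does.instr_seq rfl ((Does.forLoop (n := k * k) (T := 5 * (n + 1) + 5)
      (fun j m' => m'.natReg 5 = (n + 1) ^ j) ?_ (by decide) ?_ ?_).mono le_rfl
      fun m₂ hf₂ h₂ => ⟨?_, ?_, h₂⟩)))).time ?_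
  · simpa [hk] using h₁
  · simp
  · intro j hj m' hf _ hinv
    have h2 : m'.natReg 2 = n + 1 := by
      rw [hf.natReg 2 (by decide)]
      simp only [Mem.setNat_natReg]
      rw [if_neg (by decide), hf₁.natReg 2 (by decide)]
      simp [hn]
    refine (Does.seq (does_mul _ (by decide)) fun m₂ _ hm₂ =>
      Does.instr_seq rfl (Does.instr rfl ?_)).time (by rw [h2])
    simp [hm₂, hinv, h2, pow_succ]
  · simp only [Mem.setNat_natReg]
    rw [if_neg (by decide), if_neg (by decide), hk]
    have h1 : k ≤ B := (Nat.le_mul_self k).trans hkB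
    have h2 : k * k * (5 * (n + 1) + 5 + 4) ≤ B * (14 * B) := Nat.mul_le_mul hkB (by omega)
    have h3 : B ≤ B * B := Nat.le_mul_self B
    rw [pow_two]
    have h4 : B * (14 * B) = 14 * (B * B) := by ring
    omega
  · rw [hf₂.natReg 2 (by decide)]
    simp only [Mem.setNat_natReg]
    rw [if_neg (by decide), hf₁.natReg 2 (by decide)]
    simp [hn]
  · rw [hf₂.natReg 4 (by decide)]
    simpa [hk] using h₁

end RealRAM

/-! ### Deciding which distances are at most `ρ`. -/

namespace RealRAM

/-- Keeps loop costs in the form constant times power of `B`: nesting raises the exponent by one and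
the constant by six. -/
theorem time_forLoop {n B T c k : ℕ} (hn : n ≤ B) (hB : 1 ≤ B) (hT : T ≤ c * B ^ k) :
    n * (T + 4) + 2 ≤ (c + 6) * B ^ (k + 1) := by
  have h1 : 1 ≤ B ^ k := Nat.one_le_pow _ _ hB
  have h2 : 1 ≤ B ^ (k + 1) := Nat.one_le_pow _ _ hB
  have h3 : n * (T + 4) ≤ B * ((c + 4) * B ^ k) := Nat.mul_le_mul hn (by rw [add_mul]; omega)
  have h4 : B * ((c + 4) * B ^ k) = (c + 4) * B ^ (k + 1) := by ring
  have h5 : (c + 6) * B ^ (k + 1) = (c + 4) * B ^ (k + 1) + 2 * B ^ (k + 1) := by ring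
  omega

theorem mul_add_inj {n i j i' j' : ℕ} (hj : j < n) (hj' : j' < n) :
    i * n + j = i' * n + j' ↔ i = i' ∧ j = j' := by
  constructor
  · intro h
    have h1 : i = i' := by
      have := congrArg (· / n) h
      simpa [Nat.mul_comm _ n, Nat.mul_add_div (by omega : n > 0), Nat.div_eq_of_lt hj,
        Nat.div_eq_of_lt hj'] using this
    subst h1
    exact ⟨rfl, by omega⟩
  · rintro ⟨rfl, rfl⟩
    rfl

section Distances

variable {n : ℕ} (G : SimpleGraph (Fin n)) (w : Sym2 (Fin n) → ℝ≥0) (ρ : ℝ)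

open Classical in
/-- The memory holds the input. -/
structure HasInput (m : Mem) : Prop where
  size : m.natReg 0 = n
  adj : ∀ i j : Fin n, m.natArr 0 (i * n + j) = if G.Adj i j then 1 else 0
  weight : ∀ i j : Fin n, G.Adj i j → m.realArr 0 (i * n + j) = w s(i, j)
  radius : m.realReg 0 = ρ

variable {G w ρ} in
theorem HasInput.frame {m m' : Mem} (h : HasInput G w ρ m) {c : Cmd} (hf : Frame c m m')
    (hc : Loc.natReg 0 ∉ c.writes ∧ Loc.natArr 0 ∉ c.writes ∧ Loc.realArr 0 ∉ c.writes ∧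
      Loc.realReg 0 ∉ c.writes) : HasInput G w ρ m' := by
  obtain ⟨h1, h2, h3, h4⟩ := hc
  refine ⟨?_, ?_, ?_, ?_⟩
  · rw [hf.natReg 0 h1, h.size]
  · rw [hf.natArr 0 h2]; exact h.adj
  · rw [hf.realArr 0 h3]; exact h.weight
  · rw [hf.realReg 0 h4, h.radius]

/-- The matrix stored in real array `1`. -/
def distMat (n : ℕ) (m : Mem) (i j : Fin n) : ℝ := m.realArr 1 (i * n + j)

theorem distMat_store (m m' : Mem) (i j : Fin n) (x : ℝ)
    (h : m'.realArr 1 = Function.update (m.realArr 1) (i * n + j) x) :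
    distMat n m' = fun i' j' => if i' = i ∧ j' = j then x else distMat n m i' j' := by
  funext i' j'
  simp only [distMat, h, Function.update_apply, mul_add_inj j'.2 j.2, Fin.ext_iff]

/-- Entries up to `ρ` are upper bounds for the distance. -/
def Sound (D : Fin n → Fin n → ℝ) : Prop :=
  ∀ i j, 0 ≤ D i j ∧ (D i j ≤ ρ → weightedDist G w i j ≤ ENNReal.ofReal (D i j))

open Classical in
/-- The matrix after using the edge `i k` to improve the entry at `i, j`. -/
noncomputable def relaxed (D : Fin n → Fin n → ℝ) (i j k : Fin n) : Fin n → Fin n → ℝ :=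
  fun i' j' => if (i' = i ∧ j' = j) ∧ G.Adj i k then min (D i j) (w s(i, k) + D k j) else D i' j'

theorem relaxed_le (D : Fin n → Fin n → ℝ) (i j k i' j' : Fin n) :
    relaxed G w D i j k i' j' ≤ D i' j' := by
  rw [relaxed]
  split_ifs with h
  · obtain ⟨⟨rfl, rfl⟩, -⟩ := h
    exact min_le_left _ _
  · exact le_rfl

theorem relaxed_self_le (D : Fin n → Fin n → ℝ) {i j k : Fin n} (h : G.Adj i k) :
    relaxed G w D i j k i j ≤ w s(i, k) + D k j := by
  rw [relaxed, if_pos ⟨⟨rfl, rfl⟩, h⟩]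
  exact min_le_right _ _

variable {G w ρ}

/-- If `w s(i, k) + D k j ≤ ρ`, then `D k j ≤ ρ` because weights are nonnegative. So a meaningless
entry above `ρ` never produces an entry up to `ρ`. -/
theorem Sound.relaxed {D : Fin n → Fin n → ℝ} (hD : Sound G w ρ D) (i j k : Fin n) :
    Sound G w ρ (relaxed G w D i j k) := by
  intro i' j'
  rw [RealRAM.relaxed]
  split_ifs with h
  · obtain ⟨⟨rfl, rfl⟩, hadj⟩ := h
    have hkj := hD k j'
    have hw : (0 : ℝ) ≤ w s(i', k) := NNReal.coe_nonneg _
    refine ⟨le_min (hD i' j').1 (add_nonneg hw hkj.1), fun hle => ?_⟩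
    rcases min_cases (D i' j') (w s(i', k) + D k j') with ⟨h1, -⟩ | ⟨h1, -⟩
    · rw [h1] at hle ⊢
      exact (hD i' j').2 hle
    · rw [h1] at hle ⊢
      have h2 := weightedDist_le_add (w := w) hadj.toWalk j'
      rw [ENNReal.ofReal_add hw hkj.1, ENNReal.ofReal_coe_nnreal]
      refine h2.trans (add_le_add ?_ (hkj.2 (by linarith)))
      simp [SimpleGraph.Adj.toWalk]
  · exact hD i' j'

end Distances

namespace Cmd

/-- Real array `1` becomes the matrix with diagonal entries `0` and other entries `ρ + 1`. -/
def distInit : Cmd :=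
  .instr (.realConst 4 1) ;; .instr (.realAdd 4 4 0) ;; .instr (.realConst 5 0) ;;
  .forLoop 20 0
    (.forLoop 21 0 (.entry 20 21 ;; .instr (.realStore 1 10 4)) ;;
      .entry 20 20 ;; .instr (.realStore 1 10 5))

/-- Improve the entry for the vertices in registers `20` and `21` by the edge from `20` to `22`. -/
def relax : Cmd :=
  .entry 20 22 ;; .instr (.natLoad 7 0 10) ;; .instr (.natConst 1 1) ;;
  .ite (.nat 1 7)
    (.instr (.realLoad 6 0 10) ;; .entry 22 21 ;; .instr (.realLoad 7 1 10) ;;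
      .instr (.realAdd 6 6 7) ;; .entry 20 21 ;; .instr (.realLoad 7 1 10) ;;
      .ite (.real 7 6) .skip (.instr (.realStore 1 10 6)))
    .skip

def relaxAll : Cmd := .forLoop 20 0 (.forLoop 21 0 (.forLoop 22 0 .relax))

/-- Compute in real array `1` which distances are at most `ρ`. -/
def distances : Cmd := .distInit ;; .forLoop 23 0 .relaxAll

end Cmd

section Distances

variable {n : ℕ} {G : SimpleGraph (Fin n)} {w : Sym2 (Fin n) → ℝ≥0} {ρ : ℝ} {B : ℕ}

/-- The value `ρ + 1` stands for infinity: all that matters is that it exceeds `ρ`. -/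
theorem does_distInit {m : Mem} (hm : HasInput G w ρ m) (hnB : n ≤ B) (hB : 1 ≤ B) :
    Does .distInit m (40 * B ^ 3) fun m' =>
      ∀ i j, distMat n m' i j = if i = j then 0 else ρ + 1 := by
  refine (Does.instr_seq rfl (Does.instr_seq rfl (Does.instr_seq rfl ((Does.forLoop (n := n)
    (T := 26 * B ^ 2)
    (fun l m' => ∀ i j : Fin n, (i : ℕ) < l → distMat n m' i j = if i = j then 0 else ρ + 1)
    ?_ (by decide) ?_ ?_).mono le_rfl fun _ _ h i j => h i j i.2)))).time ?_
  · simpa using hm.size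
  · simp
  · rintro l hl m₁ hf₁ hl₁ hinv
    have hn₁ : m₁.natReg 0 = n := by
      rw [hf₁.natReg 0 (by decide)]; simpa using hm.size
    have h4 : m₁.realReg 4 = ρ + 1 := by
      rw [hf₁.realReg 4 (by decide)]
      simp [hm.radius, add_comm]
    have h5 : m₁.realReg 5 = 0 := by
      rw [hf₁.realReg 5 (by decide)]
      simp
    refine (Does.seq (Does.forLoop (n := n) (T := 10 * B ^ 1)
      (fun l' m' => (∀ i j : Fin n, (i : ℕ) < l → distMat n m' i j = if i = j then 0 else ρ + 1) ∧
        ∀ j : Fin n, (j : ℕ) < l' → distMat n m' ⟨l, hl⟩ j = ρ + 1)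
      hn₁ (by decide) ⟨hinv, by simp⟩ ?_) (T' := 5 * n + 5) ?_).time ?_
    · rintro l' hl' m₂ hf₂ hl₂ ⟨hinv₁, hinv₂⟩
      refine (Does.seq (does_entry m₂ (by decide)) (T' := 1) fun m₃ hf₃ h₃ =>
        Does.instr rfl ?_).time (by rw [hf₂.natReg 0 (by decide), hn₁, pow_one]; omega)
      have hst := distMat_store m₃ (m₃.storeReal 1 (m₃.natReg 10) (m₃.realReg 4))
        ⟨l, hl⟩ ⟨l', hl'⟩ (ρ + 1) (by
          have h6 : m₃.realReg 4 = ρ + 1 := by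
            rw [hf₃.realReg 4 (by decide), hf₂.realReg 4 (by decide), h4]
          rw [h₃, hl₂, hf₂.natReg 20 (by decide), hl₁, hf₂.natReg 0 (by decide), hn₁, h6]
          simp)
      have hsame : distMat n m₃ = distMat n m₂ := by
        funext i j
        rw [distMat, hf₃.realArr 1 (by decide), distMat]
      change (∀ i j : Fin n, _ → distMat n (m₃.storeReal 1 (m₃.natReg 10) (m₃.realReg 4)) i j = _) ∧
        ∀ j : Fin n, _ → distMat n (m₃.storeReal 1 (m₃.natReg 10) (m₃.realReg 4)) ⟨l, hl⟩ j = _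
      rw [hst, hsame]
      constructor
      · intro i j hi
        beta_reduce
        rw [if_neg (by rw [Fin.ext_iff]; dsimp only; omega)]
        exact hinv₁ i j hi
      · intro j hj
        by_cases hjl : j = ⟨l', hl'⟩
        · simp [hjl]
        · beta_reduce
          rw [if_neg (by simp [hjl])]
          refine hinv₂ j ?_
          rw [Fin.ext_iff] at hjl
          dsimp only at hjl
          omega
    · rintro m₂ hf₂ ⟨hinv₁, hinv₂⟩
      have hn₂ : m₂.natReg 0 = n := by rw [hf₂.natReg 0 (by decide), hn₁]
      refine (Does.seq (does_entry m₂ (by decide)) (T' := 1) fun m₃ hf₃ h₃ =>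
        Does.instr rfl ?_).time (by rw [hn₂])
      have hst := distMat_store m₃ (m₃.storeReal 1 (m₃.natReg 10) (m₃.realReg 5))
        ⟨l, hl⟩ ⟨l, hl⟩ 0 (by
          have h6 : m₃.realReg 5 = 0 := by
            rw [hf₃.realReg 5 (by decide), hf₂.realReg 5 (by decide), h5]
          rw [h₃, hf₂.natReg 20 (by decide), hl₁, hn₂, h6]
          simp)
      have hsame : distMat n m₃ = distMat n m₂ := by
        funext i j
        rw [distMat, hf₃.realArr 1 (by decide), distMat]
      change ∀ i j : Fin n, _ → distMat n (m₃.storeReal 1 (m₃.natReg 10) (m₃.realReg 5)) i j = _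
      rw [hst, hsame]
      intro i j hi
      by_cases hil : i = ⟨l, hl⟩
      · subst hil
        by_cases hjl : j = ⟨l, hl⟩
        · simp [hjl]
        · beta_reduce
          rw [if_neg (by simp [hjl]), hinv₂ j j.2, if_neg (Ne.symm hjl)]
      · beta_reduce
        rw [if_neg (by simp [hil])]
        refine hinv₁ i j ?_
        rw [Fin.ext_iff] at hil
        dsimp only at hil
        omega
    · have h6 : n * (10 * B ^ 1 + 4) + 2 ≤ 16 * B ^ 2 := time_forLoop hnB hB le_rfl
      have h7 : B ≤ B ^ 2 := Nat.le_self_pow two_ne_zero B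
      omega
  · have h6 : n * (26 * B ^ 2 + 4) + 2 ≤ 32 * B ^ 3 := time_forLoop hnB hB le_rfl
    have h7 : 1 ≤ B ^ 3 := Nat.one_le_pow _ _ hB
    omega

/-- The adjacency bit is tested first because `HasInput` describes the weight matrix only on edges.
-/
theorem does_relax {m : Mem} (hm : HasInput G w ρ m) {i j k : Fin n} (hi : m.natReg 20 = i)
    (hj : m.natReg 21 = j) (hk : m.natReg 22 = k) :
    Does .relax m (15 * n + 30) fun m' =>
      distMat n m' = relaxed G w (distMat n m) i j k := by
  classical
  refine (Does.seq (does_entry m (by decide)) fun m₁ hf₁ h₁ => Does.instr_seq rfl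
    (Does.instr_seq rfl (Does.ite (T := 10 * n + 20) (fun hb => ?_)
      (fun hb => Does.skip (by omega) ?_)))).time (by rw [hm.size]; omega)
  all_goals
    rw [hi, hk, hm.size] at h₁
    simp only [Test.Holds, Mem.setNat_natReg, h₁, hf₁.natArr 0 (by decide), hm.adj] at hb
  · have hadj : G.Adj i k := by
      by_contra hcon
      simp [hcon] at hb
    have e21 : m₁.natReg 21 = j := by rw [hf₁.natReg 21 (by decide), hj]
    have e22 : m₁.natReg 22 = k := by rw [hf₁.natReg 22 (by decide), hk]
    have e0 : m₁.natReg 0 = n := by rw [hf₁.natReg 0 (by decide), hm.size]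
    refine (Does.instr_seq rfl (Does.seq (does_entry _ (by decide)) (T' := 5 * n + 10)
      fun m₂ hf₂ h₂ => ?_)).time (by simp [e0]; omega)
    have e20 : m₂.natReg 20 = i := by
      rw [hf₂.natReg 20 (by decide)]; simp [hf₁.natReg 20 (by decide), hi]
    have g21 : m₂.natReg 21 = j := by
      rw [hf₂.natReg 21 (by decide)]; simp [e21]
    have g0 : m₂.natReg 0 = n := by
      rw [hf₂.natReg 0 (by decide)]; simp [e0]
    have a2 : m₂.realArr 1 = m.realArr 1 := by
      rw [hf₂.realArr 1 (by decide)]; simp [hf₁.realArr 1 (by decide)]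
    have r6 : m₂.realReg 6 = w s(i, k) := by
      rw [hf₂.realReg 6 (by decide)]
      simp [h₁, hf₁.realArr 0 (by decide), hm.weight i k hadj]
    have p2 : m₂.natReg 10 = k * n + j := by simpa [e22, e21, e0] using h₂
    refine (Does.instr_seq rfl (Does.instr_seq (i := .realAdd 6 6 7) rfl
      (Does.seq (does_entry _ (by decide)) (T' := 4) fun m₃ hf₃ h₃ => ?_))).time
      (by simp [g0]; omega)
    have a3 : m₃.realArr 1 = m.realArr 1 := by
      rw [hf₃.realArr 1 (by decide)]; simp [a2]
    have p3 : m₃.natReg 10 = i * n + j := by simpa [e20, g21, g0] using h₃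
    have s6 : m₃.realReg 6 = w s(i, k) + distMat n m k j := by
      rw [hf₃.realReg 6 (by decide)]
      simp [r6, p2, a2, distMat]
    refine Does.instr_seq rfl (Does.ite (T := 1) (fun hb' => Does.skip le_rfl ?_)
      (fun hb' => Does.instr rfl ?_))
    all_goals
      simp only [Test.Holds, Mem.setReal_realReg, p3, a3] at hb'
      rw [if_pos trivial, if_neg (by decide), s6] at hb'
    · funext i' j'
      have : distMat n ((m₃.setReal 7 (m₃.realArr 1 (m₃.natReg 10))).setNat 1 1) i' j' =
          distMat n m i' j' := by simp [distMat, a3]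
      rw [this, relaxed]
      split_ifs with h
      · obtain ⟨⟨rfl, rfl⟩, -⟩ := h
        exact (min_eq_left hb').symm
      · rfl
    · rw [distMat_store m _ i j (w s(i, k) + distMat n m k j) (by simp [p3, a3, s6])]
      funext i' j'
      rw [relaxed]
      simp only [hadj, and_true]
      split_ifs with h
      · exact (min_eq_right (not_le.1 hb').le).symm
      · rfl
  · have hadj : ¬ G.Adj i k := by
      intro hcon
      simp [hcon] at hb
    funext i' j'
    rw [relaxed, if_neg (fun h => hadj h.2)]
    simp [distMat, hf₁.realArr 1 (by decide)]

/-- One Bellman–Ford round, done in place. The conclusion compares with the matrix at the start of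
the round, which is legitimate because entries only decrease. -/
theorem does_relaxAll {m : Mem} (hm : HasInput G w ρ m) (hnB : n ≤ B) (hB : 1 ≤ B)
    (hD : Sound G w ρ (distMat n m)) :
    Does .relaxAll m (63 * B ^ 4) fun m' => Sound G w ρ (distMat n m') ∧
      (∀ i j, distMat n m' i j ≤ distMat n m i j) ∧
      ∀ i j k, G.Adj i k → distMat n m' i j ≤ w s(i, k) + distMat n m k j := by
  set D₀ := distMat n m with hD₀
  let Good : (Fin n → Fin n → ℝ) → Prop := fun D => Sound G w ρ D ∧ ∀ i j, D i j ≤ D₀ i j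
  let Rel : (Fin n → Fin n → ℝ) → Fin n → Fin n → Fin n → Prop := fun D i j k =>
    G.Adj i k → D i j ≤ w s(i, k) + D₀ k j
  refine (Does.forLoop (n := n) (T := 57 * B ^ 3)
    (fun i m' => Good (distMat n m') ∧
      ∀ i' j' k' : Fin n, (i' : ℕ) < i → Rel (distMat n m') i' j' k')
    hm.size (by decide) ⟨⟨hD, fun i j => le_rfl⟩, by simp⟩ ?_).mono
    (time_forLoop hnB hB le_rfl) fun m' _ h => ⟨h.1.1, h.1.2, fun i j k => h.2 i j k i.2⟩
  rintro i hi m₁ hf₁ hi₁ ⟨hg₁, hr₁⟩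
  have hm₁ := hm.frame hf₁ (by decide)
  refine (Does.forLoop (n := n) (T := 51 * B ^ 2)
    (fun j m' => Good (distMat n m') ∧
      ∀ i' j' k' : Fin n, ((i' : ℕ) < i ∨ (i' : ℕ) = i ∧ (j' : ℕ) < j) →
        Rel (distMat n m') i' j' k')
    hm₁.size (by decide) ⟨hg₁, fun i' j' k' h => hr₁ i' j' k' (by simpa using h)⟩ ?_).mono
    (time_forLoop hnB hB le_rfl) fun m' _ h => ⟨h.1, fun i' j' k' hlt => h.2 i' j' k' (by omega)⟩
  rintro j hj m₂ hf₂ hj₂ ⟨hg₂, hr₂⟩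
  have hm₂ := hm₁.frame hf₂ (by decide)
  refine (Does.forLoop (n := n) (T := 45 * B ^ 1)
    (fun k m' => Good (distMat n m') ∧
      ∀ i' j' k' : Fin n, ((i' : ℕ) < i ∨ (i' : ℕ) = i ∧ ((j' : ℕ) < j ∨ (j' : ℕ) = j ∧
        (k' : ℕ) < k)) → Rel (distMat n m') i' j' k')
    hm₂.size (by decide) ⟨hg₂, fun i' j' k' h => hr₂ i' j' k' (by simpa using h)⟩ ?_).mono
    (time_forLoop hnB hB le_rfl) fun m' _ h => ⟨h.1, fun i' j' k' hlt => h.2 i' j' k' (by omega)⟩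
  rintro k hk m₃ hf₃ hk₃ ⟨hg₃, hr₃⟩
  have hm₃ := hm₂.frame hf₃ (by decide)
  refine (does_relax hm₃ (i := ⟨i, hi⟩) (j := ⟨j, hj⟩) (k := ⟨k, hk⟩) ?_ ?_ hk₃).mono
    (by rw [pow_one]; omega) fun m' _ h => ?_
  · rw [hf₃.natReg 20 (by decide), hf₂.natReg 20 (by decide), hi₁]
  · rw [hf₃.natReg 21 (by decide), hj₂]
  change Good (distMat n m') ∧ ∀ i' j' k' : Fin n, _ → Rel (distMat n m') i' j' k'
  rw [h]
  refine ⟨⟨hg₃.1.relaxed _ _ _, fun i' j' => (relaxed_le _ _ _ _ _ _ _ _).trans (hg₃.2 i' j')⟩, ?_⟩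
  intro i' j' k' hlt hadj
  by_cases hnew : (i' : ℕ) = i ∧ (j' : ℕ) = j ∧ (k' : ℕ) = k
  · obtain ⟨h1, h2, h3⟩ := hnew
    have h1' : i' = ⟨i, hi⟩ := Fin.ext h1
    have h2' : j' = ⟨j, hj⟩ := Fin.ext h2
    have h3' : k' = ⟨k, hk⟩ := Fin.ext h3
    subst h1' h2' h3'
    exact (relaxed_self_le G w _ hadj).trans (add_le_add le_rfl (hg₃.2 _ _))
  · exact (relaxed_le _ _ _ _ _ _ _ _).trans (hr₃ i' j' k' (by omega) hadj)

/-- The matrix tells which distances are at most `ρ`. -/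
def DistOK (G : SimpleGraph (Fin n)) (w : Sym2 (Fin n) → ℝ≥0) (ρ : ℝ) (m : Mem) : Prop :=
  ∀ i j : Fin n, distMat n m i j ≤ ρ ↔ weightedDist G w i j ≤ ENNReal.ofReal ρ

/-- After `r` rounds every entry is at most the weight of each walk with at most `r` edges. Since
shortest paths have fewer than `n` edges, `n` rounds suffice; `Sound` gives the converse. -/
theorem does_distances {m : Mem} (hm : HasInput G w ρ m) (hρ : 0 < ρ) (hnB : n ≤ B)
    (hB : 1 ≤ B) : Does .distances m (109 * B ^ 5) (DistOK G w ρ) := by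
  refine (Does.seq (does_distInit hm hnB hB) (T' := 69 * B ^ 5) fun m₁ hf₁ h₁ => ?_).time ?_
  · have hm₁ := hm.frame hf₁ (by decide)
    refine (Does.forLoop (n := n) (T := 63 * B ^ 4)
      (fun r m' => Sound G w ρ (distMat n m') ∧
        ∀ (i j : Fin n) (p : G.Walk i j), p.length ≤ r → distMat n m' i j ≤ walkWeight w p)
      hm₁.size (by decide) ⟨fun i j => ?_, fun i j p hp => ?_⟩ ?_).mono
      (time_forLoop hnB hB le_rfl) ?_
    · change 0 ≤ distMat n m₁ i j ∧ (distMat n m₁ i j ≤ ρ → _ ≤ ENNReal.ofReal (distMat n m₁ i j))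
      rw [h₁]
      split_ifs with hij
      · subst hij
        simp [weightedDist_self]
      · exact ⟨by linarith, fun h => absurd h (by linarith)⟩
    · change distMat n m₁ i j ≤ _
      have := SimpleGraph.Walk.eq_of_length_eq_zero (Nat.le_zero.1 hp)
      rw [h₁, if_pos this]
      exact NNReal.coe_nonneg _
    · rintro r hr m₂ hf₂ - ⟨hs, hw⟩
      refine (does_relaxAll (hm₁.frame hf₂ (by decide)) hnB hB hs).mono le_rfl
        fun m₃ _ h₃ => ?_
      obtain ⟨h4, h5, h6⟩ := h₃
      refine ⟨h4, fun i j p hp => ?_⟩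
      change distMat n m₃ i j ≤ _
      cases p with
      | nil => exact (h5 i i).trans (hw i i .nil (by simp))
      | @cons _ k _ hadj q =>
        refine (h6 i j k hadj).trans ?_
        rw [walkWeight_cons, NNReal.coe_add]
        exact add_le_add le_rfl (hw k j q (by simpa using hp))
    · rintro m₂ - ⟨hs, hw⟩ i j
      refine ⟨fun h => ((hs i j).2 h).trans (ENNReal.ofReal_le_ofReal h), fun h => ?_⟩
      obtain ⟨p, hp, hpw⟩ := exists_walkWeight_eq (h.trans_lt ENNReal.ofReal_lt_top).ne
      rw [← hpw, ENNReal.ofReal, ENNReal.coe_le_coe] at h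
      refine (hw i j p (by simpa using hp.length_lt.le)).trans ?_
      exact (Real.le_toNNReal_iff_coe_le hρ.le).1 h
  · have : B ^ 3 ≤ B ^ 5 := Nat.pow_le_pow_right hB (by omega)
    omega

end Distances

end RealRAM

/-! ### Numbering the swaps. -/

section Toggle

variable {n : ℕ}

/-- Remove or add the vertex number `r`, if there is one. -/
def flipAt (r : ℕ) (S : Finset (Fin n)) : Finset (Fin n) :=
  if h : r < n then symmDiff S {⟨r, h⟩} else S

/-- Flip the membership of the first `e` digits of `q` in base `n + 1`. -/
def flipDigits : ℕ → ℕ → Finset (Fin n) → Finset (Fin n)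
  | 0, _, S => S
  | e + 1, q, S => flipDigits e (q / (n + 1)) (flipAt (q % (n + 1)) S)

theorem card_symmDiff_trans (S T U : Finset (Fin n)) :
    (symmDiff S U).card ≤ (symmDiff S T).card + (symmDiff T U).card :=
  (Finset.card_le_card (symmDiff_triangle S T U)).trans (Finset.card_union_le _ _)

theorem card_symmDiff_flipDigits (e q : ℕ) (S : Finset (Fin n)) :
    (symmDiff S (flipDigits e q S)).card ≤ e := by
  induction e generalizing q S with
  | zero => simp [flipDigits]
  | succ e ih =>
    have h1 := card_symmDiff_trans S (flipAt (q % (n + 1)) S) (flipDigits (e + 1) q S)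
    have h2 := ih (q / (n + 1)) (flipAt (q % (n + 1)) S)
    have h3 : (symmDiff S (flipAt (q % (n + 1)) S)).card ≤ 1 := by
      rw [flipAt]
      split_ifs with h
      · simp
      · simp
    rw [flipDigits] at h1 ⊢
    omega

/-- Each digit below `n` flips one element of the symmetric difference. The digit `n` flips nothing
and pads the number when fewer than `e` flips are needed. -/
theorem exists_flipDigits (e : ℕ) (S S' : Finset (Fin n)) (h : (symmDiff S S').card ≤ e) :
    ∃ q < (n + 1) ^ e, flipDigits e q S = S' := by
  induction e generalizing S with
  | zero =>
    refine ⟨0, by simp, ?_⟩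
    simpa [flipDigits] using h
  | succ e ih =>
    obtain ⟨r, hr, hrS⟩ : ∃ r < n + 1, (symmDiff (flipAt r S) S').card ≤ e := by
      rcases Finset.eq_empty_or_nonempty (symmDiff S S') with h0 | ⟨v, hv⟩
      · refine ⟨n, by omega, ?_⟩
        rw [flipAt, dif_neg (by omega), h0]
        simp
      · refine ⟨v, by omega, ?_⟩
        rw [flipAt, dif_pos v.2, symmDiff_right_comm]
        have h1 : symmDiff (symmDiff S S') {v} = (symmDiff S S').erase v := by
          ext x
          by_cases hx : x = v
          · subst hx; simp [Finset.mem_symmDiff, hv]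
          · simp [Finset.mem_symmDiff, hx]
        rw [show (⟨(v : ℕ), v.2⟩ : Fin n) = v from rfl, h1, Finset.card_erase_of_mem hv]
        omega
    obtain ⟨q, hq, hqS⟩ := ih (flipAt r S) hrS
    refine ⟨r + (n + 1) * q, ?_, ?_⟩
    · calc r + (n + 1) * q < (n + 1) * (q + 1) := by rw [mul_add]; omega
        _ ≤ (n + 1) * (n + 1) ^ e := Nat.mul_le_mul_left _ hq
        _ = (n + 1) ^ (e + 1) := by ring
    · rw [flipDigits, Nat.add_mul_mod_self_left, Nat.mod_eq_of_lt hr,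
        Nat.add_mul_div_left _ _ (by omega), Nat.div_eq_of_lt hr, zero_add, hqS]

theorem card_sdiff_add_card_sdiff (S S' : Finset (Fin n)) :
    (S \ S').card + (S' \ S).card = (symmDiff S S').card := by
  rw [symmDiff_def, Finset.sup_eq_union, Finset.card_union_of_disjoint]
  exact Finset.disjoint_left.2 fun x hx hx' =>
    (Finset.mem_sdiff.1 hx').2 (Finset.mem_sdiff.1 hx).1

end Toggle

/-! ### Subroutines of the search: copying, flipping and testing domination. -/

namespace RealRAM

variable {n : ℕ}

/-- The array is the indicator vector of `S`. -/
def IsIndicator (f : ℕ → ℕ) (S : Finset (Fin n)) : Prop := ∀ v : Fin n, f v = if v ∈ S then 1 else 0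

/-- For `r ≥ n`, in particular for the padding digit, the update hits a position that the indicator
vector does not use. -/
theorem IsIndicator.flipAt {f : ℕ → ℕ} {S : Finset (Fin n)} (h : IsIndicator f S) (r : ℕ) :
    IsIndicator (Function.update f r (1 - f r)) (flipAt r S) := by
  intro v
  rw [Function.update_apply, _root_.flipAt]
  split_ifs with h1 h2 h3 h4 h5 h6
  all_goals first
    | (have := v.2; omega)
    | (subst h1
       have := h v
       by_cases hv : v ∈ S <;> simp_all [Finset.mem_symmDiff])
    | (have h7 : v ≠ ⟨r, by assumption⟩ := fun h8 => h1 (congrArg Fin.val h8)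
       have := h v
       by_cases hv : v ∈ S <;> simp_all [Finset.mem_symmDiff])
    | (have := h v
       simp_all)

theorem IsIndicator.sum {f : ℕ → ℕ} {S : Finset (Fin n)} (h : IsIndicator f S) :
    ∑ v ∈ Finset.range n, f v = S.card := by
  rw [Finset.sum_range]
  simp only [h _]
  simp

namespace Cmd

/-- Copy the first `n` entries of array `a` to array `b`. -/
def copy (a b : ℕ) : Cmd := .forLoop 25 0 (.instr (.natLoad 8 a 25) ;; .instr (.natStore b 25 8))

/-- Register `d` becomes the sum of the first `n` entries of array `a`. -/
def sum (d a : ℕ) : Cmd :=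
  .instr (.natConst d 0) ;; .forLoop 25 0 (.instr (.natLoad 8 a 25) ;; .instr (.natAdd d d 8))

/-- Divide register `26` by register `2`: quotient in register `28`, remainder in `29`. -/
def divMod : Cmd :=
  .instr (.natConst 28 0) ;; .instr (.natConst 9 0) ;; .instr (.natAdd 29 26 9) ;;
  .forLoop 30 26 (.ite (.nat 2 29)
    (.instr (.natSub 29 29 2) ;; .instr (.natConst 1 1) ;; .instr (.natAdd 28 28 1)) .skip)

/-- Flip in array `2` the entries given by the digits of register `24`. -/
def flips : Cmd :=
  .instr (.natConst 9 0) ;; .instr (.natAdd 26 24 9) ;;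
  .forLoop 27 4 (.divMod ;; .instr (.natLoad 8 2 29) ;; .instr (.natConst 9 1) ;;
    .instr (.natSub 8 9 8) ;; .instr (.natStore 2 29 8) ;; .instr (.natConst 9 0) ;;
    .instr (.natAdd 26 28 9))

/-- Register `33` tells whether the set in array `2` dominates the vertex in register `32`. -/
def checkVertex : Cmd :=
  .instr (.natConst 33 0) ;; .forLoop 34 0
    (.instr (.natLoad 8 2 34) ;; .instr (.natConst 9 1) ;;
      .ite (.nat 9 8) (.entry 32 34 ;; .instr (.realLoad 6 1 10) ;;
        .ite (.real 6 0) (.instr (.natConst 33 1)) .skip) .skip)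

/-- Register `31` tells whether the set in array `2` is dominating. -/
def check : Cmd :=
  .instr (.natConst 31 1) ;; .forLoop 32 0 (.checkVertex ;; .instr (.natConst 9 1) ;;
    .ite (.nat 9 33) .skip (.instr (.natConst 31 0)))

/-- Try the candidate number given by register `24`. -/
def candidate : Cmd :=
  .copy 1 2 ;; .flips ;; .check ;; .sum 35 1 ;; .sum 36 2 ;;
  .ite (.nat 35 36) .skip (.instr (.natConst 9 1) ;; .ite (.nat 9 31) (.copy 2 1) .skip)

def search : Cmd :=
  .instr (.natConst 9 1) ;; .forLoop 25 0 (.instr (.natStore 1 25 9)) ;;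
  .forLoop 37 2 (.forLoop 24 5 .candidate)

end Cmd

section Search

variable {G : SimpleGraph (Fin n)} {w : Sym2 (Fin n) → ℝ≥0} {ρ : ℝ} {B : ℕ}

theorem does_copy {a b : ℕ} (hab : a ≠ b) {m : Mem} (hn : m.natReg 0 = n) (hnB : n ≤ B)
    (hB : 1 ≤ B) :
    Does (.copy a b) m (8 * B) fun m' => ∀ v < n, m'.natArr b v = m.natArr a v := by
  refine (Does.forLoop (n := n) (T := 2 * B ^ 0)
    (fun j m' => ∀ v < j, m'.natArr b v = m.natArr a v)
    hn (by simp [Cmd.writes, Instr.writes]) (by simp) ?_).time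
    ((time_forLoop hnB hB le_rfl).trans (by rw [zero_add, pow_one]))
  intro j hj m₁ hf₁ hj₁ hinv
  refine Does.instr_seq rfl (T := 1) (Does.instr rfl ?_)
  have ha : m₁.natArr a = m.natArr a :=
    hf₁.natArr a (by simp [Cmd.forLoop, Cmd.writes, Instr.writes, hab])
  intro v hv
  simp only [Mem.setNat_natArr, Mem.storeNat_natArr, Mem.setNat_natReg, if_true,
    Function.update_apply]
  rw [if_neg (by decide : (25 : ℕ) ≠ 8), hj₁, ha]
  split_ifs with h
  · rw [h]
  · exact hinv v (by omega)

theorem does_sum {d a : ℕ} (hd : d ≠ 1 ∧ d ≠ 8 ∧ d ≠ 25 ∧ d ≠ 0) {m : Mem}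
    (hn : m.natReg 0 = n) (hnB : n ≤ B) (hB : 1 ≤ B) {S : Finset (Fin n)}
    (hS : IsIndicator (m.natArr a) S) :
    Does (.sum d a) m (9 * B) fun m' => m'.natReg d = S.card := by
  obtain ⟨h1, h2, h3, h4⟩ := hd
  refine (Does.instr_seq rfl ((Does.forLoop (n := n) (T := 2 * B ^ 0)
    (fun j m' => m'.natReg d = ∑ v ∈ Finset.range j, m.natArr a v)
    (by simp [h4.symm, hn]) (by simp [Cmd.writes, Instr.writes, h3.symm, h4.symm])
    (by simp [h3]) ?_).mono le_rfl fun m' _ h => h.trans hS.sum)).time ?_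
  · intro j hj m₁ hf₁ hj₁ hinv
    refine Does.instr_seq rfl (T := 1) (Does.instr rfl ?_)
    have ha : m₁.natArr a = m.natArr a := by
      rw [hf₁.natArr a (by simp [Cmd.forLoop, Cmd.writes, Instr.writes])]
      rfl
    simp [h1, h2, h3, hinv, hj₁, ha, Finset.sum_range_succ]
  · have : n * (2 * B ^ 0 + 4) + 2 ≤ 8 * B ^ 1 := time_forLoop hnB hB le_rfl
    rw [pow_one] at this
    omega

theorem does_divMod {m : Mem} {q : ℕ} (hn : 0 < n) (h2 : m.natReg 2 = n + 1)
    (hq : m.natReg 26 = q) :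
    Does .divMod m (9 * q + 5) fun m' =>
      m'.natReg 28 = q / (n + 1) ∧ m'.natReg 29 = q % (n + 1) := by
  refine (Does.instr_seq rfl (Does.instr_seq rfl (Does.instr_seq rfl ((Does.forLoop (n := q)
    -- Division by repeated subtraction, with `q` rounds allotted. Either every round so far has
    -- subtracted, or the remainder is already small; `q` subtractions of `n + 1` from a positive
    -- `q` are impossible.
    (T := 5) (fun j m' => m'.natReg 29 + (n + 1) * m'.natReg 28 = q ∧
      (j ≤ m'.natReg 28 ∨ m'.natReg 29 < n + 1))
    (by simp [hq]) (by decide) (by simp [hq]) ?_).mono le_rfl ?_)))).time (by omega)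
  · rintro j hj m₁ hf₁ - ⟨hinv₁, hinv₂⟩
    have e2 : m₁.natReg 2 = n + 1 := by
      rw [hf₁.natReg 2 (by decide)]
      simp [h2]
    refine Does.ite (T := 3) (fun hb => ?_) (fun hb => Does.skip (by omega) ?_)
    all_goals simp only [Test.Holds, e2] at hb
    · refine Does.instr_seq rfl (T := 2) (Does.instr_seq rfl (T := 1) (Does.instr rfl ?_))
      simp [e2]
      rw [mul_add]
      omega
    · simp
      omega
  · rintro m₁ - ⟨hinv₁, hinv₂⟩
    have hlt : m₁.natReg 29 < n + 1 := by
      rcases hinv₂ with h | h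
      · by_contra hcon
        have h3 : 2 * q ≤ (n + 1) * m₁.natReg 28 := Nat.mul_le_mul (by omega) h
        omega
      · exact h
    have := (Nat.div_mod_unique (by omega : 0 < n + 1)).2 ⟨hinv₁, hlt⟩
    exact ⟨this.1.symm, this.2.symm⟩

theorem does_flips {m : Mem} {q s : ℕ} (hn : 0 < n) (h2 : m.natReg 2 = n + 1)
    (hs : m.natReg 4 = s) (hq : m.natReg 24 = q) (hsB : s ≤ B) (hqB : q ≤ B) (hB : 1 ≤ B)
    {S : Finset (Fin n)} (hS : IsIndicator (m.natArr 2) S) :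
    Does .flips m (28 * B ^ 2) fun m' => IsIndicator (m'.natArr 2) (flipDigits s q S) := by
  refine (Does.instr_seq rfl (Does.instr_seq rfl ((Does.forLoop (n := s) (T := 20 * B ^ 1)
    (fun j m' => m'.natReg 26 ≤ q ∧ ∃ S', IsIndicator (m'.natArr 2) S' ∧
      flipDigits (s - j) (m'.natReg 26) S' = flipDigits s q S)
    (by simp [hs]) (by decide) ?_ ?_).mono le_rfl ?_))).time ?_
  · simp only [Mem.setNat_natReg, Mem.setNat_natArr]
    simp only [hq]
    exact ⟨by simp, S, hS, by simp⟩
  · rintro j hj m₁ hf₁ - ⟨hle, S', hS', hflip⟩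
    have e2 : m₁.natReg 2 = n + 1 := by
      rw [hf₁.natReg 2 (by decide)]
      simp [h2]
    refine (Does.seq (does_divMod hn e2 rfl) (T' := 6) ?_).time (by rw [pow_one]; omega)
    rintro m₂ hf₂ ⟨h28, h29⟩
    refine Does.instr_seq rfl (T := 5) (Does.instr_seq rfl (T := 4) (Does.instr_seq rfl (T := 3)
      (Does.instr_seq rfl (T := 2) (Does.instr_seq rfl (T := 1) (Does.instr rfl ?_)))))
    have e : m₂.natArr 2 = m₁.natArr 2 := hf₂.natArr 2 (by decide)
    obtain ⟨k, hk⟩ : ∃ k, s - j = k + 1 := ⟨s - j - 1, by omega⟩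
    rw [hk, flipDigits] at hflip
    refine ⟨?_, flipAt (m₁.natReg 26 % (n + 1)) S', ?_, ?_⟩
    · simp [h28]
      exact (Nat.div_le_self _ _).trans hle
    · have := hS'.flipAt (m₁.natReg 26 % (n + 1))
      simpa [h29, e] using this
    · have h3 : s - (j + 1) = k := by omega
      rw [h3, ← hflip]
      simp [h28]
  · rintro m₁ - ⟨-, S', hS', hflip⟩
    rw [Nat.sub_self, flipDigits] at hflip
    rwa [← hflip]
  · have h3 : s * (20 * B ^ 1 + 4) + 2 ≤ 26 * B ^ 2 := time_forLoop hsB hB le_rfl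
    have h4 : 1 ≤ B ^ 2 := Nat.one_le_pow _ _ hB
    omega

theorem does_checkVertex {m : Mem} (hm : HasInput G w ρ m) (hD : DistOK G w ρ m) (hnB : n ≤ B)
    (hB : 1 ≤ B) {S : Finset (Fin n)} (hS : IsIndicator (m.natArr 2) S) {x : Fin n}
    (hx : m.natReg 32 = x) :
    Does .checkVertex m (30 * B ^ 2) fun m' =>
      (1 ≤ m'.natReg 33 ↔ ∃ y ∈ S, weightedDist G w x y ≤ ENNReal.ofReal ρ) := by
  refine (Does.instr_seq rfl ((Does.forLoop (n := n) (T := 17 * B ^ 1)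
    (fun j m' => 1 ≤ m'.natReg 33 ↔
      ∃ y : Fin n, (y : ℕ) < j ∧ y ∈ S ∧ weightedDist G w x y ≤ ENNReal.ofReal ρ)
    (by simpa using hm.size) (by decide) (by simp) ?_).mono le_rfl ?_)).time ?_
  · intro j hj m₁ hf₁ hj₁ hinv
    have hm₁ : HasInput G w ρ m₁ :=
      (hm.frame (c := .checkVertex) (m' := m.setNat 33 0) ?_ (by decide)).frame hf₁ (by decide)
    swap
    · intro l hl
      exact ((Cmd.Big.instr rfl : (Cmd.instr (.natConst 33 0)).Big m 1 _).frame) l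
        fun h => hl (List.mem_append_left _ h)
    have e32 : m₁.natReg 32 = x := by rw [hf₁.natReg 32 (by decide)]; simp [hx]
    have eS : m₁.natArr 2 = m.natArr 2 := by rw [hf₁.natArr 2 (by decide)]; rfl
    have eD : m₁.realArr 1 = m.realArr 1 := by rw [hf₁.realArr 1 (by decide)]; rfl
    have hstep : (∃ y : Fin n, (y : ℕ) < j + 1 ∧ y ∈ S ∧
        weightedDist G w x y ≤ ENNReal.ofReal ρ) ↔
        ((⟨j, hj⟩ : Fin n) ∈ S ∧ weightedDist G w x ⟨j, hj⟩ ≤ ENNReal.ofReal ρ) ∨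
          ∃ y : Fin n, (y : ℕ) < j ∧ y ∈ S ∧ weightedDist G w x y ≤ ENNReal.ofReal ρ := by
      constructor
      · rintro ⟨y, h1, h2⟩
        rcases Nat.lt_succ_iff_lt_or_eq.1 h1 with h | h
        · exact Or.inr ⟨y, h, h2⟩
        · obtain rfl : y = ⟨j, hj⟩ := Fin.ext h
          exact Or.inl h2
      · rintro (h | ⟨y, h1, h2⟩)
        · exact ⟨⟨j, hj⟩, by simp, h⟩
        · exact ⟨y, by omega, h2⟩
    have hval : m₁.natArr 2 j = if (⟨j, hj⟩ : Fin n) ∈ S then 1 else 0 := by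
      rw [eS]; exact hS ⟨j, hj⟩
    refine (Does.instr_seq rfl (Does.instr_seq rfl
      (Does.ite (T := 5 * n + 8) (fun hb => ?_) (fun hb => Does.skip (by omega) ?_)))).time
      (by rw [pow_one]; omega)
    all_goals simp [Test.Holds, hj₁, hval] at hb
    · replace hb : (⟨j, hj⟩ : Fin n) ∈ S := by
        by_contra hcon
        simp [hcon] at hb
      refine (Does.seq (does_entry _ (by decide)) (T' := 4) fun m₂ hf₂ h₂ => ?_).time
        (by simp [hm₁.size])
      have e0 : m₂.realReg 0 = ρ := by rw [hf₂.realReg 0 (by decide)]; exact hm₁.radius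
      have e33 : m₂.natReg 33 = m₁.natReg 33 := by rw [hf₂.natReg 33 (by decide)]; simp
      have eD₂ : m₂.realArr 1 = m.realArr 1 := by rw [hf₂.realArr 1 (by decide)]; exact eD
      have e10 : m₂.natReg 10 = x * n + j := by simpa [e32, hj₁, hm₁.size] using h₂
      refine Does.instr_seq rfl (Does.ite (T := 1) (fun hb' => Does.instr rfl ?_)
        (fun hb' => Does.skip le_rfl ?_))
      all_goals
        simp only [Test.Holds, Mem.setReal_realReg, e10, eD₂] at hb'
        rw [if_pos trivial, if_neg (by decide), e0] at hb'
        have hd := hD x ⟨j, hj⟩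
        rw [distMat] at hd
        rw [hd] at hb'
      · simp only [Mem.setNat_natReg]
        exact ⟨fun _ => hstep.2 (Or.inl ⟨hb, hb'⟩), fun _ => by simp⟩
      · rw [hstep]
        simp [e33, hinv, hb']
    · rw [hstep]
      simp [hinv, hb]
  · intro m₁ _ h
    rw [h]
    exact ⟨fun ⟨y, _, h2⟩ => ⟨y, h2⟩, fun ⟨y, h2⟩ => ⟨y, y.2, h2⟩⟩
  · have h3 : n * (17 * B ^ 1 + 4) + 2 ≤ 23 * B ^ 2 := time_forLoop hnB hB le_rfl
    have h4 : 1 ≤ B ^ 2 := Nat.one_le_pow _ _ hB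
    omega

theorem DistOK.frame {m m' : Mem} (h : DistOK G w ρ m) {c : Cmd} (hf : Frame c m m')
    (hc : Loc.realArr 1 ∉ c.writes) : DistOK G w ρ m' := by
  intro i j
  rw [distMat, hf.realArr 1 hc]
  exact h i j

theorem does_check {m : Mem} (hm : HasInput G w ρ m) (hD : DistOK G w ρ m) (hnB : n ≤ B)
    (hB : 1 ≤ B) {S : Finset (Fin n)} (hS : IsIndicator (m.natArr 2) S) :
    Does .check m (42 * B ^ 3) fun m' => (1 ≤ m'.natReg 31 ↔ IsRhoDominating G w ρ S) := by
  have hm' : HasInput G w ρ (m.setNat 31 1) :=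
    hm.frame (c := .instr (.natConst 31 1)) (Cmd.Big.instr rfl).frame (by decide)
  refine (Does.instr_seq rfl ((Does.forLoop (n := n) (T := 35 * B ^ 2)
    (fun j m' => 1 ≤ m'.natReg 31 ↔ ∀ x : Fin n, (x : ℕ) < j →
      ∃ y ∈ S, weightedDist G w x y ≤ ENNReal.ofReal ρ)
    hm'.size (by decide) (by simp) ?_).mono le_rfl ?_)).time ?_
  · intro j hj m₁ hf₁ hj₁ hinv
    have eS : m₁.natArr 2 = m.natArr 2 := by rw [hf₁.natArr 2 (by decide)]; rfl
    have hD₁ : DistOK G w ρ m₁ := DistOK.frame (m := m.setNat 31 1) hD hf₁ (by decide)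
    have hstep : (∀ x : Fin n, (x : ℕ) < j + 1 →
        ∃ y ∈ S, weightedDist G w x y ≤ ENNReal.ofReal ρ) ↔
        (∃ y ∈ S, weightedDist G w ⟨j, hj⟩ y ≤ ENNReal.ofReal ρ) ∧
        ∀ x : Fin n, (x : ℕ) < j → ∃ y ∈ S, weightedDist G w x y ≤ ENNReal.ofReal ρ := by
      constructor
      · exact fun h => ⟨h ⟨j, hj⟩ (by simp), fun x hx => h x (by omega)⟩
      · rintro ⟨h1, h2⟩ x hx
        rcases Nat.lt_succ_iff_lt_or_eq.1 hx with h | h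
        · exact h2 x h
        · obtain rfl : x = ⟨j, hj⟩ := Fin.ext h
          exact h1
    refine (Does.seq (does_checkVertex (hm'.frame hf₁ (by decide)) hD₁ hnB hB (eS ▸ hS)
      (x := ⟨j, hj⟩) hj₁) (T' := 4) fun m₂ hf₂ h₂ => ?_).time ?_
    · have e31 : m₂.natReg 31 = m₁.natReg 31 := hf₂.natReg 31 (by decide)
      refine Does.instr_seq rfl (T := 3) (Does.ite (T := 1) (fun hb => Does.skip le_rfl ?_)
        (fun hb => Does.instr rfl ?_))
      all_goals
        simp only [Test.Holds, Mem.setNat_natReg] at hb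
        rw [if_pos trivial, if_neg (by decide), h₂] at hb
      · rw [hstep]
        simp only [hb, true_and, ← hinv]
        simp [e31]
      · rw [hstep]
        simp [hb]
    · have h4 : 1 ≤ B ^ 2 := Nat.one_le_pow _ _ hB
      omega
  · intro m₁ _ h
    rw [h]
    exact ⟨fun h x => h x x.2, fun h x _ => h x⟩
  · have h3 : n * (35 * B ^ 2 + 4) + 2 ≤ 41 * B ^ 3 := time_forLoop hnB hB le_rfl
    have h4 : 1 ≤ B ^ 3 := Nat.one_le_pow _ _ hB
    omega

end Search

end RealRAM

/-! ### The local search loop. -/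

namespace RealRAM

section Search

variable {n : ℕ} {G : SimpleGraph (Fin n)} {w : Sym2 (Fin n) → ℝ≥0} {ρ : ℝ} {B s : ℕ}

/-- The memory holds the input and all data that the search needs. -/
structure Ready (G : SimpleGraph (Fin n)) (w : Sym2 (Fin n) → ℝ≥0) (ρ : ℝ) (s : ℕ) (m : Mem) :
    Prop where
  input : HasInput G w ρ m
  dist : DistOK G w ρ m
  base : m.natReg 2 = n + 1
  swap : m.natReg 4 = s
  count : m.natReg 5 = (n + 1) ^ s

theorem Ready.frame {m m' : Mem} (h : Ready G w ρ s m) {c : Cmd} (hf : Frame c m m')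
    (hc : (Loc.natReg 0 ∉ c.writes ∧ Loc.natArr 0 ∉ c.writes ∧ Loc.realArr 0 ∉ c.writes ∧
      Loc.realReg 0 ∉ c.writes) ∧ Loc.realArr 1 ∉ c.writes ∧ Loc.natReg 2 ∉ c.writes ∧
      Loc.natReg 4 ∉ c.writes ∧ Loc.natReg 5 ∉ c.writes) : Ready G w ρ s m' := by
  obtain ⟨h1, h2, h3, h4, h5⟩ := hc
  exact ⟨h.input.frame hf h1, h.dist.frame hf h2, by rw [hf.natReg 2 h3, h.base],
    by rw [hf.natReg 4 h4, h.swap], by rw [hf.natReg 5 h5, h.count]⟩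

theorem does_candidate {m : Mem} (hm : Ready G w ρ s m) (hn : 0 < n) (hnB : n ≤ B) (hsB : s ≤ B)
    (hB : 1 ≤ B) {q : ℕ} (hq : m.natReg 24 = q) (hqB : q ≤ B) {S : Finset (Fin n)}
    (hS : IsIndicator (m.natArr 1) S) :
    Does .candidate m (115 * B ^ 3) fun m' => ∃ S', IsIndicator (m'.natArr 1) S' ∧
      (S' = flipDigits s q S ∧ IsRhoDominating G w ρ S' ∧ S'.card < S.card ∨
        S' = S ∧ ¬ (IsRhoDominating G w ρ (flipDigits s q S) ∧
          (flipDigits s q S).card < S.card)) := by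
  set T := flipDigits s q S with hT
  have hpow : 1 ≤ B ^ 3 ∧ B ≤ B ^ 3 ∧ B ^ 2 ≤ B ^ 3 :=
    ⟨Nat.one_le_pow _ _ hB, Nat.le_self_pow (by omega) B, Nat.pow_le_pow_right hB (by omega)⟩
  refine (Does.seq (does_copy (a := 1) (b := 2) (by decide) hm.input.size hnB hB)
    (T' := 28 * B ^ 2 + (42 * B ^ 3 + (9 * B + (9 * B + (8 * B + 5)))))
    fun m₁ hf₁ h₁ => ?_).time (by omega)
  have hm₁ := hm.frame hf₁ (by decide)
  have hS₁ : IsIndicator (m₁.natArr 2) S := fun v => by rw [h₁ v v.2]; exact hS v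
  refine Does.seq (does_flips hn hm₁.base hm₁.swap (q := q) ?_ hsB hqB hB hS₁)
    fun m₂ hf₂ h₂ => ?_
  · rw [hf₁.natReg 24 (by decide), hq]
  have hm₂ := hm₁.frame hf₂ (by decide)
  refine Does.seq (does_check hm₂.input hm₂.dist hnB hB h₂) fun m₃ hf₃ h₃ => ?_
  have hm₃ := hm₂.frame hf₃ (by decide)
  have e1 : m₃.natArr 1 = m.natArr 1 := by
    rw [hf₃.natArr 1 (by decide), hf₂.natArr 1 (by decide), hf₁.natArr 1 (by decide)]
  have e2 : IsIndicator (m₃.natArr 2) T := by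
    rw [hf₃.natArr 2 (by decide)]; exact h₂
  refine Does.seq (does_sum (d := 35) (a := 1) (by decide) hm₃.input.size hnB hB
    (S := S) (e1 ▸ hS)) fun m₄ hf₄ h₄ => ?_
  have hm₄ := hm₃.frame hf₄ (by decide)
  refine Does.seq (does_sum (d := 36) (a := 2) (by decide) hm₄.input.size hnB hB
    (S := T) (by rw [hf₄.natArr 2 (by decide)]; exact e2)) fun m₅ hf₅ h₅ => ?_
  have hm₅ := hm₄.frame hf₅ (by decide)
  have k1 : m₅.natArr 1 = m.natArr 1 := by
    rw [hf₅.natArr 1 (by decide), hf₄.natArr 1 (by decide), e1]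
  have k2 : IsIndicator (m₅.natArr 2) T := by
    rw [hf₅.natArr 2 (by decide), hf₄.natArr 2 (by decide)]; exact e2
  have k31 : 1 ≤ m₅.natReg 31 ↔ IsRhoDominating G w ρ T := by
    rw [hf₅.natReg 31 (by decide), hf₄.natReg 31 (by decide)]; exact h₃
  have k35 : m₅.natReg 35 = S.card := by rw [hf₅.natReg 35 (by decide), h₄]
  refine Does.ite (T := 8 * B + 3) (fun hb => Does.skip (by omega) ⟨S, ?_, Or.inr ⟨rfl, ?_⟩⟩)
    (fun hb => ?_)
  · rw [Mem.setNat_natArr, k1]; exact hS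
  · simp only [Test.Holds, k35, h₅] at hb
    exact fun h => absurd h.2 (not_lt.2 hb)
  · simp only [Test.Holds, k35, h₅, not_le] at hb
    refine (Does.instr_seq rfl (Does.ite (T := 8 * B) (fun hb' => ?_)
      (fun hb' => Does.skip (by omega) ⟨S, ?_, Or.inr ⟨rfl, ?_⟩⟩))).time (by omega)
    · replace hb' : IsRhoDominating G w ρ T := k31.1 (by simpa [Test.Holds] using hb')
      refine (does_copy (a := 2) (b := 1) (by decide) (by simpa using hm₅.input.size) hnB
        hB).mono le_rfl fun m₆ _ h₆ => ⟨T, fun v => ?_, Or.inl ⟨rfl, hb', hb⟩⟩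
      rw [h₆ v v.2]
      exact k2 v
    · rw [Mem.setNat_natArr, Mem.setNat_natArr, k1]; exact hS
    · replace hb' : ¬ IsRhoDominating G w ρ T := fun h =>
        hb' (by simpa [Test.Holds] using k31.2 h)
      exact fun h => hb' h.1

/-- No further iteration of the local search is possible. -/
def Terminal (G : SimpleGraph (Fin n)) (w : Sym2 (Fin n) → ℝ≥0) (ρ : ℝ) (s : ℕ)
    (S : Finset (Fin n)) : Prop := ∀ S', ¬ LocalSearchStep G w ρ s S S'

/-- Improvements are adopted immediately and the enumeration goes on from the new set. If none
occurred, all swaps were tried on `S` itself, which is then a local optimum by `exists_flipDigits`.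
-/
theorem does_pass {m : Mem} (hm : Ready G w ρ s m) (hn : 0 < n) (hnB : n ≤ B) (hsB : s ≤ B)
    (hMB : (n + 1) ^ s ≤ B) (hB : 1 ≤ B) {S : Finset (Fin n)} (hS : IsIndicator (m.natArr 1) S) :
    Does (.forLoop 24 5 .candidate) m (121 * B ^ 4) fun m' => ∃ S', IsIndicator (m'.natArr 1) S' ∧
      Relation.ReflTransGen (LocalSearchStep G w ρ s) S S' ∧
      (Terminal G w ρ s S ∨ S'.card < S.card) := by
  refine (Does.forLoop (n := (n + 1) ^ s) (T := 115 * B ^ 3)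
    (fun j m' => ∃ S', IsIndicator (m'.natArr 1) S' ∧
      Relation.ReflTransGen (LocalSearchStep G w ρ s) S S' ∧
      (S' = S ∧ (∀ q < j, ¬ (IsRhoDominating G w ρ (flipDigits s q S) ∧
        (flipDigits s q S).card < S.card)) ∨ S'.card < S.card))
    hm.count (by decide) ⟨S, hS, .refl, Or.inl ⟨rfl, by simp⟩⟩ ?_).mono
    (time_forLoop hMB hB le_rfl) ?_
  · rintro q hq m₁ hf₁ hq₁ ⟨S₁, hS₁, hreach, hcase⟩
    refine (does_candidate (hm.frame hf₁ (by decide)) hn hnB hsB hB hq₁ (hq.le.trans hMB)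
      hS₁).mono le_rfl ?_
    rintro m₂ - ⟨S₂, hS₂, h2⟩
    refine ⟨S₂, hS₂, ?_⟩
    have hcard := card_symmDiff_flipDigits s q S₁
    rcases h2 with ⟨rfl, hdom, hlt⟩ | ⟨rfl, hno⟩
    · refine ⟨hreach.tail ⟨hdom, hlt, by rwa [card_sdiff_add_card_sdiff]⟩, Or.inr ?_⟩
      rcases hcase with ⟨rfl, -⟩ | h
      · exact hlt
      · exact hlt.trans h
    · refine ⟨hreach, hcase.imp_left ?_⟩
      rintro ⟨rfl, h⟩
      refine ⟨rfl, fun q' hq' => ?_⟩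
      rcases Nat.lt_succ_iff_lt_or_eq.1 hq' with h' | rfl
      · exact h q' h'
      · exact hno
  · rintro m₁ - ⟨S₁, hS₁, hreach, hcase⟩
    refine ⟨S₁, hS₁, hreach, hcase.imp_left ?_⟩
    rintro ⟨-, h⟩ S' ⟨hdom, hlt, hcard⟩
    rw [card_sdiff_add_card_sdiff] at hcard
    obtain ⟨q, hq, rfl⟩ := exists_flipDigits s S S' hcard
    exact h q hq ⟨hdom, hlt⟩

/-- The set starts with `n` elements and each pass removes at least one unless its starting set is
terminal, so `n + 1` passes cannot all shrink it. -/
theorem does_search {m : Mem} (hm : Ready G w ρ s m) (hn : 0 < n) (hnB : n + 1 ≤ B) (hsB : s ≤ B)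
    (hMB : (n + 1) ^ s ≤ B) :
    Does .search m (140 * B ^ 5) fun m' => ∃ S, IsIndicator (m'.natArr 1) S ∧
      IsLocalSearchResult G w ρ s S := by
  have hB : 1 ≤ B := by omega
  have hm' : Ready G w ρ s (m.setNat 9 1) :=
    hm.frame (c := .instr (.natConst 9 1)) (Cmd.Big.instr rfl).frame (by decide)
  refine (Does.instr_seq rfl (Does.seq (Does.forLoop (n := n) (T := 1 * B ^ 0)
    (fun j m' => ∀ v < j, m'.natArr 1 v = 1) hm'.input.size (by decide) (by simp) ?_)
    (T' := 127 * B ^ 5) fun m₁ hf₁ h₁ => ?_)).time ?_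
  · intro j hj m₁ hf₁ hj₁ hinv
    have e9 : m₁.natReg 9 = 1 := by rw [hf₁.natReg 9 (by decide)]; simp
    refine Does.instr rfl ?_
    intro v hv
    simp only [Mem.setNat_natArr, Mem.storeNat_natArr, if_true, Function.update_apply, hj₁, e9]
    split_ifs with h
    · rfl
    · exact hinv v (by omega)
  · have hm₁ := hm'.frame hf₁ (by decide)
    refine (Does.forLoop (n := n + 1) (T := 121 * B ^ 4)
      (fun j m' => ∃ S, IsIndicator (m'.natArr 1) S ∧
        Relation.ReflTransGen (LocalSearchStep G w ρ s) Finset.univ S ∧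
        (Terminal G w ρ s S ∨ S.card + j ≤ n)) hm₁.base (by decide)
      ⟨Finset.univ, fun v => by simpa using h₁ v v.2, .refl, Or.inr (by simp)⟩ ?_).mono
      (time_forLoop hnB hB le_rfl) ?_
    · rintro j hj m₂ hf₂ - ⟨S, hS, hreach, hcase⟩
      refine (does_pass (hm₁.frame hf₂ (by decide)) hn (by omega) hsB hMB hB hS).mono le_rfl ?_
      rintro m₃ - ⟨S', hS', hreach', hcase'⟩
      refine ⟨S', hS', hreach.trans hreach', ?_⟩
      -- No step leaves a terminal set, so later passes do not change it.
      have hterm : Terminal G w ρ s S → Terminal G w ρ s S' := by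
        intro h
        rcases hreach'.cases_head with rfl | ⟨S₂, h2, -⟩
        · exact h
        · exact absurd h2 (h S₂)
      rcases hcase' with h | h
      · exact Or.inl (hterm h)
      · exact hcase.imp hterm fun h' => by omega
    · rintro m₂ - ⟨S, hS, hreach, hcase⟩
      exact ⟨S, hS, hreach, hcase.resolve_right (by omega)⟩
  · have h3 : n * (1 * B ^ 0 + 4) + 2 ≤ 7 * B ^ 1 := time_forLoop (by omega) hB le_rfl
    have h4 : B ^ 1 ≤ B ^ 5 := Nat.pow_le_pow_right hB (by omega)
    have h5 : 1 ≤ B ^ 5 := Nat.one_le_pow _ _ hB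
    omega

end Search

/-- The whole algorithm. -/
def Cmd.main (C : ℕ) : Cmd :=
  .instr (.natConst 1 1) ;;
  .ite (.nat 0 1) (.instr (.natConst 9 0) ;; .instr (.natStore 1 9 1))
    (.ceilDiv C ;; .setup ;; .distances ;; .search)

/-! ### The whole algorithm and its running time. -/

section Main

variable {n : ℕ} (G : SimpleGraph (Fin n)) (w : Sym2 (Fin n) → ℝ≥0) (ρ ε : ℝ)

/-- The memory of the start configuration. -/
noncomputable def startMem : Mem :=
  ⟨(start G w ρ ε).natReg, (start G w ρ ε).natArr, (start G w ρ ε).realReg, (start G w ρ ε).realArr⟩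

theorem startMem_toConfig : (startMem G w ρ ε).toConfig 0 = start G w ρ ε := rfl

theorem hasInput_startMem : HasInput G w ρ (startMem G w ρ ε) := by
  classical
  have hpos : ∀ i j i' j' : Fin n, (i : ℕ) * n + j = i' * n + j' ↔ i = i' ∧ j = j' := by
    intro i j i' j'
    rw [mul_add_inj j.2 j'.2, Fin.ext_iff, Fin.ext_iff]
  refine ⟨by simp [startMem, start], fun i j => ?_, fun i j hij => ?_, by simp [startMem, start]⟩
  · simp only [startMem, start]
    refine if_congr ?_ rfl rfl
    constructor
    · rintro ⟨i', j', -, h, hadj⟩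
      obtain ⟨rfl, rfl⟩ := (hpos _ _ _ _).1 h
      exact hadj
    · exact fun h => ⟨i, j, trivial, rfl, h⟩
  · simp only [startMem, start]
    rw [Finset.sum_eq_single i, Finset.sum_eq_single j]
    · rw [if_pos ⟨trivial, rfl, hij⟩]
    · intro j' _ hj'
      rw [if_neg]
      rintro ⟨-, h, -⟩
      exact hj' ((hpos _ _ _ _).1 h).2.symm
    · simp
    · intro i' _ hi'
      refine Finset.sum_eq_zero fun j' _ => if_neg ?_
      rintro ⟨-, h, -⟩
      exact hi' ((hpos _ _ _ _).1 h).1.symm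
    · simp

variable {G w ρ ε}

theorem isLocalSearchResult_of_le_one (hn : 0 < n) (hn1 : n ≤ 1) (s : ℕ) :
    IsLocalSearchResult G w ρ s Finset.univ := by
  refine ⟨.refl, ?_⟩
  rintro S' ⟨hdom, hlt, -⟩
  obtain ⟨y, hy, -⟩ := hdom ⟨0, hn⟩
  have := Finset.card_pos.2 ⟨y, hy⟩
  rw [Finset.card_univ, Fintype.card_fin] at hlt
  omega

/-- A single vertex is treated separately: there `n ^ (K / ε ^ 2)` equals `1`, so not even the time
to compute `⌈C / ε⌉` is available. Hence the bound on `B` is required only for `2 ≤ n`, and `B = 1`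
can be taken otherwise. -/
theorem does_main (hn : 0 < n) (hε : 0 < ε) (hρ : 0 < ρ) {C : ℕ} (hC : 0 < C) {B : ℕ}
    (hB : 2 ≤ n → (n + 1) ^ ⌈(C : ℝ) / ε⌉₊ ^ 2 ≤ B) (hB1 : 1 ≤ B) :
    Does (.main C) (startMem G w ρ ε) (300 * B ^ 5) fun m' =>
      ∃ S, IsIndicator (m'.natArr 1) S ∧ IsLocalSearchResult G w ρ (⌈(C : ℝ) / ε⌉₊ ^ 2) S := by
  set m := startMem G w ρ ε with hm
  set k := ⌈(C : ℝ) / ε⌉₊ with hk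
  have hin : HasInput G w ρ (m.setNat 1 1) := (hasInput_startMem G w ρ ε).frame
    (c := .instr (.natConst 1 1)) (Cmd.Big.instr rfl).frame (by decide)
  have h5 : 1 ≤ B ^ 5 := Nat.one_le_pow _ _ hB1
  refine (Does.instr_seq rfl (Does.ite (T := 290 * B ^ 5) (fun hb => ?_) fun hb => ?_)).time
    (by omega)
  all_goals
    simp only [Test.Holds, hin.size] at hb
    simp only [Mem.setNat_natReg, if_true] at hb
  · refine (Does.instr_seq rfl (T := 1) (Does.instr rfl
      ⟨Finset.univ, fun v => ?_, isLocalSearchResult_of_le_one hn hb _⟩)).time (by omega)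
    have hv : (v : ℕ) = 0 := by omega
    simp [hv]
  · have hB' := hB (by omega)
    have hk1 : 1 ≤ k := Nat.one_le_ceil_iff.2 (by positivity)
    have hs1 : k ^ 2 ≠ 0 := by positivity
    have hnB : n + 1 ≤ B := (Nat.le_self_pow hs1 _).trans hB'
    have hsB : k * k ≤ B := by
      rw [← pow_two]
      exact (Nat.lt_pow_self (by omega)).le.trans hB'
    have hkB : k ≤ B := (Nat.le_mul_self k).trans hsB
    have hr1 : (m.setNat 1 1).realReg 1 = ε := by simp [hm, startMem, start]
    have hp : B ≤ B ^ 5 ∧ B ^ 2 ≤ B ^ 5 :=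
      ⟨Nat.le_self_pow (by omega) B, Nat.pow_le_pow_right hB1 (by omega)⟩
    refine (Does.seq (does_ceilDiv C _ hε hr1) (T' := 30 * B ^ 2 + (109 * B ^ 5 + 140 * B ^ 5))
      fun m₁ hf₁ h₁ => ?_).time (by omega)
    have hin₁ := hin.frame hf₁ (by simp [Cmd.ceilDiv, Cmd.writes, Instr.writes])
    refine Does.seq (does_setup m₁ hin₁.size h₁ hnB hsB) fun m₂ hf₂ h₂ => ?_
    have hin₂ := hin₁.frame hf₂ (by decide)
    refine Does.seq (does_distances hin₂ hρ (by omega) hB1) fun m₃ hf₃ h₃ => ?_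
    rw [← hk, ← pow_two] at h₂
    refine does_search ⟨hin₂.frame hf₃ (by decide), h₃, ?_, ?_, ?_⟩ hn hnB
      (by rw [pow_two]; exact hsB) hB'
    · rw [hf₃.natReg 2 (by decide), h₂.1]
    · rw [hf₃.natReg 4 (by decide), h₂.2.1]
    · rw [hf₃.natReg 5 (by decide), h₂.2.2]

end Main

end RealRAM

/-- For `n ≥ 2` one has `n + 1 ≤ n ^ 2`, which doubles the exponent `5 * ⌈C / ε⌉ ^ 2`; rounding is
absorbed by `⌈C / ε⌉ ≤ (C + 1) / ε`, as `1 ≤ 1 / ε`. -/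
theorem pow_ceil_le_rpow {C n : ℕ} {ε : ℝ} (hε : 0 < ε) (hε2 : ε < 1 / 2) (hn : 2 ≤ n) :
    (((n + 1) ^ ⌈(C : ℝ) / ε⌉₊ ^ 2 : ℕ) : ℝ) ^ 5 ≤ (n : ℝ) ^ ((10 * (C + 1) ^ 2 : ℝ) / ε ^ 2) := by
  have hk : ((⌈(C : ℝ) / ε⌉₊ : ℕ) : ℝ) ≤ (C + 1) / ε := by
    have h1 := Nat.ceil_lt_add_one (div_nonneg (Nat.cast_nonneg C) hε.le : (0 : ℝ) ≤ C / ε)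
    have h2 : (1 : ℝ) ≤ 1 / ε := by
      rw [le_div_iff₀ hε]; linarith
    rw [add_div]
    linarith
  have hn1 : (1 : ℝ) ≤ n := by exact_mod_cast (by omega : 1 ≤ n)
  have hsq : (n + 1 : ℕ) ≤ n ^ 2 := by nlinarith
  calc (((n + 1) ^ ⌈(C : ℝ) / ε⌉₊ ^ 2 : ℕ) : ℝ) ^ 5
      ≤ (((n ^ 2) ^ ⌈(C : ℝ) / ε⌉₊ ^ 2 : ℕ) : ℝ) ^ 5 := by gcongr
    _ = (n : ℝ) ^ ((10 * ⌈(C : ℝ) / ε⌉₊ ^ 2 : ℕ) : ℝ) := by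
        rw [Real.rpow_natCast]
        push_cast
        rw [← pow_mul, ← pow_mul]
        congr 1
        ring
    _ ≤ (n : ℝ) ^ ((10 * (C + 1) ^ 2 : ℝ) / ε ^ 2) := by
        refine Real.rpow_le_rpow_of_exponent_le hn1 ?_
        push_cast
        calc (10 : ℝ) * (⌈(C : ℝ) / ε⌉₊ : ℝ) ^ 2 ≤ 10 * ((C + 1) / ε) ^ 2 := by gcongr
          _ = _ := by rw [div_pow]; ring

theorem mainTheorem10 (h : ℕ) :
    ∃ (C : ℕ) (K : ℝ) (P : RealRAM.Program),
      ∀ (H : SimpleGraph (Fin h)) (n : ℕ), 0 < n →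
      ∀ (G : SimpleGraph (Fin n)), ¬ IsGraphMinor H G →
      ∀ (w : Sym2 (Fin n) → ℝ≥0) (ε ρ : ℝ), 0 < ε → ε < 1 / 2 → 0 < ρ →
        (∀ S : Finset (Fin n), IsLocalSearchResult G w ρ (⌈(C : ℝ) / ε⌉₊ ^ 2) S →
          IsRhoDominating G w ρ S ∧
          ∀ S' : Finset (Fin n), IsRhoDominating G w ρ S' →
            (S.card : ℝ) ≤ (1 + ε) * (S'.card : ℝ)) ∧
        ∃ (S : Finset (Fin n)) (t : ℕ) (c : RealRAM.Config),
          RealRAM.HaltsIn P t (RealRAM.start G w ρ ε) c ∧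
          (t : ℝ) ≤ K * (n : ℝ) ^ (K / ε ^ 2) ∧
          RealRAM.Outputs c S ∧
          IsLocalSearchResult G w ρ (⌈(C : ℝ) / ε⌉₊ ^ 2) S := by
  -- `C` comes from the approximation ratio. `K` is the sum of the factor `300` from `does_main` and
  -- the numerator `10 * (C + 1) ^ 2` of the exponent, so it dominates both.
  refine ⟨192 * (h + 1) ^ 2, 300 + 10 * ((192 * (h + 1) ^ 2 : ℕ) + 1) ^ 2,
    (RealRAM.Cmd.main (192 * (h + 1) ^ 2)).compile 0, ?_⟩
  intro H n hn G hG w ε ρ hε hε2 hρ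
  refine ⟨fun S hS => ⟨isRhoDominating_of_reflTransGen hS.1 isRhoDominating_univ,
    fun S' hS' => hS.card_le hG hε hε2 (Nat.le_ceil _) hS'⟩, ?_⟩
  set C := 192 * (h + 1) ^ 2 with hC
  have hC0 : 0 < C := by positivity
  have hn1 : (1 : ℝ) ≤ n := by exact_mod_cast hn
  obtain ⟨B, hB, hB1, hBt⟩ : ∃ B : ℕ, (2 ≤ n → (n + 1) ^ ⌈(C : ℝ) / ε⌉₊ ^ 2 ≤ B) ∧ 1 ≤ B ∧
      (B : ℝ) ^ 5 ≤ (n : ℝ) ^ ((10 * (C + 1) ^ 2 : ℝ) / ε ^ 2) := by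
    by_cases h2 : 2 ≤ n
    · exact ⟨_, fun _ => le_rfl, Nat.one_le_pow _ _ (by omega), pow_ceil_le_rpow hε hε2 h2⟩
    · refine ⟨1, fun h => absurd h h2, le_rfl, ?_⟩
      rw [Nat.cast_one, one_pow]
      exact Real.one_le_rpow hn1 (by positivity)
  obtain ⟨t, m', ht, hbig, S, hS, hres⟩ :=
    RealRAM.does_main (G := G) (w := w) hn hε hρ hC0 hB hB1
  refine ⟨S, t, m'.toConfig (RealRAM.Cmd.main C).size,
    RealRAM.startMem_toConfig G w ρ ε ▸ hbig.haltsIn, ?_, hS, hres⟩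
  calc (t : ℝ) ≤ 300 * (B : ℝ) ^ 5 := by exact_mod_cast ht
    _ ≤ (300 + 10 * ((C : ℝ) + 1) ^ 2) * (n : ℝ) ^ ((10 * (C + 1) ^ 2 : ℝ) / ε ^ 2) := by
        gcongr
        have : (0 : ℝ) ≤ ((C : ℝ) + 1) ^ 2 := by positivity
        linarith
    _ ≤ (300 + 10 * ((C : ℝ) + 1) ^ 2) *
        (n : ℝ) ^ ((300 + 10 * ((C : ℝ) + 1) ^ 2) / ε ^ 2) := by
        gcongr
        linarith
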